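/- **Setting.** Alice and Bob share a state $\rho$ of an $N\times N$ system $\mathcal H_N^A\otimes\mathcal H_N^B$ and the auxiliary state $\Psi_K$, where $\Psi_N=N^{-1/2}\sum_{i<N}|i\rangle^A|i\rangle^B$. The fidelity of $\rho$ is $F(\rho)=\langle\Psi_N|\rho|\Psi_N\rangle$. A general entanglement purification protocol (GEPP) $\mathcal P$ acts by local quantum operations and classical communication, and either outputs $\mathsf{FAIL}$ or a state of an $M\times M$ system. The state $\rho$ is a mixed state in the diagonal subspace if it is an ensemble of pure states of the form $\sum_i\alpha_i|i\rangle^A|i\rangle^B$. The protocol $\mathcal P$ is deterministically conditionally successful with parameter $\langle N,K,M,\epsilon,\delta,p\rangle$ for mixed states in the diagonal subspace if, for every such $\rho$ with $F(\rho)=1-\epsilon$, $$\Pr[\mathcal P(\rho)=\mathsf{FAIL}]\le p\quad\text{and}\quad \Pr[F(\mathcal P(\rho))\ge 1-\delta\mid\mathcal P(\rho)\ne\mathsf{FAIL}]=1 .$$ A family of GEPPs is efficient if there is a constant $c$ such that its members are implemented by quantum circuits of size $O((\log N+\log K)^c)$, with the same constants for the whole family. **Theorem.** For all integers $n,t,d$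 with $n>t\ge 0$ and $d\ge 1$ and all real $\epsilon<1/2$ there exist efficient GEPPs that are deterministically conditionally successful, for mixed states in the diagonal subspace, with the parameters 1. $\left\langle 2^n,\ 2^n-1,\ 2^{n-t}(2^n-1),\ \epsilon,\ \frac{2\epsilon}{2^t},\ \epsilon\right\rangle$; 2. $\left\langle 2^{2n},\ 2^n+1,\ 2^n(2^n+1),\ \epsilon,\ \frac{2\epsilon}{2^n},\ \epsilon\right\rangle$; 3. $\left\langle 2^{dn},\ \frac{2^{dn}-1}{2^n-1},\ 2^{(d-1)n}\,\frac{2^{dn}-1}{2^n-1},\ \epsilon,\ \frac{2\epsilon}{2^n},\ \epsilon\right\rangle$. The protocols do not depend on $\epsilon$. With $L=2^t$ in 1 and $L=2^n$ in 2 and 3, the fifth parameter, which is $2\epsilon/L$ above, can be replaced, for the same protocols, by $\epsilon/L$ whenever $\epsilon\le L/N$. -/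

import Mathlib

open Matrix
open scoped Kronecker ComplexOrder

noncomputable section

namespace Purification

/-! ### Bipartite states -/

/-- The rank-one operator `|φ⟩⟨φ|`. -/
def dyad {ι : Type*} (φ : ι → ℂ) : Matrix ι ι ℂ := vecMulVec φ (star φ)

/-- The maximally entangled state `Ψ_N = N^{-1/2} ∑ᵢ |i⟩|i⟩`. -/
def maxEnt (N : ℕ) : Fin N × Fin N → ℂ :=
  fun a => if a.1 = a.2 then ((1 / Real.sqrt N : ℝ) : ℂ) else 0

/-- Density matrices. -/
def IsDensity {ι : Type*} [Fintype ι] (ρ : Matrix ι ι ℂ) : Prop :=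
  ρ.PosSemidef ∧ ρ.trace = 1

/-- The fidelity `F(ρ) = ⟨Ψ_N|ρ|Ψ_N⟩` of a state `ρ` of an `N × N` system. -/
def fidelity {N : ℕ} (ρ : Matrix (Fin N × Fin N) (Fin N × Fin N) ℂ) : ℝ :=
  (star (maxEnt N) ⬝ᵥ (ρ *ᵥ maxEnt N)).re

/-- `ρ` is a mixed state in the diagonal subspace: an ensemble of unit vectors, each of which is
in the span of the vectors `|i⟩|i⟩`. -/
def InDiagonal {N : ℕ} (ρ : Matrix (Fin N × Fin N) (Fin N × Fin N) ℂ) : Prop :=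
  ∃ (s : ℕ) (p : Fin s → ℝ) (φ : Fin s → Fin N × Fin N → ℂ),
    (∀ k, 0 ≤ p k) ∧ ∑ k, p k = 1 ∧
    (∀ k, ∑ a, ‖φ k a‖ ^ 2 = 1) ∧
    (∀ k (a : Fin N × Fin N), a.1 ≠ a.2 → φ k a = 0) ∧
    ρ = ∑ k, ((p k : ℝ) : ℂ) • dyad (φ k)

/-! ### Local quantum circuits with classical communication -/

/-- The two parties. -/
inductive Party
  | alice
  | bob
  deriving DecidableEq

instance : Fintype Party where
  elems := {Party.alice, Party.bob}
  complete := by intro p; cases p <;> simp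

/-- The other party. -/
def Party.other : Party → Party
  | .alice => .bob
  | .bob => .alice

/-- Computational basis states when each party holds `w` qubits. -/
abbrev Basis (w : ℕ) : Type := Party × Fin w → Bool

/-- Elementary steps. Every gate acts on the qubits of one party only; the gates are NOT, Hadamard,
the `π/8` gate, controlled NOT and Toffoli. The step `send p q r` is one bit of classical
communication: party `p` measures qubit `q` in the computational basis and announces the result,
and the other party negates its qubit `r` if the result is `1`. -/
inductive Step (w : ℕ)
  | flip (p : Party) (q : Fin w)
  | hadamard (p : Party) (q : Fin w)
  | phase (p : Party) (q : Fin w)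
  | cnot (p : Party) (c q : Fin w) (h : c ≠ q)
  | toffoli (p : Party) (b c q : Fin w) (hbc : b ≠ c) (hb : b ≠ q) (hc : c ≠ q)
  | send (p : Party) (q r : Fin w)

section

variable {w : ℕ}

/-- The operator that maps each basis state `|s⟩` to `|f s⟩`. -/
def basisMap (f : Basis w → Basis w) : Matrix (Basis w) (Basis w) ℂ :=
  Matrix.of fun s' s => if s' = f s then 1 else 0

/-- Negation of one qubit, on basis states. -/
def negate (a : Party × Fin w) (s : Basis w) : Basis w := Function.update s a (!(s a))

/-- The projection onto the basis states in which qubit `a` has the value `b`. -/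
def proj (a : Party × Fin w) (b : Bool) : Matrix (Basis w) (Basis w) ℂ :=
  Matrix.diagonal fun s => if s a = b then 1 else 0

/-- The Hadamard gate on qubit `a`. -/
def hadamardMat (a : Party × Fin w) : Matrix (Basis w) (Basis w) ℂ :=
  Matrix.of fun s' s =>
    if ∀ c, c ≠ a → s' c = s c then
      ((1 / Real.sqrt 2 : ℝ) : ℂ) * (if (s' a && s a) = true then -1 else 1)
    else 0

/-- The gate `diag(1, e^{iπ/4})` on qubit `a`. -/
def phaseMat (a : Party × Fin w) : Matrix (Basis w) (Basis w) ℂ :=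
  Matrix.diagonal fun s =>
    if s a = true then Complex.exp (((Real.pi / 4 : ℝ) : ℂ) * Complex.I) else 1

/-- The Kraus operators of a step, one for each measurement result (gates have only one). -/
def Step.kraus : Step w → List (Matrix (Basis w) (Basis w) ℂ)
  | .flip p q => [basisMap (negate (p, q))]
  | .hadamard p q => [hadamardMat (p, q)]
  | .phase p q => [phaseMat (p, q)]
  | .cnot p c q _ =>
      [basisMap fun s => Function.update s (p, q) (xor (s (p, q)) (s (p, c)))]
  | .toffoli p b c q _ _ _ =>
      [basisMap fun s => Function.update s (p, q) (xor (s (p, q)) (s (p, b) && s (p, c)))]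
  | .send p q r =>
      [proj (p, q) false, basisMap (negate (p.other, r)) * proj (p, q) true]

/-- Run a list of steps. The result is the list of the unnormalized final states, one for each
sequence of measurement results; the trace of such a state is the probability of that sequence. -/
def run : List (Step w) → Matrix (Basis w) (Basis w) ℂ → List (Matrix (Basis w) (Basis w) ℂ)
  | [], σ => [σ]
  | o :: os, σ => o.kraus.flatMap fun A => run os (A * σ * Aᴴ)

end

/-- The contents of one party's qubits at the start, for the basis states `|i⟩` of its half of the
`N × N` system and `|y⟩` of its half of the `K × K` system: the first `⌈log₂ N⌉` qubits hold `i` in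
binary, lowest bit first, the next `⌈log₂ K⌉` qubits hold `y`, and all the others are `0`. -/
def load (N K w : ℕ) (i : Fin N) (y : Fin K) (q : Fin w) : Bool :=
  if (q : ℕ) < Nat.clog 2 N then (i : ℕ).testBit q else (y : ℕ).testBit (q - Nat.clog 2 N)

/-- The isometry that loads an `N × N` system and a `K × K` system into the qubits of the
parties. -/
def loadMat (N K w : ℕ) :
    Matrix (Basis w) ((Fin N × Fin N) × (Fin K × Fin K)) ℂ :=
  Matrix.of fun s a =>
    if s = fun pq => match pq.1 with
      | .alice => load N K w a.1.1 a.2.1 pq.2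
      | .bob => load N K w a.1.2 a.2.2 pq.2
    then 1 else 0

/-- A circuit that acts by local operations and classical communication on an `N × N` system and
the auxiliary `K × K` system: each party has `width` qubits, and the steps are performed in order.
At the end, Alice measures the qubit `flag` and announces the result; `1` means failure. Otherwise
each party outputs the `M`-dimensional system that is written in binary, lowest bit first, on the
qubits `out`, and all the other qubits are discarded. -/
structure Circuit (N K M : ℕ) where
  width : ℕ
  width_le : Nat.clog 2 N + Nat.clog 2 K ≤ width
  steps : List (Step width)
  flag : Fin width
  out : Party → Fin (Nat.clog 2 M) ↪ Fin width

namespace Circuit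

variable {N K M : ℕ} (P : Circuit N K M)

/-- The size of a circuit: the number of its steps and of its qubits. -/
def size : ℕ := P.steps.length + 2 * P.width

/-- The unnormalized states before the final measurement of the flag, for all sequences of
measurement results, on the input `ρ` and the auxiliary input `Ψ_K`. -/
def branches (ρ : Matrix (Fin N × Fin N) (Fin N × Fin N) ℂ) :
    List (Matrix (Basis P.width) (Basis P.width) ℂ) :=
  run P.steps (loadMat N K P.width * (ρ ⊗ₖ dyad (maxEnt K)) * (loadMat N K P.width)ᴴ)

/-- The probability that the circuit fails on the input `ρ`. -/
def failProb (ρ : Matrix (Fin N × Fin N) (Fin N × Fin N) ℂ) : ℝ :=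
  ((P.branches ρ).map fun σ => ((proj (Party.alice, P.flag) true * σ).trace).re).sum

/-- The unnormalized final states without failure. -/
def successes (ρ : Matrix (Fin N × Fin N) (Fin N × Fin N) ℂ) :
    List (Matrix (Basis P.width) (Basis P.width) ℂ) :=
  (P.branches ρ).map fun σ =>
    proj (Party.alice, P.flag) false * σ * proj (Party.alice, P.flag) false

/-- In the basis state `s`, the output qubits of Alice hold `a.1` and those of Bob hold `a.2`. -/
def Reads (s : Basis P.width) (a : Fin M × Fin M) : Prop :=
  ∀ l : Fin (Nat.clog 2 M),
    s (Party.alice, P.out Party.alice l) = (a.1 : ℕ).testBit l ∧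
    s (Party.bob, P.out Party.bob l) = (a.2 : ℕ).testBit l

open Classical in
/-- The partial trace over all the qubits that are not output, in terms of the basis of the
`M × M` system. -/
def output (τ : Matrix (Basis P.width) (Basis P.width) ℂ) :
    Matrix (Fin M × Fin M) (Fin M × Fin M) ℂ :=
  Matrix.of fun a b => ∑ s, ∑ s',
    if P.Reads s a ∧ P.Reads s' b ∧
        (∀ p q, q ∉ Set.range (P.out p) → s (p, q) = s' (p, q))
    then τ s s' else 0

/-- The probability of success. -/
def succProb (ρ : Matrix (Fin N × Fin N) (Fin N × Fin N) ℂ) : ℝ :=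
  ((P.successes ρ).map fun τ => τ.trace.re).sum

open Classical in
/-- The probability that the circuit succeeds and that its (normalized) output state, given all
the measurement results, has fidelity at least `1 - δ`. -/
def goodProb (ρ : Matrix (Fin N × Fin N) (Fin N × Fin N) ℂ) (δ : ℝ) : ℝ :=
  ((P.successes ρ).map fun τ =>
    if 1 - δ ≤ fidelity (((τ.trace)⁻¹) • P.output τ) then τ.trace.re else 0).sum

end Circuit

/-- A general entanglement purification protocol with input in an `N × N` system, auxiliary input
`Ψ_K` and output in an `M × M` system, given by a circuit. On every input state, a circuit that
does not fail has to leave a state of the `M × M` system on its output qubits, that is, no weight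
may lie on bit strings that do not represent numbers below `M`. -/
structure GEPP (N K M : ℕ) extends Circuit N K M where
  output_mem : ∀ ρ, IsDensity ρ → ∀ τ ∈ toCircuit.successes ρ,
    (toCircuit.output τ).trace = τ.trace

/-- The protocol is deterministically conditionally successful with parameter
`⟨N, K, M, ε, δ, p⟩` for mixed states in the diagonal subspace: the probability of failure is at
most `p`, and the conditional probability, given success, that the output has fidelity at least
`1 - δ` is `1`. -/
def GEPP.DetSuccessful {N K M : ℕ} (P : GEPP N K M) (ε δ p : ℝ) : Prop :=
  ∀ ρ : Matrix (Fin N × Fin N) (Fin N × Fin N) ℂ, InDiagonal ρ → fidelity ρ = 1 - ε →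
    P.failProb ρ ≤ p ∧ P.goodProb ρ δ / P.succProb ρ = 1

end Purification

end

/-
Alice and Bob both hold the auxiliary index `y` and apply the same linear bijection `A y` of
`(ZMod 2) ^ a` to the basis labels of their halves of `ρ`. They measure the last `t` bits of the
result in the Hadamard basis and compare the outcomes; if these agree, the measured bits carry no
information on the label and only its first `s` bits survive, next to the index `y`. So two labels
`i ≠ j` are merged exactly for those `y` for which the first `s` bits of `A y (i + j)` vanish, and
the matrices are chosen such that the number of these `y` is the same for all pairs. The success
probability and the fidelity of the output then depend only on `ε`.

In the first construction `A y` is the multiplication with the `y`-th nonzero element of the field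
with `2 ^ n` elements. In the second and third it is a transvection over this field that moves the
`y`-th line of a `d`-dimensional space to the last coordinate axis. Since every nonzero vector lies
on exactly one line, the count is `1`.
-/

noncomputable section

namespace Purification

/-! ### Monomial operators -/

/-- A monomial operator: it maps the basis vector `|i⟩` to `coeff i • |map i⟩`. All the circuits
below consist of such operators, which allows us to follow single basis states through them. -/
@[ext]
structure MonomialOp (ι κ : Type*) where
  coeff : ι → ℂ
  map : ι → κ

namespace MonomialOp

variable {ι κ η : Type*}

/-- The matrix of a monomial operator. -/
def toMatrix [DecidableEq κ] (m : MonomialOp ι κ) : Matrix κ ι ℂ :=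
  Matrix.of fun j i => if j = m.map i then m.coeff i else 0

/-- The composition of two monomial operators, the right one being applied first. -/
def comp (m₂ : MonomialOp κ η) (m₁ : MonomialOp ι κ) : MonomialOp ι η where
  coeff i := m₁.coeff i * m₂.coeff (m₁.map i)
  map i := m₂.map (m₁.map i)

/-- The monomial operator `|i⟩ ↦ |f i⟩`. -/
def ofMap (f : ι → κ) : MonomialOp ι κ where
  coeff _ := 1
  map := f

theorem toMatrix_ofMap_id [DecidableEq ι] : (ofMap (id : ι → ι)).toMatrix = 1 := by
  ext i j
  exact (Matrix.one_apply (i := i) (j := j)).symm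

variable [DecidableEq κ]

theorem toMatrix_mul_toMatrix [DecidableEq η] [Fintype κ] (m₂ : MonomialOp κ η)
    (m₁ : MonomialOp ι κ) : m₂.toMatrix * m₁.toMatrix = (m₂.comp m₁).toMatrix := by
  ext j i
  simp only [toMatrix, comp, Matrix.mul_apply, Matrix.of_apply]
  rw [Finset.sum_eq_single (m₁.map i) (fun b _ hb => by simp [hb]) (by simp)]
  by_cases h : j = m₂.map (m₁.map i) <;> simp [h, mul_comm]

theorem conjTranspose_toMatrix_mul_apply [Fintype κ] (m m' : MonomialOp ι κ) (i i' : ι) :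
    (m.toMatrixᴴ * m'.toMatrix) i i' =
      if m.map i = m'.map i' then star (m.coeff i) * m'.coeff i' else 0 := by
  simp only [toMatrix, Matrix.mul_apply, Matrix.conjTranspose_apply, Matrix.of_apply]
  rw [Finset.sum_eq_single (m.map i) (fun b _ hb => by simp [hb]) (by simp)]
  simp

theorem conjTranspose_ofMap_mul [DecidableEq ι] [Fintype κ] {f : ι → κ}
    (hf : Function.Injective f) : (ofMap f).toMatrixᴴ * (ofMap f).toMatrix = 1 := by
  ext i i'
  rw [conjTranspose_toMatrix_mul_apply]
  simp [ofMap, Matrix.one_apply, hf.eq_iff]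

end MonomialOp

section Kraus

variable {w : ℕ}

theorem basisMap_eq_toMatrix (f : Basis w → Basis w) :
    basisMap f = (MonomialOp.ofMap f).toMatrix := rfl

/-! ### Kraus operators of the elementary steps -/

theorem conjTranspose_proj (a : Party × Fin w) (b : Bool) : (proj a b)ᴴ = proj a b := by
  simp only [proj, Matrix.diagonal_conjTranspose]
  congr 1
  funext s
  by_cases h : s a = b <;> simp [h]

theorem proj_mul_proj (a : Party × Fin w) (b : Bool) : proj a b * proj a b = proj a b := by
  simp only [proj, Matrix.diagonal_mul_diagonal]
  congr 1
  funext s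
  by_cases h : s a = b <;> simp [h]

theorem proj_false_add_proj_true (a : Party × Fin w) : proj a false + proj a true = 1 := by
  simp only [proj, Matrix.diagonal_add, ← Matrix.diagonal_one]
  congr 1
  funext s
  cases s a <;> simp

/-- The sign `(-1)^b`. -/
def sgn (b : Bool) : ℂ := if b then -1 else 1

theorem star_sgn (b : Bool) : star (sgn b) = sgn b := by cases b <;> simp [sgn]

theorem sgn_mul_self (b : Bool) : sgn b * sgn b = 1 := by cases b <;> simp [sgn]

/-- The amplitude `1/√2` of the Hadamard gate. -/
def invSqrtTwo : ℂ := ((1 / Real.sqrt 2 : ℝ) : ℂ)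

theorem invSqrtTwo_mul_self : invSqrtTwo * invSqrtTwo = 1 / 2 := by
  rw [invSqrtTwo, ← Complex.ofReal_mul, div_mul_div_comm, Real.mul_self_sqrt (by norm_num)]
  norm_num

theorem star_invSqrtTwo : star invSqrtTwo = invSqrtTwo := by simp [invSqrtTwo]

/-- The part of the Hadamard gate on qubit `a` that leaves the value `b` there. -/
def hadamardPart (a : Party × Fin w) (b : Bool) : MonomialOp (Basis w) (Basis w) where
  coeff s := invSqrtTwo * sgn (b && s a)
  map s := Function.update s a b

theorem hadamardMat_apply (a : Party × Fin w) (s' s : Basis w) :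
    hadamardMat a s' s = (hadamardPart a (s' a)).toMatrix s' s := by
  have h_iff : (∀ c, c ≠ a → s' c = s c) ↔ s' = Function.update s a (s' a) := by
    rw [Function.eq_update_iff]
    simp
  exact if_congr h_iff rfl rfl

theorem proj_mul_hadamardMat (a : Party × Fin w) (b : Bool) :
    proj a b * hadamardMat a = (hadamardPart a b).toMatrix := by
  ext s' s
  rw [proj, Matrix.diagonal_mul, hadamardMat_apply]
  by_cases h : s' a = b
  · subst h
    simp
  · have h_ne : s' ≠ Function.update s a b := fun h' => h (by rw [h']; simp)
    simp [h, MonomialOp.toMatrix, hadamardPart, h_ne]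

theorem conjTranspose_hadamardMat_mul_eq_sum (a : Party × Fin w) :
    (hadamardMat a)ᴴ * hadamardMat a =
      ∑ b, (hadamardPart a b).toMatrixᴴ * (hadamardPart a b).toMatrix := by
  have h_part (b : Bool) : (hadamardMat a)ᴴ * (proj a b * hadamardMat a) =
      (hadamardPart a b).toMatrixᴴ * (hadamardPart a b).toMatrix := by
    rw [← proj_mul_hadamardMat, Matrix.conjTranspose_mul, conjTranspose_proj, Matrix.mul_assoc,
      ← Matrix.mul_assoc (proj a b), proj_mul_proj]
  rw [Fintype.sum_bool, ← h_part, ← h_part, ← Matrix.mul_add, ← Matrix.add_mul,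
    add_comm (proj a true), proj_false_add_proj_true, Matrix.one_mul]

theorem conjTranspose_hadamardMat_mul (a : Party × Fin w) :
    (hadamardMat a)ᴴ * hadamardMat a = 1 := by
  ext s s'
  simp only [conjTranspose_hadamardMat_mul_eq_sum, Fintype.sum_bool, Matrix.add_apply,
    MonomialOp.conjTranspose_toMatrix_mul_apply, hadamardPart, star_mul', star_invSqrtTwo,
    star_sgn]
  by_cases h : ∀ c, c ≠ a → s c = s' c
  · have h_update (b : Bool) : Function.update s a b = Function.update s' a b :=
      Function.update_eq_iff.2 ⟨by simp, fun c hc => by simpa [hc] using h c hc⟩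
    have h_eq : s = s' ↔ s a = s' a := by
      refine ⟨fun h' => by rw [h'], fun h' => funext fun c => ?_⟩
      by_cases hc : c = a
      · rw [hc, h']
      · exact h c hc
    have h_half := invSqrtTwo_mul_self
    simp only [h_update, if_true, Matrix.one_apply, h_eq]
    cases s a <;> cases s' a <;> simp [sgn] <;> linear_combination 2 * h_half
  · have h_update (b : Bool) : Function.update s a b ≠ Function.update s' a b := fun h' =>
      h fun c hc => by simpa [hc] using congrFun h' c
    have h_ne : s ≠ s' := fun h' => h fun c _ => by rw [h']
    simp only [h_update, if_false, add_zero, Matrix.one_apply, h_ne]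

theorem conjTranspose_phaseMat_mul (a : Party × Fin w) : (phaseMat a)ᴴ * phaseMat a = 1 := by
  simp only [phaseMat, Matrix.diagonal_conjTranspose, Matrix.diagonal_mul_diagonal,
    ← Matrix.diagonal_one]
  congr 1
  funext s
  by_cases h : s a = true
  · simp only [h, if_true, Pi.star_apply, RCLike.star_def]
    rw [← Complex.exp_conj, ← Complex.exp_add, map_mul, Complex.conj_ofReal, Complex.conj_I]
    simp
  · simp [h]

theorem negate_involutive (a : Party × Fin w) : Function.Involutive (negate a) := fun s => by
  simp [negate]

theorem conjTranspose_basisMap_mul {f : Basis w → Basis w} (hf : Function.Involutive f) :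
    (basisMap f)ᴴ * basisMap f = 1 :=
  MonomialOp.conjTranspose_ofMap_mul hf.injective

theorem sum_conjTranspose_mul_kraus (o : Step w) : (o.kraus.map fun A => Aᴴ * A).sum = 1 := by
  cases o with
  | flip p q => simpa [Step.kraus] using conjTranspose_basisMap_mul (negate_involutive (p, q))
  | hadamard p q => simpa [Step.kraus] using conjTranspose_hadamardMat_mul (p, q)
  | phase p q => simpa [Step.kraus] using conjTranspose_phaseMat_mul (p, q)
  | cnot p c q h =>
    simp only [Step.kraus, List.map_cons, List.map_nil, List.sum_cons, List.sum_nil, add_zero]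
    have h_ne : (p, c) ≠ (p, q) := by simpa using h
    exact conjTranspose_basisMap_mul fun s => by simp [Function.update_of_ne h_ne]
  | toffoli p b c q _ hb hc =>
    simp only [Step.kraus, List.map_cons, List.map_nil, List.sum_cons, List.sum_nil, add_zero]
    have hb_ne : (p, b) ≠ (p, q) := by simpa using hb
    have hc_ne : (p, c) ≠ (p, q) := by simpa using hc
    exact conjTranspose_basisMap_mul fun s => by
      simp [Function.update_of_ne hb_ne, Function.update_of_ne hc_ne]
  | send p q r =>
    simp only [Step.kraus, List.map_cons, List.map_nil, List.sum_cons, List.sum_nil, add_zero,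
      Matrix.conjTranspose_mul]
    rw [Matrix.mul_assoc, ← Matrix.mul_assoc _ (basisMap _),
      conjTranspose_basisMap_mul (negate_involutive _), Matrix.one_mul, conjTranspose_proj,
      conjTranspose_proj, proj_mul_proj, proj_mul_proj, proj_false_add_proj_true]

/-! ### Kraus operators of a list of steps -/

/-- The Kraus operators of a list of steps, one for each sequence of measurement results. -/
def krausList : List (Step w) → List (Matrix (Basis w) (Basis w) ℂ)
  | [] => [1]
  | o :: os => o.kraus.flatMap fun A => (krausList os).map (· * A)

theorem run_eq_map (l : List (Step w)) (σ : Matrix (Basis w) (Basis w) ℂ) :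
    run l σ = (krausList l).map fun A => A * σ * Aᴴ := by
  induction l generalizing σ with
  | nil => simp [run, krausList]
  | cons o os ih =>
    simp [run, krausList, ih, List.map_flatMap, Function.comp_def, Matrix.mul_assoc,
      Matrix.conjTranspose_mul]

theorem krausList_append (l₁ l₂ : List (Step w)) :
    krausList (l₁ ++ l₂) = (krausList l₁).flatMap fun A => (krausList l₂).map (· * A) := by
  induction l₁ with
  | nil => simp [krausList]
  | cons o os ih =>
    simp [krausList, ih, List.flatMap_assoc, List.map_flatMap, List.flatMap_map,
      Function.comp_def, Matrix.mul_assoc]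

theorem sum_trace_run (l : List (Step w)) (σ : Matrix (Basis w) (Basis w) ℂ) :
    ((run l σ).map Matrix.trace).sum = σ.trace := by
  induction l generalizing σ with
  | nil => simp [run]
  | cons o os ih =>
    have h_flatMap : ∀ L : List (Matrix (Basis w) (Basis w) ℂ),
        ((L.flatMap fun A => run os (A * σ * Aᴴ)).map Matrix.trace).sum =
          (((L.map fun A => Aᴴ * A).sum) * σ).trace := by
      intro L
      induction L with
      | nil => simp
      | cons A L ihL =>
        simp only [List.flatMap_cons, List.map_append, List.sum_append, ihL, ih, List.map_cons,
          List.sum_cons, Matrix.add_mul, Matrix.trace_add]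
        rw [Matrix.trace_mul_comm, Matrix.mul_assoc]
    rw [run, h_flatMap, sum_conjTranspose_mul_kraus, Matrix.one_mul]

/-- The Kraus operators of the list of steps `l` are, in order, the monomial operators `D`. -/
def HasMonomialKraus (l : List (Step w)) (D : List (MonomialOp (Basis w) (Basis w))) : Prop :=
  krausList l = D.map MonomialOp.toMatrix

theorem HasMonomialKraus.append {l₁ l₂ : List (Step w)}
    {D₁ D₂ : List (MonomialOp (Basis w) (Basis w))}
    (h₁ : HasMonomialKraus l₁ D₁) (h₂ : HasMonomialKraus l₂ D₂) :
    HasMonomialKraus (l₁ ++ l₂) (D₁.flatMap fun m₁ => D₂.map fun m₂ => m₂.comp m₁) := by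
  rw [HasMonomialKraus, krausList_append, h₁, h₂]
  simp [List.flatMap_map, List.map_flatMap, Function.comp_def, MonomialOp.toMatrix_mul_toMatrix]

theorem hasMonomialKraus_nil : HasMonomialKraus ([] : List (Step w)) [.ofMap id] := by
  simp [HasMonomialKraus, krausList, MonomialOp.toMatrix_ofMap_id]

theorem hasMonomialKraus_singleton {o : Step w} {f : Basis w → Basis w}
    (h : o.kraus = [basisMap f]) : HasMonomialKraus [o] [.ofMap f] := by
  simp [HasMonomialKraus, krausList, h, basisMap_eq_toMatrix]

/-- The operator of a measurement of qubit `q` of party `p` in the Hadamard basis with result `b`,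
which is added to qubit `r` of the other party. -/
def measureOp (p : Party) (q r : Fin w) (b : Bool) : MonomialOp (Basis w) (Basis w) where
  coeff s := invSqrtTwo * sgn (b && s (p, q))
  map s :=
    Function.update (Function.update s (p, q) b) (p.other, r) (xor (s (p.other, r)) b)

theorem Party.other_ne (p : Party) : p.other ≠ p := by cases p <;> simp [Party.other]

theorem hasMonomialKraus_measure (p : Party) (q r : Fin w) :
    HasMonomialKraus [.hadamard p q, .send p q r]
      [measureOp p q r false, measureOp p q r true] := by
  have hne : (p.other, r) ≠ (p, q) := fun h => p.other_ne (Prod.ext_iff.1 h).1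
  have h_false : measureOp p q r false = hadamardPart (p, q) false := by
    refine MonomialOp.ext rfl (funext fun s => ?_)
    simp only [measureOp, hadamardPart, Bool.xor_false]
    rw [← Function.update_of_ne hne false s, Function.update_eq_self]
  have h_true : (measureOp p q r true).toMatrix =
      basisMap (negate (p.other, r)) * (hadamardPart (p, q) true).toMatrix := by
    rw [basisMap_eq_toMatrix, MonomialOp.toMatrix_mul_toMatrix]
    congr 1
    ext s : 2 <;>
      simp [measureOp, hadamardPart, MonomialOp.comp, MonomialOp.ofMap, negate,
        Function.update_of_ne hne]
  simp [HasMonomialKraus, krausList, Step.kraus, h_false, h_true, Matrix.mul_assoc,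
    proj_mul_hadamardMat]

end Kraus

/-! ### Fidelity -/

theorem sum_eq_sum_diag {n : ℕ} {β : Type*} [AddCommMonoid β] (f : Fin n × Fin n → β)
    (hf : ∀ a, a.1 ≠ a.2 → f a = 0) : ∑ a, f a = ∑ i, f (i, i) := by
  rw [Fintype.sum_prod_type]
  refine Finset.sum_congr rfl fun i _ => ?_
  exact Finset.sum_eq_single i (fun j _ hj => hf _ (Ne.symm hj)) (by simp)

theorem one_div_sqrt_mul_self (N : ℕ) :
    ((1 / Real.sqrt N : ℝ) : ℂ) * ((1 / Real.sqrt N : ℝ) : ℂ) = 1 / (N : ℂ) := by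
  rw [← Complex.ofReal_mul, div_mul_div_comm, Real.mul_self_sqrt (Nat.cast_nonneg N)]
  simp

theorem fidelity_eq {N : ℕ} (ρ : Matrix (Fin N × Fin N) (Fin N × Fin N) ℂ) :
    fidelity ρ = (1 / (N : ℂ) * ∑ i, ∑ j, ρ (i, i) (j, j)).re := by
  rw [fidelity, dotProduct, sum_eq_sum_diag _ fun a ha => by simp [maxEnt, ha], Finset.mul_sum]
  congr 1
  refine Finset.sum_congr rfl fun i _ => ?_
  rw [Matrix.mulVec, dotProduct, sum_eq_sum_diag _ fun a ha => by simp [maxEnt, ha],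
    Finset.mul_sum, Finset.mul_sum]
  refine Finset.sum_congr rfl fun j _ => ?_
  simp only [maxEnt, Pi.star_apply, if_true, RCLike.star_def, Complex.conj_ofReal,
    ← one_div_sqrt_mul_self]
  ring

/-! ### Conjugation by monomial operators -/

theorem sum_sum_mul_sum_ite {ι κ R : Type*} [Fintype ι] [Fintype κ] [DecidableEq κ]
    [NonUnitalNonAssocSemiring R] (μ : ι → κ) (f : κ → κ → R) (g : ι × ι → R) :
    ∑ k, ∑ k', f k k' * ∑ x, (if μ x.1 = k ∧ μ x.2 = k' then g x else 0) =
      ∑ x, f (μ x.1) (μ x.2) * g x := by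
  simp only [Finset.mul_sum]
  rw [← Fintype.sum_prod_type', Finset.sum_comm]
  refine Finset.sum_congr rfl fun x _ => ?_
  rw [Fintype.sum_eq_single (μ x.1, μ x.2)]
  · simp
  · rintro ⟨k, k'⟩ hne
    rw [if_neg, mul_zero]
    rintro ⟨rfl, rfl⟩
    exact hne rfl

namespace MonomialOp

variable {ι κ : Type*} [Fintype ι] [DecidableEq κ]

theorem mul_mul_conjTranspose_apply (m : MonomialOp ι κ) (X : Matrix ι ι ℂ) (j j' : κ) :
    (m.toMatrix * X * m.toMatrixᴴ) j j' =
      ∑ x : ι × ι, if m.map x.1 = j ∧ m.map x.2 = j' then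
        m.coeff x.1 * X x.1 x.2 * star (m.coeff x.2) else 0 := by
  rw [Matrix.mul_apply, Fintype.sum_prod_type_right]
  refine Finset.sum_congr rfl fun i' _ => ?_
  rw [Matrix.mul_apply, Finset.sum_mul]
  refine Finset.sum_congr rfl fun i _ => ?_
  simp only [toMatrix, Matrix.conjTranspose_apply, Matrix.of_apply, eq_comm (a := j),
    eq_comm (a := j'), ite_and]
  split_ifs <;> simp

theorem sum_mul_mul_mul_conjTranspose [Fintype κ] (m : MonomialOp ι κ) (X : Matrix ι ι ℂ)
    (f : κ → κ → ℂ) :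
    ∑ j, ∑ j', f j j' * (m.toMatrix * X * m.toMatrixᴴ) j j' =
      ∑ x : ι × ι, f (m.map x.1) (m.map x.2) *
        (m.coeff x.1 * X x.1 x.2 * star (m.coeff x.2)) := by
  simp only [mul_mul_conjTranspose_apply]
  exact sum_sum_mul_sum_ite m.map f _

theorem trace_mul_mul_conjTranspose [Fintype κ] (m : MonomialOp ι κ) (X : Matrix ι ι ℂ) :
    (m.toMatrix * X * m.toMatrixᴴ).trace =
      ∑ x : ι × ι, if m.map x.1 = m.map x.2 then
        m.coeff x.1 * X x.1 x.2 * star (m.coeff x.2) else 0 := by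
  have h := m.sum_mul_mul_mul_conjTranspose X fun j j' => if j = j' then 1 else 0
  simp only [ite_mul, one_mul, zero_mul, Finset.sum_ite_eq, Finset.mem_univ, if_true] at h
  exact h

end MonomialOp

/-! ### Reading the output of a circuit -/

namespace Circuit

variable {N K M : ℕ}

theorem Reads.unique {P : Circuit N K M} {s : Basis P.width} {a b : Fin M × Fin M}
    (ha : P.Reads s a) (hb : P.Reads s b) : a = b := by
  have h_eq (m m' : Fin M)
      (h : ∀ l : Fin (Nat.clog 2 M), (m : ℕ).testBit l = (m' : ℕ).testBit l) : m = m' := by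
    have hM : M ≤ 2 ^ Nat.clog 2 M := Nat.le_pow_clog (by norm_num) M
    refine Fin.ext (Nat.eq_of_testBit_eq fun l => ?_)
    rcases lt_or_ge l (Nat.clog 2 M) with hl | hl
    · exact h ⟨l, hl⟩
    · have h_pow : 2 ^ Nat.clog 2 M ≤ 2 ^ l := Nat.pow_le_pow_right (by norm_num) hl
      rw [Nat.testBit_lt_two_pow (by lia), Nat.testBit_lt_two_pow (by lia)]
  exact Prod.ext (h_eq _ _ fun l => by rw [← (ha l).1, (hb l).1])
    (h_eq _ _ fun l => by rw [← (ha l).2, (hb l).2])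

theorem Reads.eq_of_eq_rest {P : Circuit N K M} {s s' : Basis P.width} {a : Fin M × Fin M}
    (h : P.Reads s a) (h' : P.Reads s' a)
    (h_rest : ∀ p q, q ∉ Set.range (P.out p) → s (p, q) = s' (p, q)) : s = s' := by
  funext ⟨p, q⟩
  by_cases hq : q ∈ Set.range (P.out p)
  · obtain ⟨l, rfl⟩ := hq
    cases p
    · rw [(h l).1, (h' l).1]
    · rw [(h l).2, (h' l).2]
  · exact h_rest p q hq

variable (P : Circuit N K M)

open Classical in
theorem output_apply_self (τ : Matrix (Basis P.width) (Basis P.width) ℂ) (a : Fin M × Fin M) :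
    P.output τ a a = ∑ s, if P.Reads s a then τ s s else 0 := by
  simp only [output, Matrix.of_apply]
  refine Finset.sum_congr rfl fun s _ => ?_
  rw [Finset.sum_eq_single s _ (by simp)]
  · exact if_congr ⟨fun h => h.1, fun h => ⟨h, h, fun _ _ _ => rfl⟩⟩ rfl rfl
  · rintro s' - hs'
    refine if_neg ?_
    rintro ⟨hs, hs'a, h_rest⟩
    exact hs' (hs'a.eq_of_eq_rest hs fun p q hq => (h_rest p q hq).symm)

theorem trace_output {τ : Matrix (Basis P.width) (Basis P.width) ℂ}
    (h : ∀ s, τ s s ≠ 0 → ∃ a, P.Reads s a) : (P.output τ).trace = τ.trace := by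
  classical
  simp only [Matrix.trace, Matrix.diag_apply, output_apply_self]
  rw [Finset.sum_comm]
  refine Finset.sum_congr rfl fun s _ => ?_
  by_cases hs : τ s s = 0
  · simp [hs]
  · obtain ⟨a, ha⟩ := h s hs
    rw [Finset.sum_eq_single a (fun b _ hb => if_neg fun h' => hb (h'.unique ha)) (by simp),
      if_pos ha]

/-- The sum `∑ ⟨m m|output|m' m'⟩`, which is `M` times the fidelity of the output. -/
def overlap (τ : Matrix (Basis P.width) (Basis P.width) ℂ) : ℂ :=
  ∑ m, ∑ m', P.output τ (m, m) (m', m')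

theorem fidelity_smul_output (c : ℂ) (τ : Matrix (Basis P.width) (Basis P.width) ℂ) :
    fidelity (c • P.output τ) = (1 / (M : ℂ) * (c * P.overlap τ)).re := by
  rw [fidelity_eq, overlap]
  simp only [Matrix.smul_apply, smul_eq_mul, Finset.mul_sum]

variable {ι : Type*} [Fintype ι] (m : MonomialOp ι (Basis P.width)) (X : Matrix ι ι ℂ)
  {μ : ι → Fin M}

theorem output_mul_mul_conjTranspose_apply (h_reads : ∀ i, P.Reads (m.map i) (μ i, μ i))
    (h_rest : ∀ i i' p q, q ∉ Set.range (P.out p) → m.map i (p, q) = m.map i' (p, q))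
    (k k' : Fin M) :
    P.output (m.toMatrix * X * m.toMatrixᴴ) (k, k) (k', k') =
      ∑ x : ι × ι, if μ x.1 = k ∧ μ x.2 = k' then
        m.coeff x.1 * X x.1 x.2 * star (m.coeff x.2) else 0 := by
  classical
  have h_iff (i : ι) (k : Fin M) : P.Reads (m.map i) (k, k) ↔ μ i = k :=
    ⟨fun h => (Prod.ext_iff.1 ((h_reads i).unique h)).1, fun h => h ▸ h_reads i⟩
  have h := m.sum_mul_mul_mul_conjTranspose X fun s s' =>
    if P.Reads s (k, k) ∧ P.Reads s' (k', k') ∧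
      (∀ p q, q ∉ Set.range (P.out p) → s (p, q) = s' (p, q)) then 1 else 0
  simp only [ite_mul, one_mul, zero_mul, h_iff] at h
  rw [output, Matrix.of_apply, h]
  refine Finset.sum_congr rfl fun x _ => ?_
  have h_rest' := h_rest x.1 x.2
  exact if_congr (by tauto) rfl rfl

theorem overlap_mul_mul_conjTranspose (h_reads : ∀ i, P.Reads (m.map i) (μ i, μ i))
    (h_rest : ∀ i i' p q, q ∉ Set.range (P.out p) → m.map i (p, q) = m.map i' (p, q)) :
    P.overlap (m.toMatrix * X * m.toMatrixᴴ) =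
      ∑ x : ι × ι, m.coeff x.1 * X x.1 x.2 * star (m.coeff x.2) := by
  simp only [overlap, P.output_mul_mul_conjTranspose_apply m X h_reads h_rest]
  simpa only [one_mul] using sum_sum_mul_sum_ite μ (fun _ _ => (1 : ℂ)) _

end Circuit

/-! ### Mixed states in the diagonal subspace -/

theorem dyad_apply {ι : Type*} (φ : ι → ℂ) (a b : ι) : dyad φ a b = φ a * star (φ b) := rfl

theorem trace_dyad {ι : Type*} [Fintype ι] (φ : ι → ℂ) :
    (dyad φ).trace = ((∑ a, ‖φ a‖ ^ 2 : ℝ) : ℂ) := by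
  rw [Complex.ofReal_sum]
  refine Finset.sum_congr rfl fun a _ => ?_
  rw [Matrix.diag_apply, dyad_apply, RCLike.star_def, Complex.mul_conj, Complex.normSq_eq_norm_sq]

theorem fidelity_sum_smul {N s : ℕ} (p : Fin s → ℝ)
    (ρ : Fin s → Matrix (Fin N × Fin N) (Fin N × Fin N) ℂ) :
    fidelity (∑ k, ((p k : ℝ) : ℂ) • ρ k) = ∑ k, p k * fidelity (ρ k) := by
  simp only [fidelity, Matrix.sum_mulVec, dotProduct_sum, Complex.re_sum, Matrix.smul_mulVec,
    dotProduct_smul, smul_eq_mul, Complex.re_ofReal_mul]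

theorem fidelity_dyad {N : ℕ} (φ : Fin N × Fin N → ℂ) :
    fidelity (dyad φ) = ‖∑ i, φ (i, i)‖ ^ 2 / N := by
  have h_sum : ∑ i, ∑ j, dyad φ (i, i) (j, j) = ((‖∑ i, φ (i, i)‖ ^ 2 : ℝ) : ℂ) := by
    rw [← Complex.normSq_eq_norm_sq, ← Complex.mul_conj, ← RCLike.star_def, star_sum,
      Finset.sum_mul_sum]
    rfl
  rw [fidelity_eq, h_sum, one_div_mul_eq_div, Complex.div_natCast_re, Complex.ofReal_re]

theorem sum_sum_apply_diag {N : ℕ} {ρ : Matrix (Fin N × Fin N) (Fin N × Fin N) ℂ}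
    (hρ : ρ.IsHermitian) (hN : N ≠ 0) :
    ∑ i, ∑ j, ρ (i, i) (j, j) = ((N * fidelity ρ : ℝ) : ℂ) := by
  have h_im : (∑ i, ∑ j, ρ (i, i) (j, j)).im = 0 := by
    rw [← Complex.conj_eq_iff_im, ← RCLike.star_def, star_sum]
    simp only [star_sum, hρ.apply]
    exact Finset.sum_comm
  have hN' : (N : ℝ) ≠ 0 := by exact_mod_cast hN
  rw [fidelity_eq, one_div_mul_eq_div, Complex.div_natCast_re, mul_div_cancel₀ _ hN']
  exact Complex.ext rfl h_im

namespace InDiagonal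

variable {N : ℕ} {ρ : Matrix (Fin N × Fin N) (Fin N × Fin N) ℂ}

theorem isHermitian (hρ : InDiagonal ρ) : ρ.IsHermitian := by
  obtain ⟨s, p, φ, -, -, -, -, rfl⟩ := hρ
  ext a b
  simp only [Matrix.conjTranspose_apply, Matrix.sum_apply, Matrix.smul_apply, dyad_apply,
    smul_eq_mul, star_sum, star_mul', RCLike.star_def, Complex.conj_ofReal, Complex.conj_conj,
    mul_comm (φ _ a)]

theorem apply_eq_zero (hρ : InDiagonal ρ) {a b : Fin N × Fin N}
    (h : a.1 ≠ a.2 ∨ b.1 ≠ b.2) : ρ a b = 0 := by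
  obtain ⟨s, p, φ, -, -, -, hφ, rfl⟩ := hρ
  rw [Matrix.sum_apply]
  refine Finset.sum_eq_zero fun k _ => ?_
  rcases h with h | h <;> simp [dyad_apply, hφ k _ h]

theorem trace_eq_one (hρ : InDiagonal ρ) : ρ.trace = 1 := by
  obtain ⟨s, p, φ, -, hp, hφ, -, rfl⟩ := hρ
  simp only [Matrix.trace_sum, Matrix.trace_smul, trace_dyad, hφ, smul_eq_mul, Complex.ofReal_one,
    mul_one, ← Complex.ofReal_sum, hp]

theorem sum_apply_diag (hρ : InDiagonal ρ) : ∑ i, ρ (i, i) (i, i) = 1 := by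
  rw [← hρ.trace_eq_one]
  exact (sum_eq_sum_diag ρ.diag fun a ha => hρ.apply_eq_zero (.inl ha)).symm

theorem fidelity_le_one (hρ : InDiagonal ρ) : fidelity ρ ≤ 1 := by
  obtain ⟨s, p, φ, hp_nonneg, hp, hφ, h_diag, rfl⟩ := hρ
  have h_dyad (k : Fin s) : fidelity (dyad (φ k)) ≤ 1 := by
    have h_norm := hφ k
    rw [sum_eq_sum_diag _ fun a ha => by simp [h_diag k a ha]] at h_norm
    rw [fidelity_dyad]
    refine div_le_one_of_le₀ ?_ (Nat.cast_nonneg N)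
    calc ‖∑ i, φ k (i, i)‖ ^ 2 ≤ (∑ i, ‖φ k (i, i)‖) ^ 2 := by
          gcongr
          exact norm_sum_le _ _
      _ ≤ (Finset.univ : Finset (Fin N)).card * ∑ i, ‖φ k (i, i)‖ ^ 2 :=
          sq_sum_le_card_mul_sum_sq
      _ = N := by rw [h_norm, Finset.card_fin, mul_one]
  calc fidelity (∑ k, ((p k : ℝ) : ℂ) • dyad (φ k)) = ∑ k, p k * fidelity (dyad (φ k)) :=
        fidelity_sum_smul p _
    _ ≤ ∑ k, p k * 1 :=
        Finset.sum_le_sum fun k _ => mul_le_mul_of_nonneg_left (h_dyad k) (hp_nonneg k)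
    _ = 1 := by simp only [mul_one, hp]

end InDiagonal

/-! ### Circuits with monomial branches -/

/-- The basis state of the qubits that holds the given basis states of the two systems. -/
def loadBasis (N K w : ℕ) (a : (Fin N × Fin N) × (Fin K × Fin K)) : Basis w :=
  fun pq => match pq.1 with
    | .alice => load N K w a.1.1 a.2.1 pq.2
    | .bob => load N K w a.1.2 a.2.2 pq.2

theorem loadMat_eq_toMatrix (N K w : ℕ) :
    loadMat N K w = (MonomialOp.ofMap (loadBasis N K w)).toMatrix := rfl

/-- The inclusion of the span of the input basis states `|i⟩|i⟩|y⟩|y⟩`, indexed by `(y, i)`. -/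
def diagOp (N K : ℕ) : MonomialOp (Fin K × Fin N) ((Fin N × Fin N) × (Fin K × Fin K)) :=
  .ofMap fun q => ((q.2, q.2), (q.1, q.1))

/-- The matrix of `ρ ⊗ |Ψ_K⟩⟨Ψ_K|` with respect to the basis states `|i⟩|i⟩|y⟩|y⟩`. -/
def diagMatrix {N : ℕ} (K : ℕ) (ρ : Matrix (Fin N × Fin N) (Fin N × Fin N) ℂ) :
    Matrix (Fin K × Fin N) (Fin K × Fin N) ℂ :=
  Matrix.of fun q q' => 1 / (K : ℂ) * ρ (q.2, q.2) (q'.2, q'.2)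

theorem InDiagonal.kronecker_dyad_maxEnt {N : ℕ} {ρ : Matrix (Fin N × Fin N) (Fin N × Fin N) ℂ}
    (hρ : InDiagonal ρ) (K : ℕ) :
    ρ ⊗ₖ dyad (maxEnt K) =
      (diagOp N K).toMatrix * diagMatrix K ρ * (diagOp N K).toMatrixᴴ := by
  ext ⟨⟨i, j⟩, ⟨y, z⟩⟩ ⟨⟨i', j'⟩, ⟨y', z'⟩⟩
  rw [MonomialOp.mul_mul_conjTranspose_apply, Matrix.kroneckerMap_apply, dyad_apply]
  simp only [diagOp, MonomialOp.ofMap, one_mul, star_one, mul_one, Prod.mk.injEq]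
  by_cases h : (i = j ∧ i' = j') ∧ (y = z ∧ y' = z')
  · obtain ⟨⟨rfl, rfl⟩, rfl, rfl⟩ := h
    rw [Fintype.sum_eq_single ((y, i), (y', i'))]
    · simp only [and_self, if_true, maxEnt, diagMatrix, Matrix.of_apply, RCLike.star_def,
        Complex.conj_ofReal, one_div_sqrt_mul_self]
      ring
    · rintro ⟨⟨v, k⟩, ⟨v', k'⟩⟩ hne
      refine if_neg ?_
      rintro ⟨⟨⟨rfl, -⟩, rfl, -⟩, ⟨rfl, -⟩, rfl, -⟩
      exact hne rfl
  · rw [Finset.sum_eq_zero fun x _ => if_neg ?_]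
    · by_cases hy : y = z ∧ y' = z'
      · rw [hρ.apply_eq_zero (by dsimp only; tauto), zero_mul]
      · rcases not_and_or.1 hy with hy | hy <;> simp [maxEnt, hy]
    · rintro ⟨⟨⟨rfl, rfl⟩, rfl, rfl⟩, ⟨rfl, rfl⟩, rfl, rfl⟩
      exact h ⟨⟨rfl, rfl⟩, rfl, rfl⟩

theorem trace_dyad_maxEnt {K : ℕ} (hK : K ≠ 0) : (dyad (maxEnt K)).trace = 1 := by
  have hK' : (K : ℂ) ≠ 0 := by exact_mod_cast hK
  rw [Matrix.trace, sum_eq_sum_diag _ fun a ha => by simp [dyad_apply, maxEnt, ha]]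
  simp only [Matrix.diag_apply, dyad_apply, maxEnt, if_true, RCLike.star_def, Complex.conj_ofReal,
    one_div_sqrt_mul_self]
  simp [hK']

/-- The projection onto the basis states in which qubit `a` has the value `b`. -/
def projOp {w : ℕ} (a : Party × Fin w) (b : Bool) : MonomialOp (Basis w) (Basis w) where
  coeff s := if s a = b then 1 else 0
  map := id

theorem proj_eq_toMatrix {w : ℕ} (a : Party × Fin w) (b : Bool) :
    proj a b = (projOp a b).toMatrix := by
  ext s s'
  by_cases h : s = s'
  · subst h
    simp [proj, projOp, MonomialOp.toMatrix]
  · simp [proj, projOp, MonomialOp.toMatrix, h]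

namespace Circuit

variable {N K M : ℕ} (P : Circuit N K M)

theorem trace_branches (hK : K ≠ 0) (h_load : Function.Injective (loadBasis N K P.width))
    (ρ : Matrix (Fin N × Fin N) (Fin N × Fin N) ℂ) :
    ((P.branches ρ).map Matrix.trace).sum = ρ.trace := by
  rw [branches, sum_trace_run, Matrix.trace_mul_comm, ← Matrix.mul_assoc, loadMat_eq_toMatrix,
    MonomialOp.conjTranspose_ofMap_mul h_load, Matrix.one_mul, Matrix.trace_kronecker,
    trace_dyad_maxEnt hK, mul_one]

theorem failProb_add_succProb (hK : K ≠ 0) (h_load : Function.Injective (loadBasis N K P.width))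
    {ρ : Matrix (Fin N × Fin N) (Fin N × Fin N) ℂ} (hρ : ρ.trace = 1) :
    P.failProb ρ + P.succProb ρ = 1 := by
  have h_trace (σ : Matrix (Basis P.width) (Basis P.width) ℂ) :
      (proj (Party.alice, P.flag) true * σ).trace +
        (proj (Party.alice, P.flag) false * σ * proj (Party.alice, P.flag) false).trace =
      σ.trace := by
    rw [Matrix.trace_mul_comm _ (proj _ false), ← Matrix.mul_assoc, proj_mul_proj,
      ← Matrix.trace_add, ← Matrix.add_mul, add_comm, proj_false_add_proj_true, Matrix.one_mul]
  rw [failProb, succProb, successes, List.map_map, ← List.sum_map_add]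
  simp only [Function.comp_apply, ← Complex.add_re, h_trace]
  have h_branches := congrArg Complex.reLm (P.trace_branches hK h_load ρ)
  rw [map_list_sum, List.map_map, hρ] at h_branches
  exact h_branches

/-- The operator of a branch with operator `m`, from the input of the circuit to its end, followed
by the projection onto success. -/
def successOp (m : MonomialOp (Basis P.width) (Basis P.width)) :
    MonomialOp ((Fin N × Fin N) × (Fin K × Fin K)) (Basis P.width) :=
  (projOp (Party.alice, P.flag) false).comp (m.comp (.ofMap (loadBasis N K P.width)))

theorem successes_eq_map {D : List (MonomialOp (Basis P.width) (Basis P.width))}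
    (hD : HasMonomialKraus P.steps D) (ρ : Matrix (Fin N × Fin N) (Fin N × Fin N) ℂ) :
    P.successes ρ = D.map fun m =>
      (P.successOp m).toMatrix * (ρ ⊗ₖ dyad (maxEnt K)) * (P.successOp m).toMatrixᴴ := by
  rw [successes, branches, run_eq_map, hD, List.map_map, List.map_map]
  refine List.map_congr_left fun m _ => ?_
  simp only [Function.comp, successOp, ← MonomialOp.toMatrix_mul_toMatrix, ← proj_eq_toMatrix,
    ← loadMat_eq_toMatrix, Matrix.conjTranspose_mul, conjTranspose_proj, Matrix.mul_assoc]

theorem trace_output_of_mem_successes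
    {D : List (MonomialOp (Basis P.width) (Basis P.width))} (hD : HasMonomialKraus P.steps D)
    (h_reads : ∀ m ∈ D, ∀ a,
      m.map (loadBasis N K P.width a) (Party.alice, P.flag) = false →
        ∃ b, P.Reads (m.map (loadBasis N K P.width a)) b)
    {ρ : Matrix (Fin N × Fin N) (Fin N × Fin N) ℂ}
    {τ : Matrix (Basis P.width) (Basis P.width) ℂ} (hτ : τ ∈ P.successes ρ) :
    (P.output τ).trace = τ.trace := by
  rw [P.successes_eq_map hD, List.mem_map] at hτ
  obtain ⟨m, hm, rfl⟩ := hτ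
  refine P.trace_output fun s hs => ?_
  rw [MonomialOp.mul_mul_conjTranspose_apply] at hs
  obtain ⟨x, -, hx⟩ := Finset.exists_ne_zero_of_sum_ne_zero hs
  obtain ⟨⟨rfl, -⟩, h_coeff⟩ := ite_ne_right_iff.1 hx
  refine h_reads m hm x.1 ?_
  by_contra h_flag
  refine h_coeff ?_
  simp [successOp, projOp, MonomialOp.comp, MonomialOp.ofMap, h_flag]

end Circuit

/-! ### Hash families -/

/-- The maps `i ↦ μ (y, i)`, for `y < K`, hash `N` points so that any two of them collide for the
same number `lam` of indices `y`, and the hash value determines `y`. The outputs of size `M` are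
left after `t` bits have been compared, where `L = 2 ^ t`. -/
structure IsHashFamily {N K M : ℕ} (μ : Fin K × Fin N → Fin M) (lam L : ℕ) : Prop where
  fst_eq : ∀ q q', μ q = μ q' → q.1 = q'.1
  card_collisions : ∀ i j, i ≠ j → (Finset.univ.filter fun y => μ (y, i) = μ (y, j)).card = lam
  K_pos : 0 < K
  L_pos : 0 < L
  two_le : 2 ≤ N
  M_mul : M * L = N * K
  lam_mul : lam * (N - 1) = K * (L - 1)

/-- The probability of success of hashing with collision number `lam`, for an input of fidelity
`f`. -/
def successProb (N K lam L : ℕ) (f : ℝ) : ℝ := ((K - lam) + lam * (N * f)) / (L * K)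

namespace IsHashFamily

variable {N K M lam L : ℕ} {μ : Fin K × Fin N → Fin M} (H : IsHashFamily μ lam L)

include H

theorem card_collisions_eq (i j : Fin N) :
    ((Finset.univ.filter fun y => μ (y, i) = μ (y, j)).card : ℂ) =
      (if i = j then (K : ℂ) - lam else 0) + lam := by
  split_ifs with h
  · simp [h]
  · rw [H.card_collisions i j h, zero_add]

theorem sum_collisions (R : Fin N → Fin N → ℂ) :
    (∑ x : (Fin K × Fin N) × (Fin K × Fin N), if μ x.1 = μ x.2 then R x.1.2 x.2.2 else 0) =
      (K - lam) * ∑ i, R i i + lam * ∑ i, ∑ j, R i j := by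
  have h_row (y : Fin K) (i : Fin N) :
      (∑ q' : Fin K × Fin N, if μ (y, i) = μ q' then R i q'.2 else 0) =
        ∑ j, if μ (y, i) = μ (y, j) then R i j else 0 := by
    rw [Fintype.sum_prod_type]
    refine Finset.sum_eq_single y (fun y' _ hy' => ?_) (by simp)
    exact Finset.sum_eq_zero fun j _ => if_neg fun h => hy' (H.fst_eq _ _ h).symm
  calc (∑ x : (Fin K × Fin N) × (Fin K × Fin N), if μ x.1 = μ x.2 then R x.1.2 x.2.2 else 0)
      = ∑ y, ∑ i, ∑ j, if μ (y, i) = μ (y, j) then R i j else 0 := by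
        rw [Fintype.sum_prod_type, Fintype.sum_prod_type]
        simp only [h_row]
    _ = ∑ i, ∑ j, ((Finset.univ.filter fun y => μ (y, i) = μ (y, j)).card : ℂ) * R i j := by
        rw [Finset.sum_comm]
        refine Finset.sum_congr rfl fun i _ => ?_
        rw [Finset.sum_comm]
        simp only [← Finset.sum_filter, Finset.sum_const, nsmul_eq_mul]
    _ = (K - lam) * ∑ i, R i i + lam * ∑ i, ∑ j, R i j := by
        simp only [H.card_collisions_eq, add_mul, ite_mul, zero_mul, Finset.sum_add_distrib,
          Finset.sum_ite_eq, Finset.mem_univ, if_true, Finset.mul_sum]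

theorem N_ne_zero : N ≠ 0 := (zero_lt_two.trans_le H.two_le).ne'

theorem lam_le : lam ≤ K := by
  have : Nontrivial (Fin N) := Fin.nontrivial_iff_two_le.2 H.two_le
  obtain ⟨i, j, hij⟩ := exists_pair_ne (Fin N)
  simpa only [H.card_collisions i j hij, Fintype.card_fin] using
    Finset.card_le_univ (Finset.univ.filter fun y => μ (y, i) = μ (y, j))

theorem L_le : L ≤ N := by
  have h := H.lam_mul ▸ Nat.mul_le_mul_right (N - 1) H.lam_le
  have h_two := H.two_le
  have := Nat.le_of_mul_le_mul_left h H.K_pos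
  lia

theorem cast_lam_mul : (lam : ℝ) * (N - 1) = K * (L - 1) := by
  rw [← Nat.cast_pred (Nat.pos_of_ne_zero H.N_ne_zero), ← Nat.cast_pred H.L_pos]
  exact_mod_cast H.lam_mul

theorem L_mul_pred_pos : (0 : ℝ) < L * (N - 1) := by
  have h_two : (2 : ℝ) ≤ N := by exact_mod_cast H.two_le
  exact mul_pos (by exact_mod_cast H.L_pos) (by linarith)

theorem successProb_mul (ε : ℝ) :
    successProb N K lam L (1 - ε) * (L * (N - 1)) = L * (N - 1) - ε * N * (L - 1) := by
  have hL : (L : ℝ) ≠ 0 := by exact_mod_cast H.L_pos.ne'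
  have hK : (K : ℝ) ≠ 0 := by exact_mod_cast H.K_pos.ne'
  rw [successProb]
  field_simp
  linear_combination (N * (1 - ε) - 1) * H.cast_lam_mul

variable {ε : ℝ}

theorem one_sub_le_successProb (hε : 0 ≤ ε) : 1 - ε ≤ successProb N K lam L (1 - ε) := by
  refine le_of_mul_le_mul_right ?_ H.L_mul_pred_pos
  have hLN : (L : ℝ) ≤ N := by exact_mod_cast H.L_le
  rw [H.successProb_mul]
  linarith [mul_nonneg hε (sub_nonneg.2 hLN)]

theorem successProb_sub_le (hε : 0 ≤ ε) (hε' : ε < 1 / 2) {δ : ℝ}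
    (hδ : δ = 2 * ε / L ∨ (ε ≤ L / N ∧ δ = ε / L)) :
    successProb N K lam L (1 - ε) - (1 - ε) ≤ δ * successProb N K lam L (1 - ε) := by
  have h_mul := H.successProb_mul ε
  have h_le := H.one_sub_le_successProb hε
  set S := successProb N K lam L (1 - ε)
  have hN : (2 : ℝ) ≤ N := by exact_mod_cast H.two_le
  have hL : (1 : ℝ) ≤ L := by exact_mod_cast H.L_pos
  suffices h : ε * (N - L) ≤ δ * S * (L * (N - 1)) by
    refine le_of_mul_le_mul_right (le_of_eq_of_le ?_ h) H.L_mul_pred_pos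
    linear_combination h_mul
  rcases hδ with rfl | ⟨hεL, rfl⟩
  · calc ε * (N - L) ≤ ε * (2 * S * (N - 1)) := mul_le_mul_of_nonneg_left (by nlinarith) hε
      _ = 2 * ε / L * S * (L * (N - 1)) := by field_simp
  · rw [le_div_iff₀ (by linarith)] at hεL
    have h_num : (N - L : ℝ) ≤ S * (N - 1) := by
      refine le_of_mul_le_mul_right ?_ (zero_lt_one.trans_le hL)
      nlinarith
    calc ε * (N - L) ≤ ε * (S * (N - 1)) := mul_le_mul_of_nonneg_left h_num hε
      _ = ε / L * S * (L * (N - 1)) := by field_simp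

end IsHashFamily

/-! ### Circuits that hash -/

namespace Circuit

variable {N K M : ℕ} (P : Circuit N K M)

/-- The restriction of `successOp m` to the span of the input basis states `|i⟩|i⟩|y⟩|y⟩`. -/
def finalOp (m : MonomialOp (Basis P.width) (Basis P.width)) :
    MonomialOp (Fin K × Fin N) (Basis P.width) :=
  (P.successOp m).comp (diagOp N K)

/-- The unnormalized final state of the branch with operator `m`. -/
def finalState (m : MonomialOp (Basis P.width) (Basis P.width))
    (ρ : Matrix (Fin N × Fin N) (Fin N × Fin N) ℂ) :
    Matrix (Basis P.width) (Basis P.width) ℂ :=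
  (P.finalOp m).toMatrix * diagMatrix K ρ * (P.finalOp m).toMatrixᴴ

theorem successes_eq_map_finalState {D : List (MonomialOp (Basis P.width) (Basis P.width))}
    (hD : HasMonomialKraus P.steps D) {ρ : Matrix (Fin N × Fin N) (Fin N × Fin N) ℂ}
    (hρ : InDiagonal ρ) : P.successes ρ = D.map fun m => P.finalState m ρ := by
  rw [P.successes_eq_map hD]
  refine List.map_congr_left fun m _ => ?_
  rw [hρ.kronecker_dyad_maxEnt, finalState, finalOp, ← MonomialOp.toMatrix_mul_toMatrix,
    Matrix.conjTranspose_mul]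
  simp only [Matrix.mul_assoc]

/-- The branches of `P` are monomial and labelled by the list `O`. The `L` branches with `good o`
succeed and replace `|i⟩|i⟩|y⟩|y⟩` by `|μ (y, i)⟩|μ (y, i)⟩`, up to a common factor; the other
branches fail. -/
structure Hashes {Ω : Type*} (O : List Ω)
    (branch : Ω → MonomialOp (Basis P.width) (Basis P.width)) (good : Ω → Bool)
    (μ : Fin K × Fin N → Fin M) (L : ℕ) : Prop where
  hasKraus : HasMonomialKraus P.steps (O.map branch)
  load_injective : Function.Injective (loadBasis N K P.width)
  reads : ∀ o ∈ O, ∀ a,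
    (branch o).map (loadBasis N K P.width a) (Party.alice, P.flag) = false →
      P.Reads ((branch o).map (loadBasis N K P.width a)) (μ (a.2.1, a.1.1), μ (a.2.2, a.1.2))
  flag_eq : ∀ o ∈ O, ∀ i y, (branch o).map (loadBasis N K P.width ((i, i), (y, y)))
    (Party.alice, P.flag) = !good o
  coeff_eq : ∀ o ∈ O, good o = true → ∃ c : ℂ, c * star c = 1 ∧ ∀ i y,
    (branch o).coeff (loadBasis N K P.width ((i, i), (y, y))) = c / L
  rest_eq : ∀ o ∈ O, good o = true → ∀ i y i' y' p r, r ∉ Set.range (P.out p) →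
    (branch o).map (loadBasis N K P.width ((i, i), (y, y))) (p, r) =
      (branch o).map (loadBasis N K P.width ((i', i'), (y', y'))) (p, r)
  count : (O.filter good).length = L

namespace Hashes

variable {P} {Ω : Type*} {O : List Ω}
  {branch : Ω → MonomialOp (Basis P.width) (Basis P.width)} {good : Ω → Bool}
  {μ : Fin K × Fin N → Fin M} {lam L : ℕ} (h : P.Hashes O branch good μ L)

include h

theorem trace_output {ρ : Matrix (Fin N × Fin N) (Fin N × Fin N) ℂ}
    {τ : Matrix (Basis P.width) (Basis P.width) ℂ} (hτ : τ ∈ P.successes ρ) :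
    (P.output τ).trace = τ.trace := by
  refine P.trace_output_of_mem_successes h.hasKraus (fun m hm a ha => ?_) hτ
  obtain ⟨o, ho, rfl⟩ := List.mem_map.1 hm
  exact ⟨_, h.reads o ho a ha⟩

theorem finalOp_coeff {o : Ω} (ho : o ∈ O) (q : Fin K × Fin N) :
    (P.finalOp (branch o)).coeff q =
      if good o then (branch o).coeff (loadBasis N K P.width ((q.2, q.2), (q.1, q.1))) else 0 := by
  simp [finalOp, successOp, MonomialOp.comp, diagOp, MonomialOp.ofMap, projOp,
    h.flag_eq o ho q.2 q.1]

theorem finalState_eq_zero {o : Ω} (ho : o ∈ O) (h_good : good o = false)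
    (ρ : Matrix (Fin N × Fin N) (Fin N × Fin N) ℂ) : P.finalState (branch o) ρ = 0 := by
  ext s s'
  rw [finalState, MonomialOp.mul_mul_conjTranspose_apply]
  simp [h.finalOp_coeff ho, h_good]

section Good

variable {o : Ω} (ho : o ∈ O) (h_good : good o = true)

include ho h_good

theorem reads_finalOp (q : Fin K × Fin N) : P.Reads ((P.finalOp (branch o)).map q) (μ q, μ q) :=
  h.reads o ho _ ((h.flag_eq o ho q.2 q.1).trans (by rw [h_good]; rfl))

theorem finalOp_map_eq_iff (q q' : Fin K × Fin N) :
    (P.finalOp (branch o)).map q = (P.finalOp (branch o)).map q' ↔ μ q = μ q' := by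
  have h_reads := h.reads_finalOp ho h_good
  refine ⟨fun h_eq => ?_, fun h_eq => ?_⟩
  · have h_unique := (h_eq ▸ h_reads q).unique (h_reads q')
    exact (Prod.ext_iff.1 h_unique).1
  · exact (h_eq ▸ h_reads q).eq_of_eq_rest (h_reads q') (h.rest_eq o ho h_good _ _ _ _)

theorem coeff_mul_diagMatrix_mul_star (ρ : Matrix (Fin N × Fin N) (Fin N × Fin N) ℂ)
    (q q' : Fin K × Fin N) :
    (P.finalOp (branch o)).coeff q * diagMatrix K ρ q q' * star ((P.finalOp (branch o)).coeff q') =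
      1 / ((L : ℂ) ^ 2 * K) * ρ (q.2, q.2) (q'.2, q'.2) := by
  obtain ⟨c, hc, h_coeff⟩ := h.coeff_eq o ho h_good
  simp only [h.finalOp_coeff ho, h_good, if_true, h_coeff, diagMatrix, Matrix.of_apply, star_div₀,
    star_natCast]
  linear_combination 1 / ((L : ℂ) ^ 2 * K) * ρ (q.2, q.2) (q'.2, q'.2) * hc

variable {ρ : Matrix (Fin N × Fin N) (Fin N × Fin N) ℂ} (hρ : InDiagonal ρ)
  (H : IsHashFamily μ lam L)

include hρ H

theorem trace_finalState : (P.finalState (branch o) ρ).trace =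
    ((successProb N K lam L (fidelity ρ) / L : ℝ) : ℂ) := by
  have hL : (L : ℂ) ≠ 0 := by exact_mod_cast H.L_pos.ne'
  have hK : (K : ℂ) ≠ 0 := by exact_mod_cast H.K_pos.ne'
  rw [finalState, MonomialOp.trace_mul_mul_conjTranspose]
  simp only [h.finalOp_map_eq_iff ho h_good, h.coeff_mul_diagMatrix_mul_star ho h_good]
  rw [H.sum_collisions fun i j => 1 / ((L : ℂ) ^ 2 * K) * ρ (i, i) (j, j)]
  simp only [← Finset.mul_sum]
  rw [hρ.sum_apply_diag,
    sum_sum_apply_diag hρ.isHermitian H.N_ne_zero, successProb]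
  push_cast
  field_simp

theorem overlap_finalState : P.overlap (P.finalState (branch o) ρ) =
    ((K * (N * fidelity ρ) / L ^ 2 : ℝ) : ℂ) := by
  have hK : (K : ℂ) ≠ 0 := by exact_mod_cast H.K_pos.ne'
  rw [finalState, P.overlap_mul_mul_conjTranspose _ _ (h.reads_finalOp ho h_good)
    fun q q' => h.rest_eq o ho h_good q.2 q.1 q'.2 q'.1]
  simp only [h.coeff_mul_diagMatrix_mul_star ho h_good, Fintype.sum_prod_type, ← Finset.mul_sum]
  simp only [Finset.sum_const, Finset.card_univ, Fintype.card_fin, nsmul_eq_mul, ← Finset.mul_sum,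
    sum_sum_apply_diag hρ.isHermitian H.N_ne_zero]
  push_cast
  field_simp

theorem fidelity_output_finalState :
    fidelity (((P.finalState (branch o) ρ).trace)⁻¹ • P.output (P.finalState (branch o) ρ)) =
      fidelity ρ / successProb N K lam L (fidelity ρ) := by
  have hL : (L : ℝ) ≠ 0 := by exact_mod_cast H.L_pos.ne'
  have hN : (N : ℝ) ≠ 0 := by exact_mod_cast H.N_ne_zero
  have hK : (K : ℝ) ≠ 0 := by exact_mod_cast H.K_pos.ne'
  have hML : (M : ℝ) * L = N * K := by exact_mod_cast H.M_mul
  have hM : (M : ℝ) ≠ 0 := left_ne_zero_of_mul (hML ▸ mul_ne_zero hN hK)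
  rw [fidelity_smul_output, h.trace_finalState ho h_good hρ H,
    h.overlap_finalState ho h_good hρ H]
  rw [← Complex.ofReal_inv, ← Complex.ofReal_mul, one_div_mul_eq_div, Complex.div_natCast_re,
    Complex.ofReal_re]
  calc (successProb N K lam L (fidelity ρ) / L)⁻¹ * (K * (N * fidelity ρ) / L ^ 2) / M
      = (N * K) / (M * L) * (fidelity ρ / successProb N K lam L (fidelity ρ)) := by
        field_simp
    _ = fidelity ρ / successProb N K lam L (fidelity ρ) := by
        rw [hML, div_self (mul_ne_zero hN hK), one_mul]

end Good

variable {ρ : Matrix (Fin N × Fin N) (Fin N × Fin N) ℂ} (hρ : InDiagonal ρ)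
  (H : IsHashFamily μ lam L)

include hρ

theorem successes_eq : P.successes ρ = O.map fun o => P.finalState (branch o) ρ := by
  rw [P.successes_eq_map_finalState h.hasKraus hρ, List.map_map]
  rfl

include H

theorem succProb_eq : P.succProb ρ = successProb N K lam L (fidelity ρ) := by
  have hL : (L : ℝ) ≠ 0 := by exact_mod_cast H.L_pos.ne'
  have h_trace : ∀ o ∈ O, (P.finalState (branch o) ρ).trace.re =
      if good o then successProb N K lam L (fidelity ρ) / L else 0 := by
    intro o ho
    cases h_good : good o
    · simp [h.finalState_eq_zero ho h_good]
    · rw [h.trace_finalState ho h_good hρ H, Complex.ofReal_re, if_pos rfl]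
  rw [succProb, h.successes_eq hρ, List.map_map]
  simp only [Function.comp_def]
  rw [List.map_congr_left h_trace, List.sum_map_ite]
  simp [h.count, mul_div_cancel₀ _ hL]

theorem goodProb_eq {δ : ℝ} (h_pos : 0 < successProb N K lam L (fidelity ρ))
    (hδ : successProb N K lam L (fidelity ρ) - fidelity ρ ≤
      δ * successProb N K lam L (fidelity ρ)) : P.goodProb ρ δ = P.succProb ρ := by
  rw [goodProb, succProb, h.successes_eq hρ, List.map_map, List.map_map]
  refine congrArg List.sum (List.map_congr_left fun o ho => ?_)
  simp only [Function.comp]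
  cases h_good : good o
  · simp [h.finalState_eq_zero ho h_good]
  · rw [h.fidelity_output_finalState ho h_good hρ H]
    refine if_pos ?_
    rw [le_div_iff₀ h_pos]
    linarith

end Hashes

theorem Hashes.detSuccessful {P : GEPP N K M} {Ω : Type*} {O : List Ω}
    {branch : Ω → MonomialOp (Basis P.width) (Basis P.width)} {good : Ω → Bool}
    {μ : Fin K × Fin N → Fin M} {lam L : ℕ} (h : P.toCircuit.Hashes O branch good μ L)
    (H : IsHashFamily μ lam L) {ε δ : ℝ} (hε : ε < 1 / 2)
    (hδ : δ = 2 * ε / L ∨ (ε ≤ L / N ∧ δ = ε / L)) : P.DetSuccessful ε δ ε := by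
  intro ρ hρ h_fid
  have hε_nonneg : 0 ≤ ε := by linarith [hρ.fidelity_le_one]
  have h_succ := h.succProb_eq hρ H
  have h_le := H.one_sub_le_successProb hε_nonneg
  have h_sub := H.successProb_sub_le hε_nonneg hε hδ
  rw [← h_fid] at h_le h_sub
  have h_pos : 0 < successProb N K lam L (fidelity ρ) := by linarith
  have h_total := P.failProb_add_succProb H.K_pos.ne' h.load_injective hρ.trace_eq_one
  refine ⟨by linarith, ?_⟩
  rw [h.goodProb_eq hρ H h_pos h_sub, h_succ]
  exact div_self h_pos.ne'

end Circuit

/-! ### Classical reversible circuits -/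

/-- Classical reversible gates on wires that are labelled by natural numbers. -/
inductive Gate
  | not (q : ℕ)
  | cnot (c q : ℕ)
  | toff (b c q : ℕ)

namespace Gate

/-- The wires of a gate, first the one that it changes. -/
def wires : Gate → List ℕ
  | .not q => [q]
  | .cnot c q => [q, c]
  | .toff b c q => [q, b, c]

/-- The wire that is changed by a gate. -/
def target : Gate → ℕ
  | .not q => q
  | .cnot _ q => q
  | .toff _ _ q => q

/-- The value that a gate adds to its target. -/
def value : Gate → (ℕ → ZMod 2) → ZMod 2
  | .not _, _ => 1
  | .cnot c _, u => u c
  | .toff b c _, u => u b * u c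

/-- The action of a gate. -/
def eval (g : Gate) (u : ℕ → ZMod 2) : ℕ → ZMod 2 :=
  Function.update u g.target (u g.target + g.value u)

theorem target_mem_wires (g : Gate) : g.target ∈ g.wires := by
  cases g <;> exact List.mem_cons_self

theorem value_congr {g : Gate} {u u' : ℕ → ZMod 2} (hg : g.wires.Nodup)
    (h : ∀ q ∈ g.wires, q ≠ g.target → u q = u' q) : g.value u = g.value u' := by
  cases g with
  | not q => rfl
  | cnot c q =>
    have hc : c ≠ q := by simpa [wires, eq_comm] using hg
    exact h c (by simp [wires]) hc
  | toff b c q =>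
    obtain ⟨⟨hb, hc⟩, -⟩ : (b ≠ q ∧ c ≠ q) ∧ b ≠ c := by simpa [wires, eq_comm] using hg
    exact congrArg₂ (· * ·) (h b (by simp [wires]) hb) (h c (by simp [wires]) hc)

theorem eval_of_ne {g : Gate} {u : ℕ → ZMod 2} {q : ℕ} (h : q ≠ g.target) :
    g.eval u q = u q := Function.update_of_ne h _ _

theorem eval_target (g : Gate) (u : ℕ → ZMod 2) :
    g.eval u g.target = u g.target + g.value u := Function.update_self _ _ _

theorem eval_eval {g : Gate} (hg : g.wires.Nodup) (u : ℕ → ZMod 2) : g.eval (g.eval u) = u := by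
  have h_value : g.value (g.eval u) = g.value u := value_congr hg fun q _ hq => eval_of_ne hq
  funext q
  by_cases hq : q = g.target
  · rw [hq, eval_target, eval_target, h_value, add_assoc, CharTwo.add_self_eq_zero, add_zero]
  · rw [eval_of_ne hq, eval_of_ne hq]

theorem eqOn_eval {g : Gate} {S : Set ℕ} (hg : ∀ q ∈ g.wires, q ∈ S) {u u' : ℕ → ZMod 2}
    (h : Set.EqOn u u' S) : Set.EqOn (g.eval u) (g.eval u') S := by
  have h_value : g.value u = g.value u' := by
    cases g with
    | not q => rfl
    | cnot c q => exact h (hg c (by simp [wires]))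
    | toff b c q =>
      exact congrArg₂ (· * ·) (h (hg b (by simp [wires]))) (h (hg c (by simp [wires])))
  intro q hq
  by_cases h_target : q = g.target
  · rw [h_target, eval_target, eval_target, h_value, h (hg _ g.target_mem_wires)]
  · rw [eval_of_ne h_target, eval_of_ne h_target, h hq]

/-- The action of a list of gates. -/
def evalList (l : List Gate) (u : ℕ → ZMod 2) : ℕ → ZMod 2 := l.foldl (fun u g => g.eval u) u

@[simp] theorem evalList_nil (u : ℕ → ZMod 2) : evalList [] u = u := rfl

@[simp] theorem evalList_cons (g : Gate) (l : List Gate) (u : ℕ → ZMod 2) :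
    evalList (g :: l) u = evalList l (g.eval u) := rfl

theorem evalList_append (l l' : List Gate) (u : ℕ → ZMod 2) :
    evalList (l ++ l') u = evalList l' (evalList l u) := List.foldl_append

theorem evalList_of_forall_ne {l : List Gate} {u : ℕ → ZMod 2} {q : ℕ}
    (h : ∀ g ∈ l, q ≠ g.target) : evalList l u q = u q := by
  induction l generalizing u with
  | nil => rfl
  | cons g l ih =>
    rw [evalList_cons, ih fun g' hg' => h g' (List.mem_cons_of_mem _ hg'),
      eval_of_ne (h g List.mem_cons_self)]

theorem evalList_reverse_evalList {l : List Gate} (hl : ∀ g ∈ l, g.wires.Nodup)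
    (u : ℕ → ZMod 2) : evalList l.reverse (evalList l u) = u := by
  induction l generalizing u with
  | nil => rfl
  | cons g l ih =>
    rw [List.reverse_cons, evalList_append, evalList_cons g l u,
      ih fun g' hg' => hl g' (List.mem_cons_of_mem _ hg')]
    exact eval_eval (hl g List.mem_cons_self) u

theorem eqOn_evalList {l : List Gate} {S : Set ℕ} (hl : ∀ g ∈ l, ∀ q ∈ g.wires, q ∈ S)
    {u u' : ℕ → ZMod 2} (h : Set.EqOn u u' S) : Set.EqOn (evalList l u) (evalList l u') S := by
  induction l generalizing u u' with
  | nil => exact h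
  | cons g l ih =>
    exact ih (fun g' hg' => hl g' (List.mem_cons_of_mem _ hg'))
      (eqOn_eval (hl g List.mem_cons_self) h)

/- Uncomputation: gates `gs'` that do not change the wires `S` of `gs` may be conjugated by `gs`. -/
theorem evalList_conj_of_mem {gs gs' : List Gate} (hgs : ∀ g ∈ gs, g.wires.Nodup) {S : Set ℕ}
    (hS : ∀ g ∈ gs, ∀ q ∈ g.wires, q ∈ S) {u : ℕ → ZMod 2}
    (h : Set.EqOn (evalList gs' (evalList gs u)) (evalList gs u) S) {q : ℕ} (hq : q ∈ S) :
    evalList (gs ++ gs' ++ gs.reverse) u q = u q := by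
  rw [evalList_append, evalList_append,
    eqOn_evalList (fun g hg => hS g (List.mem_reverse.1 hg)) h hq, evalList_reverse_evalList hgs]

theorem evalList_conj_of_notMem {gs gs' : List Gate} {S : Set ℕ}
    (hS : ∀ g ∈ gs, ∀ q ∈ g.wires, q ∈ S) {u : ℕ → ZMod 2} {q : ℕ} (hq : q ∉ S) :
    evalList (gs ++ gs' ++ gs.reverse) u q = evalList gs' (evalList gs u) q := by
  rw [evalList_append, evalList_append]
  refine evalList_of_forall_ne fun g hg h_eq => hq ?_
  exact h_eq ▸ hS g (List.mem_reverse.1 hg) _ g.target_mem_wires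

theorem evalList_map_toff {ι : Type*} (l : List ι) {b c t : ι → ℕ} (hb : ∀ x x', b x ≠ t x')
    (hc : ∀ x x', c x ≠ t x') (u : ℕ → ZMod 2) (q : ℕ) :
    evalList (l.map fun x => .toff (b x) (c x) (t x)) u q =
      u q + (l.map fun x => if t x = q then u (b x) * u (c x) else 0).sum := by
  induction l generalizing u with
  | nil => simp
  | cons x l ih =>
    have h_eval (r : ℕ) : (Gate.toff (b x) (c x) (t x)).eval u r =
        u r + if t x = r then u (b x) * u (c x) else 0 := by
      split_ifs with h
      · exact h ▸ eval_target (.toff (b x) (c x) (t x)) u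
      · rw [add_zero]
        exact eval_of_ne (g := .toff (b x) (c x) (t x)) (Ne.symm h)
    simp only [List.map_cons, evalList_cons, ih, List.sum_cons, h_eval, (hb _ _).symm,
      (hc _ _).symm, if_false, add_zero, add_assoc]

/-- The gates that add the product of the matrix on the wires `W i k` and the vector on the wires
`s + k` to the wires `d + i`. -/
def mulVecGates {a : ℕ} (W : Fin a → Fin a → ℕ) (s d : ℕ) : List Gate :=
  (Finset.univ.toList : List (Fin a × Fin a)).map fun x => .toff (W x.1 x.2) (s + x.2) (d + x.1)

section

variable {a : ℕ} {W : Fin a → Fin a → ℕ} {s d : ℕ}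

theorem length_mulVecGates : (mulVecGates W s d).length = a ^ 2 := by
  simp [mulVecGates, sq]

theorem exists_of_mem_mulVecGates {g : Gate} (hg : g ∈ mulVecGates W s d) :
    ∃ i k : Fin a, g = .toff (W i k) (s + k) (d + i) := by
  obtain ⟨x, -, rfl⟩ := List.mem_map.1 hg
  exact ⟨x.1, x.2, rfl⟩

theorem evalList_mulVecGates_of_forall_ne {u : ℕ → ZMod 2} {q : ℕ} (hq : ∀ i : Fin a, q ≠ d + i) :
    evalList (mulVecGates W s d) u q = u q := by
  refine evalList_of_forall_ne fun g hg => ?_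
  obtain ⟨i, k, rfl⟩ := exists_of_mem_mulVecGates hg
  exact hq i

theorem evalList_mulVecGates (hW : ∀ i k, ∀ j : Fin a, W i k ≠ d + j)
    (hs : ∀ k j : Fin a, s + k ≠ d + (j : ℕ)) (u : ℕ → ZMod 2) (i : Fin a) :
    evalList (mulVecGates W s d) u (d + i) =
      u (d + i) + ((Matrix.of fun i k => u (W i k)) *ᵥ fun k : Fin a => u (s + k)) i := by
  rw [mulVecGates, evalList_map_toff _ (fun x x' => hW x.1 x.2 x'.1) fun x x' => hs x.2 x'.1,
    Finset.sum_map_toList, Fintype.sum_prod_type]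
  simp only [add_right_inj, ← Fin.ext_iff]
  rw [Finset.sum_eq_single i (fun j _ hj => Finset.sum_eq_zero fun k _ => if_neg hj) (by simp)]
  simp only [if_true, Matrix.mulVec, dotProduct, Matrix.of_apply]

end

end Gate

/-! ### Straight-line programs -/

/-- The binary digits of a natural number. -/
def bitZ (n i : ℕ) : ZMod 2 := if n.testBit i then 1 else 0

/-- `IsProgram a l`: the functions in the list `l`, from the end to the start, can be computed one
after the other from the first `a` binary digits of the argument; each step is a constant, a
digit, or a sum or product of earlier functions. -/
inductive IsProgram (a : ℕ) {K : ℕ} : List (Fin K → ZMod 2) → Prop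
  | nil : IsProgram a []
  | one {l} : IsProgram a l → IsProgram a (1 :: l)
  | bit {l} (i : ℕ) (hi : i < a) : IsProgram a l → IsProgram a ((fun y => bitZ y i) :: l)
  | add {l} (f g) (hf : f ∈ l) (hg : g ∈ l) : IsProgram a l → IsProgram a ((f + g) :: l)
  | mul {l} (f g) (hf : f ∈ l) (hg : g ∈ l) : IsProgram a l → IsProgram a ((f * g) :: l)

/-- The wires `a, …, 2 a - 1` hold the number `y`, and the wires from `B` on hold `0`. -/
def Loaded (a B y : ℕ) (u : ℕ → ZMod 2) : Prop :=
  (∀ i < a, u (a + i) = bitZ y i) ∧ ∀ r, B ≤ r → u r = 0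

theorem Loaded.mono {a B B' y : ℕ} {u : ℕ → ZMod 2} (h : Loaded a B y u) (hB : B ≤ B') :
    Loaded a B' y u := ⟨h.1, fun r hr => h.2 r (hB.trans hr)⟩

/-- The gates `gs` compute the functions in `l` on the wires `B, B + 1, …`. -/
structure Computes (a B : ℕ) {K : ℕ} (l : List (Fin K → ZMod 2)) (gs : List Gate) : Prop where
  length_le : gs.length ≤ 2 * l.length
  nodup : ∀ g ∈ gs, g.wires.Nodup
  wires : ∀ g ∈ gs, ∀ q ∈ g.wires, (a ≤ q ∧ q < 2 * a) ∨ (B ≤ q ∧ q < B + l.length)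
  target : ∀ g ∈ gs, B ≤ g.target
  value : ∀ f ∈ l, ∃ q, B ≤ q ∧ q < B + l.length ∧ ∀ (y : Fin K) (u : ℕ → ZMod 2),
    Loaded a B y u → Gate.evalList gs u q = f y

namespace Computes

variable {a B K : ℕ} {l : List (Fin K → ZMod 2)} {gs : List Gate} (h : Computes a B l gs)

include h

theorem append {f : Fin K → ZMod 2} {gs' : List Gate} (h_length : gs'.length ≤ 2)
    (h_nodup : ∀ g ∈ gs', g.wires.Nodup) (h_target : ∀ g ∈ gs', g.target = B + l.length)
    (h_wires : ∀ g ∈ gs', ∀ q ∈ g.wires, q = g.target ∨ (a ≤ q ∧ q < 2 * a) ∨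
      (B ≤ q ∧ q < B + l.length))
    (h_value : ∀ (y : Fin K) (u : ℕ → ZMod 2), Loaded a B y u →
      Gate.evalList gs' (Gate.evalList gs u) (B + l.length) = f y) :
    Computes a B (f :: l) (gs ++ gs') where
  length_le := by
    have := h.length_le
    simp only [List.length_append, List.length_cons]
    lia
  nodup := List.forall_mem_append.2 ⟨h.nodup, h_nodup⟩
  wires := by
    rw [List.length_cons]
    refine List.forall_mem_append.2 ⟨fun g hg q hq => ?_, fun g hg q hq => ?_⟩
    · have := h.wires g hg q hq
      lia
    · have := h_wires g hg q hq
      have := h_target g hg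
      lia
  target := List.forall_mem_append.2 ⟨h.target, fun g hg => by rw [h_target g hg]; lia⟩
  value := by
    rw [List.length_cons]
    refine List.forall_mem_cons.2 ⟨?_, fun f' hf' => ?_⟩
    · refine ⟨B + l.length, by lia, by lia, fun y u hu => ?_⟩
      rw [Gate.evalList_append, h_value y u hu]
    · obtain ⟨q, hBq, hql, hq⟩ := h.value f' hf'
      refine ⟨q, hBq, by lia, fun y u hu => ?_⟩
      rw [Gate.evalList_append, Gate.evalList_of_forall_ne, hq y u hu]
      intro g hg
      rw [h_target g hg]
      lia

theorem evalList_next (hB : 2 * a ≤ B) {y : ℕ} {u : ℕ → ZMod 2} (hu : Loaded a B y u) :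
    Gate.evalList gs u (B + l.length) = 0 := by
  rw [Gate.evalList_of_forall_ne, hu.2 _ (by lia)]
  intro g hg
  have := h.wires g hg _ g.target_mem_wires
  lia

theorem evalList_digit (hB : 2 * a ≤ B) {y i : ℕ} (hi : i < a) {u : ℕ → ZMod 2}
    (hu : Loaded a B y u) : Gate.evalList gs u (a + i) = bitZ y i := by
  rw [Gate.evalList_of_forall_ne, hu.1 i hi]
  intro g hg
  have := h.target g hg
  lia

theorem one (hB : 2 * a ≤ B) : Computes a B (1 :: l) (gs ++ [.not (B + l.length)]) := by
  refine h.append (by simp) (by simp [Gate.wires]) (by simp [Gate.target])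
    (by simp [Gate.wires, Gate.target]) fun y u hu => ?_
  simp [Gate.eval, Gate.target, Gate.value, h.evalList_next hB hu]

theorem bit (hB : 2 * a ≤ B) {i : ℕ} (hi : i < a) :
    Computes a B ((fun y => bitZ y i) :: l) (gs ++ [.cnot (a + i) (B + l.length)]) := by
  refine h.append (by simp) ?_ (by simp [Gate.target]) ?_ fun y u hu => ?_
  · simp [Gate.wires]; lia
  · simp [Gate.wires, Gate.target]; lia
  · simp [Gate.eval, Gate.target, Gate.value, h.evalList_next hB hu, h.evalList_digit hB hi hu]

theorem add (hB : 2 * a ≤ B) {f g : Fin K → ZMod 2} (hf : f ∈ l) (hg : g ∈ l) :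
    ∃ gs', Computes a B ((f + g) :: l) gs' := by
  obtain ⟨q, hBq, hql, hq⟩ := h.value f hf
  obtain ⟨r, hBr, hrl, hr⟩ := h.value g hg
  refine ⟨_, h.append (gs' := [.cnot q (B + l.length), .cnot r (B + l.length)]) (by simp) ?_
    (by simp [Gate.target]) ?_ fun y u hu => ?_⟩
  · simp [Gate.wires]; lia
  · simp [Gate.wires, Gate.target]; lia
  · simp [Gate.eval, Gate.target, Gate.value, h.evalList_next hB hu, hq y u hu, hr y u hu,
      (show r ≠ B + l.length by lia)]

theorem mul (hB : 2 * a ≤ B) {f g : Fin K → ZMod 2} (hf : f ∈ l) (hg : g ∈ l) :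
    ∃ gs', Computes a B ((f * g) :: l) gs' := by
  obtain ⟨q, hBq, hql, hq⟩ := h.value f hf
  obtain ⟨r, hBr, hrl, hr⟩ := h.value g hg
  rcases eq_or_ne q r with rfl | hqr
  · refine ⟨_, h.append (gs' := [.cnot q (B + l.length)]) (by simp) ?_ (by simp [Gate.target]) ?_
      fun y u hu => ?_⟩
    · simp [Gate.wires]; lia
    · simp [Gate.wires, Gate.target]; lia
    · have h_eq : f y = g y := (hq y u hu).symm.trans (hr y u hu)
      have h_sq : ∀ x : ZMod 2, x = x * x := by decide
      simp [Gate.eval, Gate.target, Gate.value, h.evalList_next hB hu, hq y u hu, ← h_eq, ← h_sq]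
  · refine ⟨_, h.append (gs' := [.toff q r (B + l.length)]) (by simp) ?_ (by simp [Gate.target]) ?_
      fun y u hu => ?_⟩
    · simp [Gate.wires]; lia
    · simp [Gate.wires, Gate.target]; lia
    · simp [Gate.eval, Gate.target, Gate.value, h.evalList_next hB hu, hq y u hu, hr y u hu]

end Computes

theorem IsProgram.exists_computes {a B K : ℕ} (hB : 2 * a ≤ B) {l : List (Fin K → ZMod 2)}
    (hl : IsProgram a l) : ∃ gs, Computes a B l gs := by
  induction hl with
  | nil => exact ⟨[], by constructor <;> simp⟩
  | one _ ih => exact ih.imp' _ fun _ h => h.one hB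
  | bit i hi _ ih => exact ih.imp' _ fun _ h => h.bit hB hi
  | add f g hf hg _ ih => exact ih.elim fun _ h => h.add hB hf hg
  | mul f g hf hg _ ih => exact ih.elim fun _ h => h.mul hB hf hg

/-! ### In-place linear maps that depend on the auxiliary register -/

/-- The gates `gs`, on the wires below `w`, map `|x⟩|y⟩|0⟩` to `|0⟩|y⟩|A y x⟩`, where the three
registers consist of `a` wires each. -/
structure MovesMulVec {a K : ℕ} (A : Fin K → Matrix (Fin a) (Fin a) (ZMod 2)) (w : ℕ)
    (gs : List Gate) : Prop where
  nodup : ∀ g ∈ gs, g.wires.Nodup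
  lt : ∀ g ∈ gs, ∀ q ∈ g.wires, q < w
  eval_source : ∀ (y : Fin K) (u : ℕ → ZMod 2), Loaded a (2 * a) y u → ∀ i < a,
    Gate.evalList gs u i = 0
  eval_dest : ∀ (y : Fin K) (u : ℕ → ZMod 2), Loaded a (2 * a) y u → ∀ i : Fin a,
    Gate.evalList gs u (2 * a + i) = (A y *ᵥ fun k => u k) i
  eval_rest : ∀ (y : Fin K) (u : ℕ → ZMod 2), Loaded a (2 * a) y u → ∀ q, a ≤ q →
    (q < 2 * a ∨ 3 * a ≤ q) → Gate.evalList gs u q = u q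

section

variable {a B K : ℕ} {WA WB : Fin a → Fin a → ℕ}

/-- The gates that replace `|x⟩|0⟩` by `|0⟩|A x⟩`, when `A` and its inverse are held on the wires
`WA` and `WB`. -/
def moveGates (WA WB : Fin a → Fin a → ℕ) : List Gate :=
  Gate.mulVecGates WA 0 (2 * a) ++ Gate.mulVecGates WB (2 * a) 0

theorem evalList_moveGates (hWA : ∀ i k, 3 * a ≤ WA i k) (hWB : ∀ i k, 3 * a ≤ WB i k)
    {A A' : Matrix (Fin a) (Fin a) (ZMod 2)} (hA : A' * A = 1) {u : ℕ → ZMod 2}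
    (huA : ∀ i k, u (WA i k) = A i k) (huB : ∀ i k, u (WB i k) = A' i k)
    (hu : ∀ i : Fin a, u (2 * a + i) = 0) :
    (∀ i : Fin a, Gate.evalList (moveGates WA WB) u i = 0) ∧
      (∀ i : Fin a, Gate.evalList (moveGates WA WB) u (2 * a + i) = (A *ᵥ fun k => u k) i) ∧
      ∀ q, a ≤ q → (q < 2 * a ∨ 3 * a ≤ q) → Gate.evalList (moveGates WA WB) u q = u q := by
  rw [moveGates, Gate.evalList_append]
  set v := Gate.evalList (Gate.mulVecGates WA 0 (2 * a)) u with hv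
  have hv_rest (q : ℕ) (hq : q < 2 * a ∨ 3 * a ≤ q) : v q = u q :=
    Gate.evalList_mulVecGates_of_forall_ne fun i => by lia
  have hv_dest (i : Fin a) : v (2 * a + i) = (A *ᵥ fun k => u k) i := by
    have huA' : (Matrix.of fun i k => u (WA i k)) = A := Matrix.ext huA
    rw [hv, Gate.evalList_mulVecGates (fun i k j => by have := hWA i k; lia)
      (fun k j => by lia), hu, zero_add, huA']
    simp only [zero_add]
  have h_rest (q : ℕ) (hq : a ≤ q) : Gate.evalList (Gate.mulVecGates WB (2 * a) 0) v q = v q :=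
    Gate.evalList_mulVecGates_of_forall_ne fun i => by lia
  refine ⟨fun i => ?_, fun i => ?_, fun q hq hq' => ?_⟩
  · have hvB : (Matrix.of fun i k => v (WB i k)) = A' :=
      Matrix.ext fun i k => (hv_rest _ (.inr (hWB i k))).trans (huB i k)
    have h_eval := Gate.evalList_mulVecGates (s := 2 * a) (d := 0) (W := WB)
      (fun i k j => by have := hWB i k; lia) (fun k j => by lia) v i
    simp only [zero_add] at h_eval
    rw [h_eval, hvB, funext hv_dest, Matrix.mulVec_mulVec, hA, Matrix.one_mulVec,
      hv_rest _ (by lia), CharTwo.add_self_eq_zero]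
  · rw [h_rest _ (by lia), hv_dest]
  · rw [h_rest q hq, hv_rest q hq']

theorem nodup_lt_of_mem_moveGates {w : ℕ} (hWA : ∀ i k, 3 * a ≤ WA i k ∧ WA i k < w)
    (hWB : ∀ i k, 3 * a ≤ WB i k ∧ WB i k < w) :
    ∀ g ∈ moveGates WA WB, g.wires.Nodup ∧ ∀ q ∈ g.wires, q < w := by
  refine List.forall_mem_append.2 ⟨fun g hg => ?_, fun g hg => ?_⟩ <;>
    obtain ⟨i, k, rfl⟩ := Gate.exists_of_mem_mulVecGates hg
  · have := hWA i k
    constructor <;> simp [Gate.wires] <;> lia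
  · have := hWB i k
    constructor <;> simp [Gate.wires] <;> lia

variable {A A' : Fin K → Matrix (Fin a) (Fin a) (ZMod 2)} {l : List (Fin K → ZMod 2)}

/- The entries of `A y` and `A' y` are computed, used to move the vector, and uncomputed. -/
theorem Computes.movesMulVec {gs : List Gate} (h : Computes a B l gs) (hB : 3 * a ≤ B)
    (hA : ∀ y, A' y * A y = 1)
    (hWA : ∀ i k, B ≤ WA i k ∧ WA i k < B + l.length ∧ ∀ (y : Fin K) (u : ℕ → ZMod 2),
      Loaded a B y u → Gate.evalList gs u (WA i k) = A y i k)
    (hWB : ∀ i k, B ≤ WB i k ∧ WB i k < B + l.length ∧ ∀ (y : Fin K) (u : ℕ → ZMod 2),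
      Loaded a B y u → Gate.evalList gs u (WB i k) = A' y i k) :
    MovesMulVec A (B + l.length) (gs ++ moveGates WA WB ++ gs.reverse) := by
  have h_move := nodup_lt_of_mem_moveGates (w := B + l.length)
    (fun i k => ⟨hB.trans (hWA i k).1, (hWA i k).2.1⟩)
    (fun i k => ⟨hB.trans (hWB i k).1, (hWB i k).2.1⟩)
  have h_gs : ∀ g ∈ gs, g.wires.Nodup ∧ ∀ q ∈ g.wires, q < B + l.length := fun g hg =>
    ⟨h.nodup g hg, fun q hq => by have := h.wires g hg q hq; lia⟩
  have h_all : ∀ g ∈ gs ++ moveGates WA WB ++ gs.reverse,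
      g.wires.Nodup ∧ ∀ q ∈ g.wires, q < B + l.length :=
    List.forall_mem_append.2 ⟨List.forall_mem_append.2 ⟨h_gs, h_move⟩,
      fun g hg => h_gs g (List.mem_reverse.1 hg)⟩
  have h_wires : ∀ g ∈ gs, ∀ q ∈ g.wires, q ∈ {q | a ≤ q ∧ (q < 2 * a ∨ 3 * a ≤ q)} := by
    intro g hg q hq
    have := h.wires g hg q hq
    rw [Set.mem_ofPred_eq]
    lia
  have h_lt (u : ℕ → ZMod 2) {q : ℕ} (hq : q < B) : Gate.evalList gs u q = u q :=
    Gate.evalList_of_forall_ne fun g hg => (hq.trans_le (h.target g hg)).ne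
  have h_eval (y : Fin K) (u : ℕ → ZMod 2) (hu : Loaded a (2 * a) y u) :=
    evalList_moveGates (fun i k => hB.trans (hWA i k).1) (fun i k => hB.trans (hWB i k).1) (hA y)
      (fun i k => (hWA i k).2.2 y u (hu.mono (by lia)))
      (fun i k => (hWB i k).2.2 y u (hu.mono (by lia)))
      fun i => (h_lt u (by lia)).trans (hu.2 _ (by lia))
  refine ⟨fun g hg => (h_all g hg).1, fun g hg => (h_all g hg).2, fun y u hu i hi => ?_,
    fun y u hu i => ?_, fun y u hu q hq hq' => ?_⟩
  · rw [Gate.evalList_conj_of_notMem h_wires fun hi' => by have := hi'.1; lia]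
    exact (h_eval y u hu).1 ⟨i, hi⟩
  · rw [Gate.evalList_conj_of_notMem h_wires fun hi' => by have := hi'.2; lia,
      (h_eval y u hu).2.1 i]
    exact congrFun (congrArg _ (funext fun k : Fin a => h_lt u (by lia))) i
  · exact Gate.evalList_conj_of_mem h.nodup h_wires (fun r hr => (h_eval y u hu).2.2 r hr.1 hr.2)
      ⟨hq, hq'⟩

theorem IsProgram.exists_movesMulVec (hB : 3 * a ≤ B) (hA : ∀ y, A' y * A y = 1)
    (hl : IsProgram a l) (hlA : ∀ i k, (fun y => A y i k) ∈ l)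
    (hlA' : ∀ i k, (fun y => A' y i k) ∈ l) :
    ∃ gs : List Gate, gs.length ≤ 4 * l.length + 2 * a ^ 2 ∧
      MovesMulVec A (B + l.length) gs := by
  obtain ⟨gs, h⟩ := hl.exists_computes (B := B) (by lia)
  choose WA hWA using fun i k => h.value _ (hlA i k)
  choose WB hWB using fun i k => h.value _ (hlA' i k)
  refine ⟨_, ?_, h.movesMulVec hB hA hWA hWB⟩
  have := h.length_le
  simp only [moveGates, List.length_append, List.length_reverse, Gate.length_mulVecGates]
  lia

end

/-! ### Classical gates on the qubits of a party -/

/-- Elements of `ZMod 2` as Booleans. -/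
def toB (x : ZMod 2) : Bool := decide (x = 1)

theorem toB_add (x y : ZMod 2) : toB (x + y) = xor (toB x) (toB y) := by
  revert x y; decide

theorem toB_mul (x y : ZMod 2) : toB (x * y) = (toB x && toB y) := by
  revert x y; decide

theorem toB_eq_true_iff {x : ZMod 2} : toB x = true ↔ x ≠ 0 := by
  revert x; decide

theorem toB_injective : Function.Injective toB := by
  intro x y; revert x y; decide

theorem toB_bitZ (n i : ℕ) : toB (bitZ n i) = n.testBit i := by
  rw [bitZ]; cases n.testBit i <;> decide

section Wires

variable {w : ℕ}

/-- The basis state given by the values of the wires of the two parties. -/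
def wireState (u : Party → ℕ → ZMod 2) : Basis w := fun x => toB (u x.1 x.2)

theorem update_wireState (u : Party → ℕ → ZMod 2) (p : Party) (q : Fin w) (x : ZMod 2) :
    Function.update (wireState u) (p, q) (toB x) =
      (wireState (Function.update u p (Function.update (u p) q x)) : Basis w) := by
  refine (Function.eq_update_iff.2 ⟨by simp [wireState], ?_⟩).symm
  rintro ⟨p', r⟩ h
  rcases eq_or_ne p' p with rfl | hp
  · have hr : (r : ℕ) ≠ q := fun h' => h (by rw [Fin.ext h'])
    simp [wireState, hr]
  · simp [wireState, hp]

/-- The steps `l` implement the gates `gs` of party `p`, and map each basis state `|s⟩` to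
`|f s⟩`. -/
structure Simulates (p : Party) (gs : List Gate) (l : List (Step w)) (f : Basis w → Basis w) :
    Prop where
  length_eq : l.length = gs.length
  hasKraus : HasMonomialKraus l [.ofMap f]
  map_wireState : ∀ u, f (wireState u) = wireState (Function.update u p (Gate.evalList gs (u p)))

theorem Gate.exists_step (p : Party) {g : Gate} (h_nodup : g.wires.Nodup)
    (h_lt : ∀ q ∈ g.wires, q < w) : ∃ (o : Step w) (f : Basis w → Basis w),
      o.kraus = [basisMap f] ∧
        ∀ u, f (wireState u) = wireState (Function.update u p (g.eval (u p))) := by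
  cases g with
  | not q =>
    obtain ⟨q, rfl⟩ : ∃ q' : Fin w, (q' : ℕ) = q := ⟨⟨q, h_lt q (by simp [wires])⟩, rfl⟩
    refine ⟨.flip p q, _, rfl, fun u => ?_⟩
    refine Eq.trans ?_ (update_wireState u p q (u p q + 1))
    rw [negate, toB_add, show toB 1 = true by decide, Bool.xor_true]
    rfl
  | cnot c q =>
    obtain ⟨q, rfl⟩ : ∃ q' : Fin w, (q' : ℕ) = q := ⟨⟨q, h_lt q (by simp [wires])⟩, rfl⟩
    obtain ⟨c, rfl⟩ : ∃ c' : Fin w, (c' : ℕ) = c := ⟨⟨c, h_lt c (by simp [wires])⟩, rfl⟩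
    have hcq : c ≠ q := by simpa [wires, eq_comm, Fin.ext_iff] using h_nodup
    refine ⟨.cnot p c q hcq, _, rfl, fun u => ?_⟩
    refine Eq.trans ?_ (update_wireState u p q (u p q + u p c))
    rw [toB_add]
    rfl
  | toff b c q =>
    obtain ⟨q, rfl⟩ : ∃ q' : Fin w, (q' : ℕ) = q := ⟨⟨q, h_lt q (by simp [wires])⟩, rfl⟩
    obtain ⟨b, rfl⟩ : ∃ b' : Fin w, (b' : ℕ) = b := ⟨⟨b, h_lt b (by simp [wires])⟩, rfl⟩
    obtain ⟨c, rfl⟩ : ∃ c' : Fin w, (c' : ℕ) = c := ⟨⟨c, h_lt c (by simp [wires])⟩, rfl⟩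
    obtain ⟨⟨hbq, hcq⟩, hbc⟩ : (b ≠ q ∧ c ≠ q) ∧ b ≠ c := by
      simpa [wires, eq_comm, Fin.ext_iff] using h_nodup
    refine ⟨.toffoli p b c q hbc hbq hcq, _, rfl, fun u => ?_⟩
    refine Eq.trans ?_ (update_wireState u p q (u p q + u p b * u p c))
    rw [toB_add, toB_mul]
    rfl

theorem exists_simulates (p : Party) {gs : List Gate} (h_nodup : ∀ g ∈ gs, g.wires.Nodup)
    (h_lt : ∀ g ∈ gs, ∀ q ∈ g.wires, q < w) :
    ∃ (l : List (Step w)) (f : Basis w → Basis w), Simulates p gs l f := by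
  induction gs with
  | nil => exact ⟨[], id, rfl, hasMonomialKraus_nil, fun u => by simp⟩
  | cons g gs ih =>
    rw [List.forall_mem_cons] at h_nodup h_lt
    obtain ⟨l, f, h⟩ := ih h_nodup.2 h_lt.2
    obtain ⟨o, f', h_kraus, h_map⟩ := Gate.exists_step p h_nodup.1 h_lt.1
    refine ⟨o :: l, f ∘ f', by simp [h.length_eq], ?_, fun u => by simp [h_map, h.map_wireState]⟩
    simpa [MonomialOp.comp, MonomialOp.ofMap, Function.comp_def] using
      (hasMonomialKraus_singleton h_kraus).append h.hasKraus

end Wires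

/-! ### The disjunction of a list of wires -/

/-- Gates that compute on wire `f + hs.length` the disjunction of wire `f` and the wires in `hs`,
when all the wires above `f` hold `0`. -/
def orGates : ℕ → List ℕ → List Gate
  | _, [] => []
  | f, h :: hs => [.cnot f (f + 1), .cnot h (f + 1), .toff f h (f + 1)] ++ orGates (f + 1) hs

theorem length_orGates (f : ℕ) (hs : List ℕ) : (orGates f hs).length = 3 * hs.length := by
  induction hs generalizing f with
  | nil => rfl
  | cons h hs ih =>
    simp only [orGates, List.length_append, List.length_cons, List.length_nil, ih]
    ring

theorem nodup_lt_of_mem_orGates {f w : ℕ} {hs : List ℕ} (hf : ∀ h ∈ hs, h < f)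
    (hw : f + hs.length < w) :
    ∀ g ∈ orGates f hs, g.wires.Nodup ∧ ∀ q ∈ g.wires, q < w := by
  induction hs generalizing f with
  | nil => simp [orGates]
  | cons h hs ih =>
    rw [List.forall_mem_cons] at hf
    rw [List.length_cons] at hw
    refine List.forall_mem_append.2
      ⟨?_, ih (fun h' hh' => (hf.2 h' hh').trans f.lt_succ_self) (by lia)⟩
    simp only [List.mem_cons, List.not_mem_nil, or_false, Gate.wires, forall_eq_or_imp,
      List.nodup_cons, Nat.add_eq_left, one_ne_zero, or_self, not_false_eq_true, List.nodup_nil,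
      and_self, forall_eq, true_and, and_true, false_or]
    lia

theorem evalList_orGates_cons {f h : ℕ} (hs : List ℕ) (hf : h < f) {u : ℕ → ZMod 2}
    (hu : u (f + 1) = 0) : Gate.evalList (orGates f (h :: hs)) u =
      Gate.evalList (orGates (f + 1) hs)
        (Function.update u (f + 1) (u f + u h + u f * u h)) := by
  have h_ne : h ≠ f + 1 := by lia
  simp [orGates, Gate.eval, Gate.target, Gate.value, hu, h_ne]

theorem evalList_orGates_eq_zero_iff {f : ℕ} {hs : List ℕ} (hf : ∀ h ∈ hs, h < f)
    {u : ℕ → ZMod 2} (hu : ∀ q, f < q → u q = 0) :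
    Gate.evalList (orGates f hs) u (f + hs.length) = 0 ↔ u f = 0 ∧ ∀ h ∈ hs, u h = 0 := by
  induction hs generalizing f u with
  | nil => simp [orGates]
  | cons h hs ih =>
    rw [List.forall_mem_cons] at hf
    have h_or : ∀ x y : ZMod 2, x + y + x * y = 0 ↔ x = 0 ∧ y = 0 := by decide
    have hu' : ∀ q, f + 1 < q → Function.update u (f + 1) (u f + u h + u f * u h) q = 0 := by
      intro q hq
      rw [Function.update_of_ne hq.ne', hu q (by lia)]
    rw [evalList_orGates_cons hs hf.1 (hu _ f.lt_succ_self), List.length_cons,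
      show f + (hs.length + 1) = f + 1 + hs.length by lia,
      ih (fun h' hh' => (hf.2 h' hh').trans f.lt_succ_self) hu', Function.update_self,
      h_or, List.forall_mem_cons, and_assoc]
    refine and_congr_right fun _ => and_congr_right fun _ => forall₂_congr fun h' hh' => ?_
    rw [Function.update_of_ne ((hf.2 h' hh').trans f.lt_succ_self).ne]

theorem evalList_orGates_of_eq_zero {f : ℕ} {hs : List ℕ} (hf : ∀ h ∈ hs, h < f)
    {u : ℕ → ZMod 2} (hu : ∀ q, f ≤ q → u q = 0) (hs_zero : ∀ h ∈ hs, u h = 0) :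
    Gate.evalList (orGates f hs) u = u := by
  induction hs generalizing f with
  | nil => rfl
  | cons h hs ih =>
    rw [List.forall_mem_cons] at hf hs_zero
    have h_succ := hu _ f.le_succ
    rw [evalList_orGates_cons hs hf.1 h_succ, hu f le_rfl, hs_zero.1, mul_zero, add_zero, add_zero,
      ← h_succ, Function.update_eq_self]
    exact ih (fun h' hh' => (hf.2 h' hh').trans f.lt_succ_self)
      (fun q hq => hu q (f.le_succ.trans hq)) hs_zero.2

/-! ### Comparison of Hadamard measurements -/

section Compare

variable {w : ℕ}

/-- All the outcomes of the measurements of the qubits `qs` by both parties: each qubit is listed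
with the results of Alice and Bob. -/
def outcomes : List (Fin w) → List (List (Fin w × Bool × Bool))
  | [] => [[]]
  | q :: qs => [(false, false), (false, true), (true, false), (true, true)].flatMap
      fun ab => (outcomes qs).map ((q, ab) :: ·)

theorem map_fst_of_mem_outcomes {qs : List (Fin w)} {z : List (Fin w × Bool × Bool)}
    (hz : z ∈ outcomes qs) : z.map Prod.fst = qs := by
  induction qs generalizing z with
  | nil =>
    rw [outcomes, List.mem_singleton] at hz
    rw [hz, List.map_nil]
  | cons q qs ih =>
    simp only [outcomes, List.mem_flatMap, List.mem_map] at hz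
    obtain ⟨ab, -, z, hz, rfl⟩ := hz
    rw [List.map_cons, ih hz]

/-- The results of the two parties agree. -/
def agree (z : List (Fin w × Bool × Bool)) : Bool := z.all fun x => x.2.1 == x.2.2

theorem agree_cons (x : Fin w × Bool × Bool) (z : List (Fin w × Bool × Bool)) :
    agree (x :: z) = (x.2.1 == x.2.2 && agree z) := List.all_cons

theorem length_filter_agree (qs : List (Fin w)) :
    ((outcomes qs).filter agree).length = 2 ^ qs.length := by
  induction qs with
  | nil => rfl
  | cons q qs ih =>
    have h_cons (ab : Bool × Bool) : (((outcomes qs).map ((q, ab) :: ·)).filter agree).length =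
        if ab.1 = ab.2 then 2 ^ qs.length else 0 := by
      simp only [List.filter_map, List.length_map, Function.comp_def, agree_cons, ← ih]
      split_ifs with h <;> simp [h]
    rw [outcomes, List.filter_flatMap, List.length_flatMap]
    simp only [h_cons, List.map_cons, List.map_nil, List.sum_cons, List.sum_nil, if_true, add_zero,
      Bool.false_eq_true, Bool.true_eq_false, if_false, zero_add, List.length_cons, pow_succ,
      mul_two]

/-- Both parties measure qubit `q` in the Hadamard basis, and each adds its result to qubit `q` of
the other party. Alice, who is first, is left with the sum of the two results. -/
def compareSteps (qs : List (Fin w)) : List (Step w) := qs.flatMap fun q =>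
  [.hadamard .alice q, .send .alice q q, .hadamard .bob q, .send .bob q q]

theorem length_compareSteps (qs : List (Fin w)) :
    (compareSteps qs).length = 4 * qs.length := by
  simp [compareSteps, List.length_flatMap, mul_comm]

/-- The operator of the comparison of one qubit, for given results. -/
def compareQubitOp (x : Fin w × Bool × Bool) : MonomialOp (Basis w) (Basis w) :=
  (measureOp .bob x.1 x.1 x.2.2).comp (measureOp .alice x.1 x.1 x.2.1)

/-- The operator of the comparison of the qubits in an outcome. -/
def compareOp : List (Fin w × Bool × Bool) → MonomialOp (Basis w) (Basis w)
  | [] => .ofMap id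
  | x :: z => (compareOp z).comp (compareQubitOp x)

theorem hasMonomialKraus_compareSteps (qs : List (Fin w)) :
    HasMonomialKraus (compareSteps qs) ((outcomes qs).map compareOp) := by
  induction qs with
  | nil => exact hasMonomialKraus_nil
  | cons q qs ih =>
    have h := ((hasMonomialKraus_measure .alice q q).append
      (hasMonomialKraus_measure .bob q q)).append ih
    simpa [compareSteps, outcomes, compareOp, compareQubitOp, Function.comp_def] using h

/-- Booleans as elements of `ZMod 2`. -/
def toZ (b : Bool) : ZMod 2 := if b then 1 else 0

theorem toB_toZ (b : Bool) : toB (toZ b) = b := by revert b; decide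

/-- The value of a compared qubit of party `p`, for the results `ab`. -/
def comparedBit (ab : Bool × Bool) : Party → ZMod 2
  | .alice => toZ ab.1 + toZ ab.2
  | .bob => toZ ab.2

/-- The wires after the comparison, with the wires `u` before it. -/
def comparedWires :
    List (Fin w × Bool × Bool) → (Party → ℕ → ZMod 2) → Party → ℕ → ZMod 2
  | [], u => u
  | x :: z, u => comparedWires z fun p => Function.update (u p) x.1 (comparedBit x.2 p)

theorem compareQubitOp_map (x : Fin w × Bool × Bool) (u : Party → ℕ → ZMod 2) :
    (compareQubitOp x).map (wireState u) =
      wireState fun p => Function.update (u p) x.1 (comparedBit x.2 p) := by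
  funext ⟨p, r⟩
  rcases eq_or_ne r x.1 with rfl | h
  · cases p <;> simp [compareQubitOp, MonomialOp.comp, measureOp, Party.other, wireState,
      comparedBit, toB_add, toB_toZ]
  · have h_val : (r : ℕ) ≠ x.1 := Fin.val_ne_of_ne h
    simp [compareQubitOp, MonomialOp.comp, measureOp, wireState, h, h_val]

theorem compareQubitOp_coeff (q : Fin w) (b : Bool) {u : Party → ℕ → ZMod 2}
    (hu : u .alice q = u .bob q) :
    (compareQubitOp (q, b, b)).coeff (wireState u) = sgn b / 2 := by
  have h_half := invSqrtTwo_mul_self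
  simp only [compareQubitOp, MonomialOp.comp, measureOp, Party.other, wireState, hu]
  cases b <;> cases toB (u .bob q) <;>
    simp only [Function.update_self, sgn, Bool.and_self, Bool.and_true, Bool.and_false,
      Bool.bne_false, Bool.xor_true,
      Bool.not_false, bne_self_eq_false, if_true, if_false, Bool.false_eq_true] <;>
    first | linear_combination h_half | linear_combination -h_half

theorem compareOp_map (z : List (Fin w × Bool × Bool)) (u : Party → ℕ → ZMod 2) :
    (compareOp z).map (wireState u) = wireState (comparedWires z u) := by
  induction z generalizing u with
  | nil => rfl
  | cons x z ih => exact (congrArg _ (compareQubitOp_map x u)).trans (ih _)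

theorem comparedWires_of_notMem {z : List (Fin w × Bool × Bool)} (u : Party → ℕ → ZMod 2)
    (p : Party) {r : ℕ} (hr : ∀ q ∈ z.map Prod.fst, r ≠ q) : comparedWires z u p r = u p r := by
  induction z generalizing u with
  | nil => rfl
  | cons x z ih =>
    rw [List.map_cons, List.forall_mem_cons] at hr
    rw [comparedWires, ih _ hr.2, Function.update_of_ne hr.1]

theorem comparedWires_eq_of_mem {z : List (Fin w × Bool × Bool)} (u u' : Party → ℕ → ZMod 2)
    (p : Party) {q : Fin w} (hq : q ∈ z.map Prod.fst) :
    comparedWires z u p q = comparedWires z u' p q := by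
  induction z generalizing u u' with
  | nil => exact absurd hq List.not_mem_nil
  | cons x z ih =>
    by_cases h : q ∈ z.map Prod.fst
    · exact ih _ _ h
    · have h_ne : ∀ r ∈ z.map Prod.fst, (q : ℕ) ≠ r := fun r hr h' => h (Fin.ext h' ▸ hr)
      obtain rfl : q = x.1 := (List.mem_cons.1 hq).resolve_right h
      simp only [comparedWires, comparedWires_of_notMem _ _ h_ne, Function.update_self]

theorem comparedWires_alice_eq_zero_iff {z : List (Fin w × Bool × Bool)}
    (hz : (z.map Prod.fst).Nodup) (u : Party → ℕ → ZMod 2) :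
    (∀ q ∈ z.map Prod.fst, comparedWires z u .alice q = 0) ↔ agree z = true := by
  induction z generalizing u with
  | nil => simp [agree]
  | cons x z ih =>
    rw [List.map_cons, List.nodup_cons] at hz
    have h_ne : ∀ r ∈ z.map Prod.fst, (x.1 : ℕ) ≠ r := fun r hr h' => hz.1 (Fin.ext h' ▸ hr)
    have h_bit : ∀ a b : Bool, toZ a + toZ b = 0 ↔ a = b := by decide
    rw [List.map_cons, List.forall_mem_cons, agree_cons, Bool.and_eq_true, beq_iff_eq]
    simp only [comparedWires]
    rw [comparedWires_of_notMem _ _ h_ne, Function.update_self, comparedBit, h_bit, ih hz.2]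

/-- The product of the signs that are caused by the results of Alice. -/
def outcomeSign (z : List (Fin w × Bool × Bool)) : ℂ := (z.map fun x => sgn x.2.1).prod

theorem outcomeSign_mul_star (z : List (Fin w × Bool × Bool)) :
    outcomeSign z * star (outcomeSign z) = 1 := by
  induction z with
  | nil => simp [outcomeSign]
  | cons x z ih =>
    rw [outcomeSign] at ih ⊢
    rw [List.map_cons, List.prod_cons, star_mul', mul_mul_mul_comm, ih, star_sgn, sgn_mul_self,
      one_mul]

theorem compareOp_coeff {z : List (Fin w × Bool × Bool)} (hz : agree z = true)
    (h_nodup : (z.map Prod.fst).Nodup) {u : Party → ℕ → ZMod 2}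
    (hu : ∀ q ∈ z.map Prod.fst, u .alice q = u .bob q) :
    (compareOp z).coeff (wireState u) = outcomeSign z / 2 ^ z.length := by
  induction z generalizing u with
  | nil => simp [compareOp, MonomialOp.ofMap, outcomeSign]
  | cons x z ih =>
    obtain ⟨q, a, b⟩ := x
    rw [agree_cons, Bool.and_eq_true, beq_iff_eq] at hz
    obtain ⟨h_eq, hz⟩ := hz
    obtain rfl : a = b := h_eq
    rw [List.map_cons, List.nodup_cons] at h_nodup
    rw [List.map_cons, List.forall_mem_cons] at hu
    have hu' : ∀ r ∈ z.map Prod.fst, Function.update (u .alice) q (comparedBit (a, a) .alice) r =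
        Function.update (u .bob) q (comparedBit (a, a) .bob) r := fun r hr => by
      have h_ne : (r : ℕ) ≠ q := fun h => h_nodup.1 (Fin.ext h ▸ hr)
      rw [Function.update_of_ne h_ne, Function.update_of_ne h_ne, hu.2 r hr]
    have h_coeff : (compareOp ((q, a, a) :: z)).coeff (wireState u) =
        (compareQubitOp (q, a, a)).coeff (wireState u) *
          (compareOp z).coeff ((compareQubitOp (q, a, a)).map (wireState u)) := rfl
    rw [h_coeff, compareQubitOp_map, compareQubitOp_coeff q a hu.1, ih hz h_nodup.2 hu',
      outcomeSign, outcomeSign, List.map_cons, List.prod_cons, List.length_cons]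
    ring

end Compare

/-! ### Hashing by linear maps -/

theorem bitZ_eq_bitZ_iff {m n j : ℕ} : bitZ m j = bitZ n j ↔ m.testBit j = n.testBit j := by
  rw [← toB_bitZ, ← toB_bitZ, toB_injective.eq_iff]

theorem bitZ_eq_zero_of_lt {n j : ℕ} (h : n < 2 ^ j) : bitZ n j = 0 := by
  simp [bitZ, Nat.testBit_lt_two_pow h]

theorem eq_of_forall_bitZ_eq {m n a : ℕ} (hm : m < 2 ^ a) (hn : n < 2 ^ a)
    (h : ∀ j < a, bitZ m j = bitZ n j) : m = n := by
  refine Nat.eq_of_testBit_eq fun j => bitZ_eq_bitZ_iff.1 ?_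
  rcases lt_or_ge j a with hj | hj
  · exact h j hj
  · have h_le : 2 ^ a ≤ 2 ^ j := Nat.pow_le_pow_right two_pos hj
    rw [bitZ_eq_zero_of_lt (hm.trans_le h_le), bitZ_eq_zero_of_lt (hn.trans_le h_le)]

/-- The bit vector of a number below `2 ^ a`. -/
def bitVec {a : ℕ} (i : Fin (2 ^ a)) : Fin a → ZMod 2 := fun k => bitZ i k

theorem bitVec_injective {a : ℕ} : Function.Injective (bitVec (a := a)) := fun i j h =>
  Fin.ext (eq_of_forall_bitZ_eq i.2 j.2 fun k hk => congrFun h ⟨k, hk⟩)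

section HashPair

variable {s t K : ℕ}

/-- The number whose binary digits are the first `s` entries of a vector. -/
def lowBits (v : Fin (s + t) → ZMod 2) : ℕ :=
  Nat.ofBits fun l : Fin s => toB (v (Fin.castAdd t l))

theorem lowBits_lt (v : Fin (s + t) → ZMod 2) : lowBits v < 2 ^ s := Nat.ofBits_lt_two_pow _

theorem testBit_lowBits (v : Fin (s + t) → ZMod 2) (l : Fin s) :
    (lowBits v).testBit l = toB (v (Fin.castAdd t l)) := Nat.testBit_ofBits_lt _ _ l.2

theorem lowBits_eq_lowBits_iff {v v' : Fin (s + t) → ZMod 2} :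
    lowBits v = lowBits v' ↔ ∀ l : Fin s, v (Fin.castAdd t l) = v' (Fin.castAdd t l) := by
  refine ⟨fun h l => toB_injective ?_, fun h => by simp only [lowBits, h]⟩
  rw [← testBit_lowBits, h, testBit_lowBits]

theorem two_pow_mul_add_inj {y y' r r' : ℕ} (hr : r < 2 ^ s) (hr' : r' < 2 ^ s) :
    2 ^ s * y + r = 2 ^ s * y' + r' ↔ y = y' ∧ r = r' := by
  refine ⟨fun h => ?_, fun ⟨hy, hr⟩ => by rw [hy, hr]⟩
  have h_div := congrArg (· / 2 ^ s) h
  have h_mod := congrArg (· % 2 ^ s) h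
  simp only [Nat.mul_add_div (Nat.two_pow_pos s), Nat.div_eq_of_lt hr, Nat.div_eq_of_lt hr',
    add_zero] at h_div
  simp only [Nat.mul_add_mod, Nat.mod_eq_of_lt hr, Nat.mod_eq_of_lt hr'] at h_mod
  exact ⟨h_div, h_mod⟩

variable (A : Fin K → Matrix (Fin (s + t)) (Fin (s + t)) (ZMod 2))

/-- The number `y` together with the first `s` bits of the image of `x` under `A y`. -/
def hashPair (q : Fin K × Fin (2 ^ (s + t))) : Fin (2 ^ s * K) :=
  ⟨2 ^ s * q.1 + lowBits (A q.1 *ᵥ bitVec q.2), by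
    have h_lt := lowBits_lt (A q.1 *ᵥ bitVec q.2)
    have h_mul : 2 ^ s * ((q.1 : ℕ) + 1) ≤ 2 ^ s * K := Nat.mul_le_mul_left _ q.1.2
    rw [mul_add, mul_one] at h_mul
    lia⟩

variable {A}

theorem hashPair_eq_hashPair_iff {q q' : Fin K × Fin (2 ^ (s + t))} :
    hashPair A q = hashPair A q' ↔
      q.1 = q'.1 ∧ lowBits (A q.1 *ᵥ bitVec q.2) = lowBits (A q'.1 *ᵥ bitVec q'.2) := by
  rw [hashPair, hashPair, Fin.mk.injEq, two_pow_mul_add_inj (lowBits_lt _) (lowBits_lt _),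
    Fin.ext_iff]

theorem testBit_hashPair (q : Fin K × Fin (2 ^ (s + t))) (l : ℕ) :
    (hashPair A q : ℕ).testBit l =
      if h : l < s then toB ((A q.1 *ᵥ bitVec q.2) ⟨l, by lia⟩)
      else toB (bitZ q.1 (l - s)) := by
  rw [hashPair, Nat.testBit_two_pow_mul_add _ (lowBits_lt _), toB_bitZ]
  split_ifs with h
  · exact testBit_lowBits _ ⟨l, h⟩
  · rfl

theorem isHashFamily_hashPair {lam : ℕ} (ha : 0 < s + t) (hK : 0 < K)
    (h_lam : lam * (2 ^ (s + t) - 1) = K * (2 ^ t - 1))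
    (h_card : ∀ x : Fin (s + t) → ZMod 2, x ≠ 0 →
      (Finset.univ.filter fun y => ∀ l : Fin s, (A y *ᵥ x) (Fin.castAdd t l) = 0).card = lam) :
    IsHashFamily (hashPair A) lam (2 ^ t) where
  fst_eq _ _ h := (hashPair_eq_hashPair_iff.1 h).1
  card_collisions i j hij := by
    rw [← h_card (bitVec i - bitVec j) (sub_ne_zero.2 (bitVec_injective.ne hij))]
    simp only [hashPair_eq_hashPair_iff, lowBits_eq_lowBits_iff, Matrix.mulVec_sub, Pi.sub_apply,
      sub_eq_zero, true_and]
  K_pos := hK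
  L_pos := Nat.two_pow_pos t
  two_le := Nat.le_self_pow ha.ne' 2
  M_mul := by rw [pow_add]; ring
  lam_mul := h_lam

end HashPair

/-! ### The hashing circuit -/

/-- The component of a pair that belongs to a party: the first for Alice, the second for Bob. -/
def Party.component {α : Type*} (x : α × α) : Party → α
  | .alice => x.1
  | .bob => x.2

theorem Party.component_diag {α : Type*} (i : α) (p : Party) : p.component (i, i) = i := by
  cases p <;> rfl

/-- The wires of a party that holds `|i⟩` in the first `a` qubits and then `|y⟩`. -/
def loadWires {a K : ℕ} (i : Fin (2 ^ a)) (y : Fin K) (q : ℕ) : ZMod 2 :=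
  if q < a then bitZ i q else bitZ y (q - a)

theorem loadBasis_eq_wireState (a : ℕ) {K w : ℕ}
    (x : (Fin (2 ^ a) × Fin (2 ^ a)) × (Fin K × Fin K)) : loadBasis (2 ^ a) K w x =
      wireState fun p => loadWires (p.component x.1) (p.component x.2) := by
  funext ⟨p, q⟩
  cases p <;>
    simp only [loadBasis, load, wireState, loadWires, Party.component, Nat.clog_pow 2 a one_lt_two,
      apply_ite toB, toB_bitZ]

theorem loaded_loadWires {a K : ℕ} (hK : K ≤ 2 ^ a) (i : Fin (2 ^ a)) (y : Fin K) :
    Loaded a (2 * a) y (loadWires i y) := by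
  refine ⟨fun j _ => by simp [loadWires], fun r hr => ?_⟩
  rw [loadWires, if_neg (by lia)]
  exact bitZ_eq_zero_of_lt (y.2.trans_le (hK.trans (Nat.pow_le_pow_right two_pos (by lia))))

theorem loadBasis_injective {a K w : ℕ} (hK : K ≤ 2 ^ a) (hw : 2 * a ≤ w) :
    Function.Injective (loadBasis (2 ^ a) K w) := by
  intro x x' h
  rw [loadBasis_eq_wireState, loadBasis_eq_wireState] at h
  have h_wires (p : Party) (q : ℕ) (hq : q < w) :
      loadWires (p.component x.1) (p.component x.2) q =
        loadWires (p.component x'.1) (p.component x'.2) q :=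
    toB_injective (congrFun h (p, ⟨q, hq⟩))
  have h_fst (p : Party) : p.component x.1 = p.component x'.1 := by
    refine bitVec_injective (funext fun k => ?_)
    simpa [loadWires, bitVec] using h_wires p k (by lia)
  have h_snd (p : Party) : p.component x.2 = p.component x'.2 := by
    have h_lt (y : Fin K) : (y : ℕ) < 2 ^ a := y.2.trans_le hK
    refine Fin.ext (eq_of_forall_bitZ_eq (h_lt _) (h_lt _) fun j hj => ?_)
    simpa [loadWires] using h_wires p (a + j) (by lia)
  exact Prod.ext (Prod.ext (h_fst .alice) (h_fst .bob)) (Prod.ext (h_snd .alice) (h_snd .bob))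

section

variable {a K w : ℕ} {A : Fin K → Matrix (Fin a) (Fin a) (ZMod 2)} {gs : List Gate}

theorem MovesMulVec.evalList_eq_zero_of_lt (h : MovesMulVec A w gs) (hK : K ≤ 2 ^ a)
    (i : Fin (2 ^ a)) (y : Fin K) {q : ℕ} (hq : q < a) :
    Gate.evalList gs (loadWires i y) q = 0 :=
  h.eval_source y _ (loaded_loadWires hK i y) q hq

theorem MovesMulVec.evalList_auxiliary (h : MovesMulVec A w gs) (hK : K ≤ 2 ^ a)
    (i : Fin (2 ^ a)) (y : Fin K) {j : ℕ} (hj : j < a) :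
    Gate.evalList gs (loadWires i y) (a + j) = bitZ y j := by
  have h_loaded := loaded_loadWires hK i y
  rw [h.eval_rest y _ h_loaded _ (by lia) (by lia), h_loaded.1 j hj]

theorem MovesMulVec.evalList_mulVec (h : MovesMulVec A w gs) (hK : K ≤ 2 ^ a)
    (i : Fin (2 ^ a)) (y : Fin K) (j : Fin a) :
    Gate.evalList gs (loadWires i y) (2 * a + j) = (A y *ᵥ bitVec i) j := by
  have h_bits : (fun k : Fin a => loadWires i y k) = bitVec i := by
    funext k
    simp [loadWires, bitVec]
  rw [h.eval_dest y _ (loaded_loadWires hK i y), h_bits]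

theorem MovesMulVec.evalList_eq_zero_of_le (h : MovesMulVec A w gs) (hK : K ≤ 2 ^ a)
    (i : Fin (2 ^ a)) (y : Fin K) {q : ℕ} (hq : 3 * a ≤ q) :
    Gate.evalList gs (loadWires i y) q = 0 := by
  have h_loaded := loaded_loadWires hK i y
  rw [h.eval_rest y _ h_loaded _ (by lia) (by lia), h_loaded.2 q (by lia)]

end

section HashParts

variable {s t K w : ℕ}

/-- The qubits that the parties compare: the last `t` bits of the image of the linear map. -/
def checkQubits (s t : ℕ) {w : ℕ} (hw : 4 * (s + t) + 1 ≤ w) : List (Fin w) :=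
  List.ofFn fun j : Fin t => ⟨2 * (s + t) + s + j, by lia⟩

theorem length_checkQubits (hw : 4 * (s + t) + 1 ≤ w) : (checkQubits s t hw).length = t :=
  List.length_ofFn

theorem mem_checkQubits (hw : 4 * (s + t) + 1 ≤ w) {q : Fin w} :
    q ∈ checkQubits s t hw ↔ 2 * (s + t) + s ≤ q ∧ q < 3 * (s + t) := by
  rw [checkQubits, List.mem_ofFn']
  refine ⟨?_, fun h => ⟨⟨q - (2 * (s + t) + s), by lia⟩, Fin.ext (by simp; lia)⟩⟩
  rintro ⟨j, rfl⟩
  simp only [le_add_iff_nonneg_right, zero_le, true_and]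
  lia

theorem nodup_checkQubits (hw : 4 * (s + t) + 1 ≤ w) : (checkQubits s t hw).Nodup :=
  List.nodup_ofFn.2 fun i j h => by simpa [Fin.ext_iff] using h

/-- The qubits on which the output is written: the first `s` bits of the image of the linear map,
and then the auxiliary register. -/
def outQubits (s t : ℕ) {k w : ℕ} (hk : k ≤ s + (s + t)) (hw : 4 * (s + t) + 1 ≤ w) :
    Fin k ↪ Fin w where
  toFun l := ⟨if (l : ℕ) < s then 2 * (s + t) + l else s + t + (l - s), by split_ifs <;> lia⟩
  inj' l l' h := by
    rw [Fin.mk.injEq] at h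
    refine Fin.ext ?_
    split_ifs at h <;> lia

theorem coe_outQubits {k : ℕ} (hk : k ≤ s + (s + t)) (hw : 4 * (s + t) + 1 ≤ w) (l : Fin k) :
    (outQubits s t hk hw l : ℕ) = if (l : ℕ) < s then 2 * (s + t) + l else s + t + (l - s) := rfl

/-- The parts of the circuit for hashing with the matrices `A y`: both parties apply the linear
maps, the qubits `checkQubits` are compared, and Alice computes whether the results differ. -/
structure HashParts (A : Fin K → Matrix (Fin (s + t)) (Fin (s + t)) (ZMod 2)) (w : ℕ) where
  gates : List Gate
  moveSteps : Party → List (Step w)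
  moveMap : Party → Basis w → Basis w
  orSteps : List (Step w)
  orMap : Basis w → Basis w
  le_width : 4 * (s + t) + 1 ≤ w
  moves : MovesMulVec A w gates
  simulates_move : ∀ p, Simulates p gates (moveSteps p) (moveMap p)
  simulates_or : Simulates .alice
    (orGates (3 * (s + t)) ((checkQubits s t le_width).map Fin.val)) orSteps orMap

theorem MovesMulVec.exists_hashParts {A : Fin K → Matrix (Fin (s + t)) (Fin (s + t)) (ZMod 2)}
    {gs : List Gate} (h : MovesMulVec A w gs) (hw : 4 * (s + t) + 1 ≤ w) :
    ∃ T : HashParts A w, T.gates = gs := by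
  choose lp fp h_move using fun p => exists_simulates p h.nodup h.lt
  have h_or : ∀ g ∈ orGates (3 * (s + t)) ((checkQubits s t hw).map Fin.val),
      g.wires.Nodup ∧ ∀ q ∈ g.wires, q < w := by
    refine nodup_lt_of_mem_orGates ?_ (by rw [List.length_map, length_checkQubits]; lia)
    simp only [List.forall_mem_map, mem_checkQubits]
    exact fun q hq => hq.2
  obtain ⟨l, f, h_or⟩ := exists_simulates .alice (fun g hg => (h_or g hg).1)
    fun g hg => (h_or g hg).2
  exact ⟨⟨gs, lp, fp, l, f, hw, h, h_move, h_or⟩, rfl⟩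

namespace HashParts

variable {A : Fin K → Matrix (Fin (s + t)) (Fin (s + t)) (ZMod 2)} (T : HashParts A w)

/-- The compared qubits. -/
def checks : List (Fin w) := checkQubits s t T.le_width

/-- The steps of the circuit. -/
def steps : List (Step w) :=
  T.moveSteps .alice ++ T.moveSteps .bob ++ (compareSteps T.checks ++ T.orSteps)

/-- The operator of the circuit for the outcome `z` of the measurements. -/
def branch (z : List (Fin w × Bool × Bool)) : MonomialOp (Basis w) (Basis w) :=
  ((MonomialOp.ofMap T.orMap).comp (compareOp z)).comp
    ((MonomialOp.ofMap (T.moveMap .bob)).comp (.ofMap (T.moveMap .alice)))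

/-- The wires of a party that started with `|i⟩|y⟩` after the linear map. -/
def movedWires (i : Fin (2 ^ (s + t))) (y : Fin K) : ℕ → ZMod 2 :=
  Gate.evalList T.gates (loadWires i y)

/-- The wires after the comparison with outcome `z`. -/
def checkedWires (z : List (Fin w × Bool × Bool))
    (x : (Fin (2 ^ (s + t)) × Fin (2 ^ (s + t))) × (Fin K × Fin K)) : Party → ℕ → ZMod 2 :=
  comparedWires z fun p => T.movedWires (p.component x.1) (p.component x.2)

/-- The wires at the end. -/
def finalWires (z : List (Fin w × Bool × Bool))
    (x : (Fin (2 ^ (s + t)) × Fin (2 ^ (s + t))) × (Fin K × Fin K)) : Party → ℕ → ZMod 2 :=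
  Function.update (T.checkedWires z x) .alice
    (Gate.evalList (orGates (3 * (s + t)) (T.checks.map Fin.val)) (T.checkedWires z x .alice))

theorem length_checks : T.checks.length = t := length_checkQubits T.le_width

theorem hasMonomialKraus_steps :
    HasMonomialKraus T.steps ((outcomes T.checks).map T.branch) := by
  have h := ((T.simulates_move .alice).hasKraus.append (T.simulates_move .bob).hasKraus).append
    ((hasMonomialKraus_compareSteps T.checks).append T.simulates_or.hasKraus)
  change HasMonomialKraus T.steps ((outcomes T.checks).map fun z => T.branch z)
  simpa [steps, branch, List.flatMap_map, ← List.map_eq_flatMap, Function.comp_def] using h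

theorem moveMap_loadBasis (x : (Fin (2 ^ (s + t)) × Fin (2 ^ (s + t))) × (Fin K × Fin K)) :
    T.moveMap .bob (T.moveMap .alice (loadBasis (2 ^ (s + t)) K w x)) =
      wireState fun p => T.movedWires (p.component x.1) (p.component x.2) := by
  rw [loadBasis_eq_wireState, (T.simulates_move .alice).map_wireState,
    (T.simulates_move .bob).map_wireState]
  congr 1
  funext p
  cases p <;> simp [movedWires]

theorem branch_map_loadBasis (z : List (Fin w × Bool × Bool))
    (x : (Fin (2 ^ (s + t)) × Fin (2 ^ (s + t))) × (Fin K × Fin K)) :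
    (T.branch z).map (loadBasis (2 ^ (s + t)) K w x) = wireState (T.finalWires z x) := by
  simp only [branch, MonomialOp.comp, MonomialOp.ofMap, T.moveMap_loadBasis, compareOp_map,
    T.simulates_or.map_wireState]
  rfl

theorem branch_coeff_loadBasis {z : List (Fin w × Bool × Bool)} (hz : z ∈ outcomes T.checks)
    (h_agree : agree z = true) (i : Fin (2 ^ (s + t))) (y : Fin K) :
    (T.branch z).coeff (loadBasis (2 ^ (s + t)) K w ((i, i), (y, y))) = outcomeSign z / 2 ^ t := by
  have h_fst := map_fst_of_mem_outcomes hz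
  have h_length : z.length = t := by
    rw [← List.length_map (f := Prod.fst), h_fst, T.length_checks]
  have h_nodup : (z.map Prod.fst).Nodup := h_fst ▸ nodup_checkQubits T.le_width
  simp only [branch, MonomialOp.comp, MonomialOp.ofMap, T.moveMap_loadBasis, one_mul, mul_one]
  rw [compareOp_coeff h_agree h_nodup fun q _ => by simp only [Party.component_diag], h_length]

theorem checkedWires_of_notMem {z : List (Fin w × Bool × Bool)} (hz : z ∈ outcomes T.checks)
    (x : (Fin (2 ^ (s + t)) × Fin (2 ^ (s + t))) × (Fin K × Fin K)) (p : Party) {r : ℕ}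
    (hr : r < 2 * (s + t) + s ∨ 3 * (s + t) ≤ r) :
    T.checkedWires z x p r = T.movedWires (p.component x.1) (p.component x.2) r := by
  refine comparedWires_of_notMem _ _ fun q hq => ?_
  rw [map_fst_of_mem_outcomes hz, checks, mem_checkQubits] at hq
  lia

theorem movedWires_eq_zero_of_le (hK : K ≤ 2 ^ (s + t)) (i : Fin (2 ^ (s + t))) (y : Fin K)
    {q : ℕ} (hq : 3 * (s + t) ≤ q) : T.movedWires i y q = 0 :=
  T.moves.evalList_eq_zero_of_le hK i y hq

theorem checkedWires_eq_zero_of_le (hK : K ≤ 2 ^ (s + t)) {z : List (Fin w × Bool × Bool)}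
    (hz : z ∈ outcomes T.checks)
    (x : (Fin (2 ^ (s + t)) × Fin (2 ^ (s + t))) × (Fin K × Fin K)) (p : Party) {r : ℕ}
    (hr : 3 * (s + t) ≤ r) : T.checkedWires z x p r = 0 := by
  rw [T.checkedWires_of_notMem hz x p (.inr hr), T.movedWires_eq_zero_of_le hK _ _ hr]

theorem checks_lt : ∀ q ∈ T.checks.map Fin.val, q < 3 * (s + t) := by
  simp only [List.forall_mem_map, checks, mem_checkQubits]
  exact fun q hq => hq.2

theorem forall_checkedWires_eq_zero_iff {z : List (Fin w × Bool × Bool)}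
    (hz : z ∈ outcomes T.checks)
    (x : (Fin (2 ^ (s + t)) × Fin (2 ^ (s + t))) × (Fin K × Fin K)) :
    (∀ q ∈ T.checks.map Fin.val, T.checkedWires z x .alice q = 0) ↔ agree z = true := by
  have h_fst := map_fst_of_mem_outcomes hz
  rw [← comparedWires_alice_eq_zero_iff (h_fst ▸ nodup_checkQubits T.le_width), h_fst,
    List.forall_mem_map]
  rfl

theorem finalWires_of_agree (hK : K ≤ 2 ^ (s + t)) {z : List (Fin w × Bool × Bool)}
    (hz : z ∈ outcomes T.checks) (h_agree : agree z = true)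
    (x : (Fin (2 ^ (s + t)) × Fin (2 ^ (s + t))) × (Fin K × Fin K)) :
    T.finalWires z x = T.checkedWires z x := by
  rw [finalWires, evalList_orGates_of_eq_zero T.checks_lt
    (fun q hq => T.checkedWires_eq_zero_of_le hK hz x _ hq)
    ((T.forall_checkedWires_eq_zero_iff hz x).2 h_agree), Function.update_eq_self]

theorem toB_finalWires_flag (hK : K ≤ 2 ^ (s + t)) {z : List (Fin w × Bool × Bool)}
    (hz : z ∈ outcomes T.checks)
    (x : (Fin (2 ^ (s + t)) × Fin (2 ^ (s + t))) × (Fin K × Fin K)) :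
    toB (T.finalWires z x .alice (3 * (s + t) + t)) = !agree z := by
  have h_zero : ∀ q, 3 * (s + t) ≤ q → T.checkedWires z x .alice q = 0 := fun q hq =>
    T.checkedWires_eq_zero_of_le hK hz x _ hq
  have h_or := evalList_orGates_eq_zero_iff T.checks_lt fun q hq => h_zero q hq.le
  rw [T.forall_checkedWires_eq_zero_iff hz, List.length_map, T.length_checks,
    and_iff_right (h_zero _ le_rfl)] at h_or
  rw [Bool.eq_iff_iff, toB_eq_true_iff, finalWires, Function.update_self, Ne, h_or,
    Bool.not_eq_true', Bool.not_eq_true]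

theorem movedWires_outQubits (hK : K ≤ 2 ^ (s + t)) {k : ℕ} (hk : k ≤ s + (s + t))
    (i : Fin (2 ^ (s + t))) (y : Fin K) (l : Fin k) :
    toB (T.movedWires i y (outQubits s t hk T.le_width l)) =
      (hashPair A (y, i) : ℕ).testBit l := by
  rw [testBit_hashPair, movedWires, coe_outQubits]
  split_ifs with h
  · rw [← T.moves.evalList_mulVec hK]
  · rw [T.moves.evalList_auxiliary hK i y (by lia)]

theorem finalWires_outQubits (hK : K ≤ 2 ^ (s + t)) {z : List (Fin w × Bool × Bool)}
    (hz : z ∈ outcomes T.checks) (h_agree : agree z = true)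
    (x : (Fin (2 ^ (s + t)) × Fin (2 ^ (s + t))) × (Fin K × Fin K)) (p : Party) {k : ℕ}
    (hk : k ≤ s + (s + t)) (l : Fin k) :
    toB (T.finalWires z x p (outQubits s t hk T.le_width l)) =
      (hashPair A (p.component x.2, p.component x.1) : ℕ).testBit l := by
  rw [T.finalWires_of_agree hK hz h_agree, T.checkedWires_of_notMem hz,
    T.movedWires_outQubits hK]
  rw [coe_outQubits]
  split_ifs <;> lia

theorem movedWires_eq_zero_of_notMem_range (hK : K ≤ 2 ^ (s + t)) {k : ℕ}
    (hk : k ≤ s + (s + t)) (h_le : 2 ^ s * K ≤ 2 ^ k) (i : Fin (2 ^ (s + t))) (y : Fin K)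
    {r : Fin w} (hr : r ∉ Set.range (outQubits s t hk T.le_width))
    (h_check : r < 2 * (s + t) + s ∨ 3 * (s + t) ≤ (r : ℕ)) : T.movedWires i y r = 0 := by
  have h_out (l : ℕ) (hl : l < k) :
      (r : ℕ) ≠ if l < s then 2 * (s + t) + l else s + t + (l - s) :=
    fun h => hr ⟨⟨l, hl⟩, Fin.ext h.symm⟩
  rcases h_check with h_check | h_check
  swap
  · exact T.movedWires_eq_zero_of_le hK i y h_check
  rcases lt_or_ge (r : ℕ) (s + t) with h_lt | h_ge
  · exact T.moves.evalList_eq_zero_of_lt hK i y h_lt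
  obtain ⟨j, hj⟩ := Nat.exists_eq_add_of_le h_ge
  rcases lt_or_ge j (s + t) with hj_lt | hj_ge
  · have hkj : k ≤ s + j := by
      by_contra! h
      refine h_out _ h ?_
      rw [if_neg (by lia), hj, Nat.add_sub_cancel_left]
    have h_pow : K ≤ 2 ^ j := by
      have h := h_le.trans (Nat.pow_le_pow_right two_pos hkj)
      rw [pow_add] at h
      exact Nat.le_of_mul_le_mul_left h (Nat.two_pow_pos s)
    rw [hj, movedWires, T.moves.evalList_auxiliary hK i y hj_lt,
      bitZ_eq_zero_of_lt (y.2.trans_le h_pow)]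
  · have hsk : s ≤ k := (Nat.pow_le_pow_iff_right one_lt_two).1
      ((Nat.le_mul_of_pos_right _ y.pos).trans h_le)
    refine absurd ?_ (h_out (r - 2 * (s + t)) (by lia))
    rw [if_pos (by lia)]
    lia

theorem finalWires_eq_of_notMem_range (hK : K ≤ 2 ^ (s + t)) {z : List (Fin w × Bool × Bool)}
    (hz : z ∈ outcomes T.checks) (h_agree : agree z = true)
    (x x' : (Fin (2 ^ (s + t)) × Fin (2 ^ (s + t))) × (Fin K × Fin K)) (p : Party) {k : ℕ}
    (hk : k ≤ s + (s + t)) (h_le : 2 ^ s * K ≤ 2 ^ k) {r : Fin w}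
    (hr : r ∉ Set.range (outQubits s t hk T.le_width)) :
    T.finalWires z x p r = T.finalWires z x' p r := by
  rw [T.finalWires_of_agree hK hz h_agree, T.finalWires_of_agree hK hz h_agree]
  by_cases h_mem : r ∈ T.checks
  · exact comparedWires_eq_of_mem _ _ p (map_fst_of_mem_outcomes hz ▸ h_mem)
  · rw [checks, mem_checkQubits, not_and_or, not_le, not_lt] at h_mem
    rw [T.checkedWires_of_notMem hz x p h_mem, T.checkedWires_of_notMem hz x' p h_mem,
      T.movedWires_eq_zero_of_notMem_range hK hk h_le _ _ hr h_mem,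
      T.movedWires_eq_zero_of_notMem_range hK hk h_le _ _ hr h_mem]

theorem clog_two_pow_mul_le (hK : K ≤ 2 ^ (s + t)) : Nat.clog 2 (2 ^ s * K) ≤ s + (s + t) :=
  Nat.clog_le_of_le_pow (by rw [pow_add 2 s]; exact Nat.mul_le_mul_left _ hK)

/-- The circuit with the given parts. -/
def circuit (hK : K ≤ 2 ^ (s + t)) : Circuit (2 ^ (s + t)) K (2 ^ s * K) where
  width := w
  width_le := by
    have h_le := T.le_width
    have h_clog := Nat.clog_le_of_le_pow hK
    rw [Nat.clog_pow 2 _ one_lt_two]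
    lia
  steps := T.steps
  flag := ⟨3 * (s + t) + t, by have := T.le_width; lia⟩
  out _ := outQubits s t (clog_two_pow_mul_le hK) T.le_width

theorem hashes_circuit (hK : K ≤ 2 ^ (s + t)) :
    (T.circuit hK).Hashes (outcomes T.checks) T.branch agree (hashPair A) (2 ^ t) where
  hasKraus := T.hasMonomialKraus_steps
  load_injective := loadBasis_injective hK (by have := T.le_width; change _ ≤ w; lia)
  flag_eq z hz _ _ :=
    (congrFun (T.branch_map_loadBasis z _) _).trans (T.toB_finalWires_flag hK hz _)
  reads z hz x hx := by
    have h_map := T.branch_map_loadBasis z x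
    have h_flag := (congrFun h_map _).symm.trans hx
    have h_agree : agree z = true := by
      simpa using (T.toB_finalWires_flag hK hz x).symm.trans h_flag
    have h_out (p : Party) (l) := (congrFun h_map (p, (T.circuit hK).out p l)).trans
      (T.finalWires_outQubits hK hz h_agree x p (clog_two_pow_mul_le hK) l)
    exact fun l => ⟨h_out .alice l, h_out .bob l⟩
  coeff_eq z hz h_agree := ⟨outcomeSign z, outcomeSign_mul_star z, fun i y => by
    rw [Nat.cast_pow]
    exact T.branch_coeff_loadBasis hz h_agree i y⟩
  rest_eq z hz h_agree i y i' y' p r hr := by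
    have h_map (x) := congrFun (T.branch_map_loadBasis z x) (p, r)
    refine (h_map _).trans (Eq.trans ?_ (h_map _).symm)
    exact congrArg toB (T.finalWires_eq_of_notMem_range hK hz h_agree _ _ p
      (clog_two_pow_mul_le hK) (Nat.le_pow_clog one_lt_two _) hr)
  count := by rw [length_filter_agree, T.length_checks]

theorem length_steps : T.steps.length = 2 * T.gates.length + 7 * t := by
  simp only [steps, List.length_append, (T.simulates_move _).length_eq, length_compareSteps,
    T.simulates_or.length_eq, length_orGates, List.length_map, T.length_checks,
    length_checkQubits]
  ring

end HashParts

end HashParts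

theorem IsProgram.exists_gepp {a s t K : ℕ} (hst : s + t = a) (ha : 0 < a) (hK : 0 < K)
    (hKa : K ≤ 2 ^ a) {A A' : Fin K → Matrix (Fin a) (Fin a) (ZMod 2)}
    (hA : ∀ y, A' y * A y = 1) {l : List (Fin K → ZMod 2)} (hl : IsProgram a l)
    (hlA : ∀ i j, (fun y => A y i j) ∈ l) (hlA' : ∀ i j, (fun y => A' y i j) ∈ l) {lam : ℕ}
    (h_lam : lam * (2 ^ a - 1) = K * (2 ^ t - 1))
    (h_card : ∀ x : Fin a → ZMod 2, x ≠ 0 →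
      (Finset.univ.filter fun y => ∀ i : Fin a, (i : ℕ) < s → (A y *ᵥ x) i = 0).card = lam) :
    ∃ P : GEPP (2 ^ a) K (2 ^ s * K), P.size ≤ 10 * l.length + 4 * a ^ 2 + 15 * a + 2 ∧
      ∀ ε : ℝ, ε < 1 / 2 → P.DetSuccessful ε (2 * ε / 2 ^ t) ε ∧
        (ε ≤ 2 ^ t / 2 ^ a → P.DetSuccessful ε (ε / 2 ^ t) ε) := by
  subst hst
  obtain ⟨gs, h_length, h_moves⟩ :=
    hl.exists_movesMulVec (B := 4 * (s + t) + 1) (by lia) hA hlA hlA'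
  obtain ⟨T, rfl⟩ := h_moves.exists_hashParts (by lia)
  have h_family : IsHashFamily (hashPair A) lam (2 ^ t) := by
    refine isHashFamily_hashPair ha hK h_lam fun x hx => ?_
    rw [← h_card x hx]
    congr! 2 with y
    exact ⟨fun h i hi => h ⟨i, hi⟩, fun h i => h _ i.2⟩
  have h := T.hashes_circuit hKa
  let P : GEPP (2 ^ (s + t)) K (2 ^ s * K) :=
    { toCircuit := T.circuit hKa
      output_mem := fun ρ _ τ => h.trace_output }
  have h_size : P.size = T.steps.length + 2 * (4 * (s + t) + 1 + l.length) := rfl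
  have h_cast : ((2 ^ t : ℕ) : ℝ) = 2 ^ t := by push_cast; rfl
  refine ⟨P, by rw [h_size, T.length_steps]; lia, fun ε hε => ⟨?_, fun hε' => ?_⟩⟩
  · exact Circuit.Hashes.detSuccessful (P := P) h h_family hε (.inl (by rw [h_cast]))
  · exact Circuit.Hashes.detSuccessful (P := P) h h_family hε
      (.inr ⟨by push_cast; exact hε', by rw [h_cast]⟩)

/-! ### Costs of straight-line programs -/

/-- The functions in `F` can be computed from those in `G` with `c` steps: every program that
computes the functions in `G` extends, by at most `c` steps, to one that computes also those in
`F`. -/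
def ComputableWithin (a : ℕ) {K : ℕ} (c : ℕ) (G F : Set (Fin K → ZMod 2)) : Prop :=
  ∀ l, IsProgram a l → (∀ g ∈ G, g ∈ l) →
    ∃ l', IsProgram a l' ∧ (∀ g ∈ l, g ∈ l') ∧ (∀ f ∈ F, f ∈ l') ∧ l'.length ≤ l.length + c

namespace ComputableWithin

variable {a K c c' c₁ c₂ : ℕ} {G F F' F₁ F₂ : Set (Fin K → ZMod 2)} {f g : Fin K → ZMod 2}

theorem mono (h : ComputableWithin a c G F) (hc : c ≤ c') (hF : F' ⊆ F) :
    ComputableWithin a c' G F' := by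
  intro l hl hG
  obtain ⟨l', hl', h_sub, h_mem, h_length⟩ := h l hl hG
  exact ⟨l', hl', h_sub, fun f hf => h_mem f (hF hf), by lia⟩

theorem mono_cost (h : ComputableWithin a c G F) (hc : c ≤ c') : ComputableWithin a c' G F :=
  h.mono hc subset_rfl

theorem of_subset (h : F ⊆ G) : ComputableWithin a 0 G F :=
  fun l hl hG => ⟨l, hl, fun _ hg => hg, fun f hf => hG f (h hf), le_rfl⟩

theorem of_mem (h : f ∈ G) : ComputableWithin a 0 G {f} :=
  of_subset (Set.singleton_subset_iff.2 h)

theorem trans (h₁ : ComputableWithin a c₁ G F₁) (h₂ : ComputableWithin a c₂ (G ∪ F₁) F₂) :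
    ComputableWithin a (c₁ + c₂) G F₂ := by
  intro l hl hG
  obtain ⟨l₁, hl₁, h_sub₁, h_mem₁, h_length₁⟩ := h₁ l hl hG
  obtain ⟨l₂, hl₂, h_sub₂, h_mem₂, h_length₂⟩ := h₂ l₁ hl₁ fun g hg =>
    hg.elim (fun hg => h_sub₁ g (hG g hg)) (h_mem₁ g)
  exact ⟨l₂, hl₂, fun g hg => h_sub₂ g (h_sub₁ g hg), h_mem₂, by lia⟩

theorem union (h₁ : ComputableWithin a c₁ G F₁) (h₂ : ComputableWithin a c₂ G F₂) :
    ComputableWithin a (c₁ + c₂) G (F₁ ∪ F₂) := by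
  intro l hl hG
  obtain ⟨l₁, hl₁, h_sub₁, h_mem₁, h_length₁⟩ := h₁ l hl hG
  obtain ⟨l₂, hl₂, h_sub₂, h_mem₂, h_length₂⟩ := h₂ l₁ hl₁ fun g hg => h_sub₁ g (hG g hg)
  exact ⟨l₂, hl₂, fun g hg => h_sub₂ g (h_sub₁ g hg), fun f hf =>
    hf.elim (fun hf => h_sub₂ f (h_mem₁ f hf)) (h_mem₂ f), by lia⟩

theorem biUnion {ι : Type*} (s : Finset ι) {F : ι → Set (Fin K → ZMod 2)}
    (h : ∀ i, ComputableWithin a c G (F i)) :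
    ComputableWithin a (s.card * c) G (⋃ i ∈ s, F i) := by
  classical
  induction s using Finset.induction_on with
  | empty => exact (of_subset (by simp)).mono_cost (Nat.zero_le _)
  | insert i s hi ih =>
    rw [Finset.set_biUnion_insert, Finset.card_insert_of_notMem hi]
    exact ((h i).union ih).mono_cost (by linarith)

theorem iUnion {ι : Type*} [Fintype ι] {F : ι → Set (Fin K → ZMod 2)}
    (h : ∀ i, ComputableWithin a c G (F i)) :
    ComputableWithin a (Fintype.card ι * c) G (⋃ i, F i) := by
  simpa using biUnion Finset.univ h

theorem range {ι : Type*} [Fintype ι] {f : ι → Fin K → ZMod 2}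
    (h : ∀ i, ComputableWithin a c G {f i}) :
    ComputableWithin a (Fintype.card ι * c) G (Set.range f) := by
  simpa only [Set.iUnion_singleton_eq_range] using iUnion h

theorem one : ComputableWithin a 1 G {(1 : Fin K → ZMod 2)} := fun l hl _ =>
  ⟨1 :: l, hl.one, fun _ => List.mem_cons_of_mem _, by simp, by simp⟩

theorem bit {i : ℕ} (hi : i < a) : ComputableWithin a 1 G {fun y : Fin K => bitZ y i} :=
  fun l hl _ => ⟨_ :: l, hl.bit i hi, fun _ => List.mem_cons_of_mem _, by simp, by simp⟩

theorem add (hf : ComputableWithin a c₁ G {f}) (hg : ComputableWithin a c₂ G {g}) :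
    ComputableWithin a (c₁ + c₂ + 1) G {f + g} := by
  refine (hf.union hg).trans fun l hl h => ⟨(f + g) :: l, hl.add f g (h f ?_) (h g ?_),
    fun _ => List.mem_cons_of_mem _, by simp, by simp⟩ <;> simp

theorem mul (hf : ComputableWithin a c₁ G {f}) (hg : ComputableWithin a c₂ G {g}) :
    ComputableWithin a (c₁ + c₂ + 1) G {f * g} := by
  refine (hf.union hg).trans fun l hl h => ⟨(f * g) :: l, hl.mul f g (h f ?_) (h g ?_),
    fun _ => List.mem_cons_of_mem _, by simp, by simp⟩ <;> simp

theorem zero : ComputableWithin a 3 G {(0 : Fin K → ZMod 2)} := by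
  have h_zero : (0 : Fin K → ZMod 2) = 1 + 1 :=
    funext fun _ => (CharTwo.add_self_eq_zero (1 : ZMod 2)).symm
  exact h_zero ▸ one.add one

theorem const (x : ZMod 2) : ComputableWithin a 3 G {fun _ : Fin K => x} := by
  fin_cases x
  · exact zero
  · exact one.mono_cost (by norm_num)

theorem sum {ι : Type*} (s : Finset ι) {f : ι → Fin K → ZMod 2}
    (h : ∀ i, ComputableWithin a c G {f i}) :
    ComputableWithin a (s.card * (c + 1) + 3) G {∑ i ∈ s, f i} := by
  classical
  induction s using Finset.induction_on with
  | empty => exact zero.mono_cost (by simp)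
  | insert i s hi ih =>
    rw [Finset.sum_insert hi, Finset.card_insert_of_notMem hi]
    exact ((h i).add ih).mono_cost (by linarith)

theorem prod {ι : Type*} (s : Finset ι) {f : ι → Fin K → ZMod 2}
    (h : ∀ i, ComputableWithin a c G {f i}) :
    ComputableWithin a (s.card * (c + 1) + 1) G {∏ i ∈ s, f i} := by
  classical
  induction s using Finset.induction_on with
  | empty => exact one.mono_cost (by simp)
  | insert i s hi ih =>
    rw [Finset.prod_insert hi, Finset.card_insert_of_notMem hi]
    exact ((h i).mul ih).mono_cost (by linarith)

theorem exists_isProgram (h : ComputableWithin a c ∅ F) :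
    ∃ l, IsProgram a l ∧ (∀ f ∈ F, f ∈ l) ∧ l.length ≤ c := by
  obtain ⟨l, hl, -, h_mem, h_length⟩ := h [] .nil (by simp)
  exact ⟨l, hl, h_mem, by simpa using h_length⟩

end ComputableWithin

/-! ### Arithmetic in finite fields of characteristic two -/

/-- The entries of a matrix that depends on `y`. -/
def entries {K : ℕ} {m : Type*} (A : Fin K → Matrix m m (ZMod 2)) : Set (Fin K → ZMod 2) :=
  Set.range fun (p : m × m) y => A y p.1 p.2

theorem mem_entries {K : ℕ} {m : Type*} (A : Fin K → Matrix m m (ZMod 2)) (i j : m) :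
    (fun y => A y i j) ∈ entries A := ⟨(i, j), rfl⟩

theorem equivFun_mul {ι R A : Type*} [Fintype ι] [CommRing R] [Ring A] [Algebra R A]
    (b : Module.Basis ι R A) (x y : A) (i : ι) : b.equivFun (x * y) i =
      ∑ p : ι × ι, b.equivFun (b p.1 * b p.2) i * (b.equivFun x p.1 * b.equivFun y p.2) := by
  conv_lhs => rw [← b.sum_equivFun x, ← b.sum_equivFun y, Finset.sum_mul_sum,
    ← Fintype.sum_prod_type', map_sum, Finset.sum_apply]
  refine Finset.sum_congr rfl fun p _ => ?_
  rw [smul_mul_smul_comm, map_smul, Pi.smul_apply, smul_eq_mul, mul_comm]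

section Field

variable {n K : ℕ} {F : Type*} [Field F] [Algebra (ZMod 2) F] (b : Module.Basis (Fin n) (ZMod 2) F)

/-- The coordinates of a field element that depends on `y`. -/
def coords (ζ : Fin K → F) : Set (Fin K → ZMod 2) := Set.range fun k y => b.equivFun (ζ y) k

variable {b}

theorem mem_coords (ζ : Fin K → F) (k : Fin n) : (fun y => b.equivFun (ζ y) k) ∈ coords b ζ :=
  ⟨k, rfl⟩

namespace ComputableWithin

variable {a c c₁ c₂ : ℕ} {G : Set (Fin K → ZMod 2)} {ζ η : Fin K → F}

theorem of_coords (h : ∀ k, ComputableWithin a c G {fun y => b.equivFun (ζ y) k}) :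
    ComputableWithin a (n * c) G (coords b ζ) := by
  simpa only [coords, Fintype.card_fin] using range h

theorem coords_const (x : F) : ComputableWithin a (3 * n) G (coords b fun _ : Fin K => x) :=
  (of_coords fun _ => const _).mono_cost (mul_comm n 3).le

theorem coords_add (hζ : ComputableWithin a c₁ G (coords b ζ))
    (hη : ComputableWithin a c₂ G (coords b η)) :
    ComputableWithin a (c₁ + c₂ + n) G (coords b fun y => ζ y + η y) := by
  refine ((hζ.union hη).trans (of_coords (c := 1) fun k => ?_)).mono_cost (by lia)
  simp only [map_add, Pi.add_apply]
  exact add (of_mem (.inr (.inl (mem_coords ζ k)))) (of_mem (.inr (.inr (mem_coords η k))))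

theorem coords_smul {f : Fin K → ZMod 2} (hf : ComputableWithin a c₁ G {f})
    (hζ : ComputableWithin a c₂ G (coords b ζ)) :
    ComputableWithin a (c₁ + c₂ + n) G (coords b fun y => f y • ζ y) := by
  refine ((hf.union hζ).trans (of_coords (c := 1) fun k => ?_)).mono_cost (by lia)
  simp only [map_smul, Pi.smul_apply, smul_eq_mul]
  exact mul (of_mem (.inr (.inl rfl))) (of_mem (.inr (.inr (mem_coords ζ k))))

theorem coords_mul (hζ : coords b ζ ⊆ G) (hη : coords b η ⊆ G) :
    ComputableWithin a (9 * n ^ 3) G (coords b fun y => ζ y * η y) := by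
  refine (of_coords (c := n * n * 6 + 3) fun i => ?_).mono_cost
    (by linarith [Nat.le_self_pow three_ne_zero n])
  have h_term (p : Fin n × Fin n) : ComputableWithin a 5 G
      {(fun _ => b.equivFun (b p.1 * b p.2) i) *
        ((fun y => b.equivFun (ζ y) p.1) * fun y => b.equivFun (η y) p.2)} :=
    (const _).mul
      ((of_mem (hζ (mem_coords ζ p.1))).mul (of_mem (hη (mem_coords η p.2))))
  have h_sum := (sum Finset.univ h_term).mono_cost (c' := n * n * 6 + 3) (by simp)
  convert h_sum using 2
  funext y
  rw [equivFun_mul]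
  simp only [Finset.sum_apply, Pi.mul_apply]

theorem entries_leftMulMatrix (hζ : coords b ζ ⊆ G) :
    ComputableWithin a (12 * n ^ 4) G (entries fun y => Algebra.leftMulMatrix b (ζ y)) := by
  have h_column (j : Fin n) :
      ComputableWithin a (3 * n + 9 * n ^ 3) G (coords b fun y => ζ y * b j) :=
    (coords_const (b j)).trans
      (coords_mul (hζ.trans Set.subset_union_left) Set.subset_union_right)
  refine (iUnion h_column).mono ?_ ?_
  · have h_pow : n ^ 2 ≤ (n ^ 2) ^ 2 := Nat.le_self_pow two_ne_zero _
    rw [Fintype.card_fin]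
    linarith
  · rintro _ ⟨⟨i, j⟩, rfl⟩
    refine Set.mem_iUnion.2 ⟨j, i, funext fun y => ?_⟩
    exact (Algebra.leftMulMatrix_eq_repr_mul b _ _ _).symm

end ComputableWithin

end Field

/-! ### Hashing by multiplication in a finite field -/

theorem exists_field_basis_card_two_pow {n : ℕ} (hn : n ≠ 0) :
    ∃ (F : Type) (_ : Field F) (_ : Fintype F) (_ : Algebra (ZMod 2) F),
      Fintype.card F = 2 ^ n ∧ Nonempty (Module.Basis (Fin n) (ZMod 2) F) := by
  let _ : Fintype (GaloisField 2 n) := Fintype.ofFinite _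
  refine ⟨GaloisField 2 n, inferInstance, inferInstance, inferInstance, ?_,
    ⟨Module.finBasisOfFinrankEq _ _ (GaloisField.finrank 2 hn)⟩⟩
  rw [← Nat.card_eq_fintype_card, GaloisField.card 2 n hn]

theorem card_filter_forall_lt_eq_zero {n s t : ℕ} (hst : s + t = n) :
    (Finset.univ.filter fun v : Fin n → ZMod 2 => ∀ i : Fin n, (i : ℕ) < s → v i = 0).card =
      2 ^ t := by
  subst hst
  have h_eq : (Finset.univ.filter fun v : Fin (s + t) → ZMod 2 =>
      ∀ i : Fin (s + t), (i : ℕ) < s → v i = 0) =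
      Fintype.piFinset fun i : Fin (s + t) => if (i : ℕ) < s then {0} else Finset.univ := by
    ext v
    simp only [Finset.mem_filter_univ, Fintype.mem_piFinset]
    refine forall_congr' fun i => ?_
    split_ifs with h <;> simp [h]
  rw [h_eq, Fintype.card_piFinset, Fin.prod_univ_add]
  simp [ZMod.card]

theorem card_filter_forall_lt_eq_zero_of_injective {n s t : ℕ} (hst : s + t = n)
    {g : Fin (2 ^ n - 1) → Fin n → ZMod 2} (hg : Function.Injective g) (hg_ne : ∀ y, g y ≠ 0) :
    (Finset.univ.filter fun y => ∀ i : Fin n, (i : ℕ) < s → g y i = 0).card = 2 ^ t - 1 := by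
  classical
  have h_image : Finset.univ.image g = Finset.univ.erase 0 := by
    refine Finset.eq_of_subset_of_card_le (fun v hv => ?_) ?_
    · obtain ⟨y, -, rfl⟩ := Finset.mem_image.1 hv
      exact Finset.mem_erase.2 ⟨hg_ne y, Finset.mem_univ _⟩
    · rw [Finset.card_image_of_injective _ hg, Finset.card_erase_of_mem (Finset.mem_univ _)]
      simp [ZMod.card]
  rw [← card_filter_forall_lt_eq_zero hst, ← Finset.card_erase_of_mem (a := 0) (by simp),
    ← Finset.filter_erase, ← h_image, Finset.filter_image, Finset.card_image_of_injective _ hg]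

/-- The power `x ^ (2 ^ (k + 1) - 2)`, computed by repeated squaring. In a field with `2 ^ (k + 1)`
elements it is the inverse of `x`. -/
def powTwoPowSubTwo {R : Type*} [Monoid R] : ℕ → R → R
  | 0, _ => 1
  | k + 1, x => (powTwoPowSubTwo k x * x) * (powTwoPowSubTwo k x * x)

theorem powTwoPowSubTwo_mul_self {R : Type*} [Monoid R] (k : ℕ) (x : R) :
    powTwoPowSubTwo k x * x = x ^ (2 ^ (k + 1) - 1) := by
  induction k with
  | zero => simp [powTwoPowSubTwo]
  | succ k ih =>
    have h_pos := Nat.one_le_two_pow (n := k + 1)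
    rw [powTwoPowSubTwo, ih, ← pow_add, ← pow_succ, pow_succ 2 (k + 1)]
    congr 1
    lia

theorem leftMulMatrix_mulVec {ι R A : Type*} [Fintype ι] [DecidableEq ι] [CommRing R] [Ring A]
    [Algebra R A] (b : Module.Basis ι R A) (x : A) (v : ι → R) :
    Algebra.leftMulMatrix b x *ᵥ v = b.equivFun (x * b.equivFun.symm v) := by
  rw [b.equivFun_apply, ← Algebra.leftMulMatrix_mulVec_repr, ← b.equivFun_apply,
    b.equivFun.apply_symm_apply]

section Field

variable {n : ℕ} {F : Type*} [Field F] [Algebra (ZMod 2) F]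

/-- The field element whose coordinates are the complements of the last `n` binary digits of `y`.
The complement makes it nonzero for all `y < 2 ^ n - 1`. -/
def complElt (b : Module.Basis (Fin n) (ZMod 2) F) (y : ℕ) : F :=
  b.equivFun.symm fun k => bitZ y k + 1

variable (b : Module.Basis (Fin n) (ZMod 2) F)

theorem equivFun_complElt (y : ℕ) (k : Fin n) : b.equivFun (complElt b y) k = bitZ y k + 1 := by
  rw [complElt, b.equivFun.apply_symm_apply]

theorem complElt_injOn : Set.InjOn (complElt b) (Set.Iio (2 ^ n)) := by
  refine fun y hy y' hy' h => eq_of_forall_bitZ_eq hy hy' fun k hk => ?_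
  rw [← add_left_inj 1, ← equivFun_complElt b y ⟨k, hk⟩, h, equivFun_complElt]

theorem complElt_two_pow_sub_one : complElt b (2 ^ n - 1) = 0 := by
  refine b.equivFun.map_eq_zero_iff.1 (funext fun k => ?_)
  have h_bit : bitZ (2 ^ n - 1) k = 1 := by simp [bitZ, Nat.testBit_two_pow_sub_one]
  rw [equivFun_complElt, h_bit, CharTwo.add_self_eq_zero, Pi.zero_apply]

theorem complElt_ne_zero {y : ℕ} (hy : y < 2 ^ n - 1) : complElt b y ≠ 0 := fun h =>
  hy.ne (complElt_injOn b (Set.mem_Iio.2 (by lia)) (Set.mem_Iio.2 (by lia))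
    (h.trans (complElt_two_pow_sub_one b).symm))

theorem complElt_mul_injective {x : F} (hx : x ≠ 0) :
    Function.Injective fun y : Fin (2 ^ n - 1) => complElt b y * x := fun y y' h =>
  Fin.ext (complElt_injOn b (Set.mem_Iio.2 (by lia)) (Set.mem_Iio.2 (by lia))
    (mul_right_cancel₀ hx h))

theorem card_filter_leftMulMatrix_complElt {s t : ℕ} (hst : s + t = n) {x : Fin n → ZMod 2}
    (hx : x ≠ 0) :
    (Finset.univ.filter fun y : Fin (2 ^ n - 1) => ∀ i : Fin n, (i : ℕ) < s →
      (Algebra.leftMulMatrix b (complElt b y) *ᵥ x) i = 0).card = 2 ^ t - 1 := by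
  have hx' : b.equivFun.symm x ≠ 0 := b.equivFun.symm.map_ne_zero_iff.2 hx
  simp only [leftMulMatrix_mulVec]
  exact card_filter_forall_lt_eq_zero_of_injective hst
    (b.equivFun.injective.comp (complElt_mul_injective b hx')) fun y =>
      b.equivFun.map_ne_zero_iff.2 (mul_ne_zero (complElt_ne_zero b y.2) hx')

namespace ComputableWithin

variable {b} {a K : ℕ} {G : Set (Fin K → ZMod 2)}

theorem coords_complElt (ha : n ≤ a) :
    ComputableWithin a (3 * n) G (coords b fun y : Fin K => complElt b y) := by
  refine (of_coords (c := 3) fun k => ?_).mono_cost (mul_comm n 3).le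
  simp only [equivFun_complElt]
  exact (bit (by lia)).add one

theorem coords_powTwoPowSubTwo {ζ : Fin K → F} (hζ : coords b ζ ⊆ G) (k : ℕ) :
    ComputableWithin a (3 * n + k * (18 * n ^ 3)) G
      (coords b fun y => powTwoPowSubTwo k (ζ y)) := by
  induction k with
  | zero => exact (coords_const (1 : F)).mono_cost (by simp)
  | succ k ih =>
    have h_mul := coords_mul (a := a) (η := ζ)
      (Set.subset_union_right (s := G) (t := coords b fun y => powTwoPowSubTwo k (ζ y)))
      (hζ.trans Set.subset_union_left)
    have h_sq := h_mul.trans (coords_mul Set.subset_union_right Set.subset_union_right)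
    exact (ih.trans h_sq).mono_cost (by linarith)

end ComputableWithin

end Field

theorem gepp_size_le {C a len size : ℕ} (ha : 0 < a) (h_len : len ≤ C * a ^ 4)
    (h_size : size ≤ 10 * len + 4 * a ^ 2 + 15 * a + 2) : size ≤ (10 * C + 21) * a ^ 4 := by
  have h_one : 1 ≤ a ^ 4 := Nat.one_le_pow _ _ ha
  have h_self : a ≤ a ^ 4 := Nat.le_self_pow four_ne_zero a
  have h_sq : a ^ 2 ≤ a ^ 4 := Nat.pow_le_pow_right ha (by norm_num)
  linarith

theorem exists_gepp_field {n t : ℕ} (ht : t < n) :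
    ∃ P : GEPP (2 ^ n) (2 ^ n - 1) (2 ^ (n - t) * (2 ^ n - 1)), P.size ≤ 501 * n ^ 4 ∧
      ∀ ε : ℝ, ε < 1 / 2 → P.DetSuccessful ε (2 * ε / 2 ^ t) ε ∧
        (ε ≤ 2 ^ t / 2 ^ n → P.DetSuccessful ε (ε / 2 ^ t) ε) := by
  have hn : 0 < n := by lia
  obtain ⟨F, _, _, _, h_card, ⟨b⟩⟩ := exists_field_basis_card_two_pow hn.ne'
  let ζ : Fin (2 ^ n - 1) → F := fun y => complElt b y
  let η : Fin (2 ^ n - 1) → F := fun y => powTwoPowSubTwo (n - 1) (ζ y)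
  have h_inv (y : Fin (2 ^ n - 1)) :
      Algebra.leftMulMatrix b (η y) * Algebra.leftMulMatrix b (ζ y) = 1 := by
    rw [← map_mul, powTwoPowSubTwo_mul_self, Nat.sub_add_cancel hn, ← h_card,
      FiniteField.pow_card_sub_one_eq_one _ (complElt_ne_zero b y.2), map_one]
  have h_computable := (ComputableWithin.coords_complElt (G := ∅) (b := b) le_rfl).trans
    ((ComputableWithin.entries_leftMulMatrix (ζ := ζ) Set.subset_union_right).union
      ((ComputableWithin.coords_powTwoPowSubTwo (ζ := ζ) Set.subset_union_right (n - 1)).trans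
        (ComputableWithin.entries_leftMulMatrix (ζ := η) Set.subset_union_right)))
  obtain ⟨l, hl, h_mem, h_length⟩ := h_computable.exists_isProgram
  have h_two_pow : 2 ≤ 2 ^ n := Nat.le_self_pow hn.ne' 2
  obtain ⟨P, h_size, hP⟩ := hl.exists_gepp (Nat.sub_add_cancel ht.le) hn (by lia) (by lia) h_inv
    (fun i j => h_mem _ (.inl (mem_entries _ i j))) (fun i j => h_mem _ (.inr (mem_entries _ i j)))
    (mul_comm _ _) fun x hx =>
      card_filter_leftMulMatrix_complElt b (Nat.sub_add_cancel ht.le) hx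
  refine ⟨P, gepp_size_le (C := 48) hn (h_length.trans ?_) h_size, hP⟩
  have h_self : n ≤ n ^ 4 := Nat.le_self_pow four_ne_zero n
  calc _ ≤ 3 * n + (12 * n ^ 4 + (3 * n + n * (18 * n ^ 3) + 12 * n ^ 4)) := by gcongr; lia
    _ ≤ 48 * n ^ 4 := by linarith

/-! ### Matrices over a finite field as matrices over its prime field -/

section Expand

variable {d n : ℕ} {R A : Type*} [CommRing R] [Ring A] [Algebra R A] (b : Module.Basis (Fin n) R A)

/-- The ring homomorphism that replaces every entry of a matrix by the matrix over `R` of the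
multiplication with it. -/
def expandMatrix : Matrix (Fin d) (Fin d) A →+* Matrix (Fin (d * n)) (Fin (d * n)) R :=
  ((reindexRingEquiv R finProdFinEquiv).toRingHom.comp
    (compRingEquiv (Fin d) (Fin n) R).toRingHom).comp (Algebra.leftMulMatrix b).toRingHom.mapMatrix

theorem expandMatrix_apply (T : Matrix (Fin d) (Fin d) A) (i k : Fin d) (α β : Fin n) :
    expandMatrix b T (finProdFinEquiv (i, α)) (finProdFinEquiv (k, β)) =
      Algebra.leftMulMatrix b (T i k) α β := by
  simp [expandMatrix]

/-- The vector over `A` whose entries have the coordinates that are listed in `x`. -/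
def collectVec (x : Fin (d * n) → R) (i : Fin d) : A :=
  b.equivFun.symm fun α => x (finProdFinEquiv (i, α))

theorem expandMatrix_mulVec (T : Matrix (Fin d) (Fin d) A) (x : Fin (d * n) → R) (i : Fin d)
    (α : Fin n) : (expandMatrix b T *ᵥ x) (finProdFinEquiv (i, α)) =
      b.equivFun ((T *ᵥ collectVec b x) i) α := by
  simp only [Matrix.mulVec, dotProduct, map_sum, Finset.sum_apply, collectVec,
    ← leftMulMatrix_mulVec, ← finProdFinEquiv.sum_comp (fun k => _ * x k), Fintype.sum_prod_type,
    expandMatrix_apply]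

theorem collectVec_ne_zero {x : Fin (d * n) → R} (hx : x ≠ 0) : collectVec b x ≠ 0 := by
  refine fun h => hx (funext fun k => ?_)
  obtain ⟨⟨i, α⟩, rfl⟩ := finProdFinEquiv.surjective k
  exact congrFun (b.equivFun.symm.map_eq_zero_iff.1 (congrFun h i)) α

theorem forall_expandMatrix_mulVec_eq_zero_iff {s : ℕ} (hs : s + n = d * n) {o : Fin d}
    (ho : (o : ℕ) + 1 = d) (T : Matrix (Fin d) (Fin d) A) (x : Fin (d * n) → R) :
    (∀ k : Fin (d * n), (k : ℕ) < s → (expandMatrix b T *ᵥ x) k = 0) ↔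
      ∀ i, i ≠ o → (T *ᵥ collectVec b x) i = 0 := by
  have hs' : s = n * o := by
    rw [← ho, add_one_mul, mul_comm] at hs
    exact add_right_cancel hs
  have h_lt (i : Fin d) (α : Fin n) : (finProdFinEquiv (i, α) : ℕ) < s ↔ i ≠ o := by
    rw [finProdFinEquiv_apply_val, hs', ← Fin.val_ne_iff]
    refine ⟨fun h => (Nat.lt_of_mul_lt_mul_left ((Nat.le_add_left _ _).trans_lt h)).ne, fun h => ?_⟩
    calc (α : ℕ) + n * i < n + n * i := by lia
      _ = n * (i + 1) := by ring
      _ ≤ n * o := Nat.mul_le_mul_left n (by lia)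
  simp only [finProdFinEquiv.surjective.forall, Prod.forall, h_lt, expandMatrix_mulVec]
  refine forall_congr' fun i => ⟨fun h hi => ?_, fun h α hi => ?_⟩
  · exact b.equivFun.map_eq_zero_iff.1 (funext fun α => h α hi)
  · rw [h hi, map_zero, Pi.zero_apply]

end Expand

theorem ComputableWithin.entries_expandMatrix {a c d n K : ℕ} {F : Type*} [Field F]
    [Algebra (ZMod 2) F] {b : Module.Basis (Fin n) (ZMod 2) F} {G : Set (Fin K → ZMod 2)}
    {T : Fin K → Matrix (Fin d) (Fin d) F}
    (hT : ∀ i k, ComputableWithin a c G (coords b fun y => T y i k)) :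
    ComputableWithin a (d * d * (c + 12 * n ^ 4)) G (entries fun y => expandMatrix b (T y)) := by
  have h_block (p : Fin d × Fin d) : ComputableWithin a (c + 12 * n ^ 4) G
      (entries fun y => Algebra.leftMulMatrix b (T y p.1 p.2)) :=
    (hT p.1 p.2).trans (entries_leftMulMatrix Set.subset_union_right)
  refine (iUnion h_block).mono (by simp) ?_
  rintro _ ⟨⟨k, l⟩, rfl⟩
  obtain ⟨⟨i, α⟩, rfl⟩ := finProdFinEquiv.surjective k
  obtain ⟨⟨j, β⟩, rfl⟩ := finProdFinEquiv.surjective l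
  simp only [expandMatrix_apply]
  exact Set.mem_iUnion.2 ⟨(i, j), mem_entries _ α β⟩

/-! ### Involutions that move a line to a coordinate axis -/

section LineMatrix

variable {ι R : Type*} [DecidableEq ι] [CommRing R]

/-- In characteristic two, the transvection that swaps the vector `v` and the unit vector of
coordinate `o`, provided that `v j = 1` and that `v o = 0` unless `o = j`. -/
def lineMatrix (o j : ι) (v : ι → R) : Matrix ι ι R :=
  1 + vecMulVec (v + Pi.single o 1) fun k => if k = o ∨ k = j then 1 else 0

variable [Fintype ι] {o j : ι} {v : ι → R}

theorem ite_dotProduct_eq_one (hv : v j = 1) (hv' : j ≠ o → v o = 0) :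
    (fun k => if k = o ∨ k = j then 1 else 0) ⬝ᵥ v = 1 := by
  rw [dotProduct, Finset.sum_eq_single j (fun k _ hk => ?_) (by simp)]
  · simp [hv]
  · by_cases hko : k = o
    · rw [hko, hv' (hko ▸ hk.symm), mul_zero]
    · rw [if_neg (not_or.2 ⟨hko, hk⟩), zero_mul]

theorem ite_dotProduct_single : (fun k => if k = o ∨ k = j then (1 : R) else 0) ⬝ᵥ
    Pi.single o 1 = 1 := by
  simp

variable [CharP R 2]

theorem lineMatrix_mul_self (hv : v j = 1) (hv' : j ≠ o → v o = 0) :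
    lineMatrix o j v * lineMatrix o j v = 1 := by
  have h_add_self (M : Matrix ι ι R) : M + M = 0 :=
    Matrix.ext fun i k => CharTwo.add_self_eq_zero (M i k)
  rw [lineMatrix, mul_add, add_mul, add_mul, one_mul, mul_one, one_mul, vecMulVec_mul_vecMulVec,
    dotProduct_add, ite_dotProduct_eq_one hv hv', ite_dotProduct_single,
    CharTwo.add_self_eq_zero, zero_smul, vecMulVec_zero, add_zero, add_assoc, h_add_self, add_zero]

theorem lineMatrix_mulVec_single (v : ι → R) :
    lineMatrix o j v *ᵥ Pi.single o 1 = v := by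
  rw [lineMatrix, add_mulVec, one_mulVec, vecMulVec_mulVec, ite_dotProduct_single,
    MulOpposite.op_one, one_smul, add_comm, add_assoc]
  exact funext fun i => by simp [CharTwo.add_self_eq_zero]

theorem forall_lineMatrix_mulVec_eq_zero_iff (hv : v j = 1) (hv' : j ≠ o → v o = 0) (x : ι → R) :
    (∀ i, i ≠ o → (lineMatrix o j v *ᵥ x) i = 0) ↔ x = x j • v := by
  have h_invol (x : ι → R) : lineMatrix o j v *ᵥ lineMatrix o j v *ᵥ x = x := by
    rw [mulVec_mulVec, lineMatrix_mul_self hv hv', one_mulVec]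
  constructor
  · intro h
    have h_axis : lineMatrix o j v *ᵥ x = (lineMatrix o j v *ᵥ x) o • Pi.single o 1 := by
      funext i
      rcases eq_or_ne i o with rfl | hi
      · simp
      · simp [h i hi, hi]
    have h_line : x = (lineMatrix o j v *ᵥ x) o • v := by
      rw [← lineMatrix_mulVec_single (o := o) (j := j) v, ← mulVec_smul,
        lineMatrix_mulVec_single, ← h_axis, h_invol]
    have h_coeff := congrFun h_line j
    rw [Pi.smul_apply, hv, smul_eq_mul, mul_one] at h_coeff
    rwa [h_coeff]
  · intro h i hi
    have h_swap : lineMatrix o j v *ᵥ v = Pi.single o 1 := by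
      have h_single := h_invol (Pi.single o 1)
      rwa [lineMatrix_mulVec_single] at h_single
    rw [h, mulVec_smul, h_swap, Pi.smul_apply, Pi.single_eq_of_ne hi, smul_zero]

end LineMatrix

/-! ### Directions of lines -/

theorem bitZ_two_pow_add {k y : ℕ} (hy : y < 2 ^ k) (i : ℕ) :
    bitZ (2 ^ k + y) i = if i < k then bitZ y i else if i = k then 1 else 0 := by
  have h_testBit := Nat.testBit_two_pow_mul_add 1 hy i
  rw [mul_one] at h_testBit
  simp only [bitZ, h_testBit]
  by_cases h_lt : i < k
  · simp [h_lt]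
  · simp [h_lt, Nat.testBit_one_eq_true_iff_self_eq_zero, Nat.sub_eq_zero_iff_le,
      (not_lt.1 h_lt).ge_iff_eq']

theorem mul_add_lt_mul {d n i α : ℕ} (hi : i < d) (hα : α < n) : n * i + α < d * n := by
  calc n * i + α < n * i + n := by lia
    _ = (i + 1) * n := by ring
    _ ≤ d * n := Nat.mul_le_mul_right n hi

/-- Among the `d` digits of `y` in base `2 ^ n`, the one at position `j` is `0` and those at higher
positions are `1`. A number with pivot `j` stands for a line in `d`-dimensional space whose last
nonzero coordinate is the one at position `j`. -/
structure IsPivot (n d y j : ℕ) : Prop where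
  lt : j < d
  bitZ_above : ∀ i, j < i → i < d → ∀ α < n, bitZ y (n * i + α) = if α = 0 then 1 else 0
  bitZ_pivot : ∀ α < n, bitZ y (n * j + α) = 0

theorem exists_isPivot {n d y : ℕ} (hn : 0 < n) (hy : y < ∑ i ∈ Finset.range d, (2 ^ n) ^ i) :
    ∃ j, IsPivot n d y j := by
  induction d generalizing y with
  | zero => simp at hy
  | succ d ih =>
    rw [Finset.sum_range_succ] at hy
    by_cases h_top : y < (2 ^ n) ^ d
    · refine ⟨d, d.lt_succ_self, fun i h_gt h_lt => by lia, fun α _ => bitZ_eq_zero_of_lt ?_⟩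
      rw [← pow_mul] at h_top
      exact h_top.trans_le (Nat.pow_le_pow_right two_pos (Nat.le_add_right _ _))
    · obtain ⟨y, rfl⟩ := Nat.exists_eq_add_of_le (not_lt.1 h_top)
      have hy_sum : y < ∑ i ∈ Finset.range d, (2 ^ n) ^ i := by lia
      have hy_lt : y < 2 ^ (n * d) := by
        rw [pow_mul]
        exact hy_sum.trans (Nat.geomSum_lt (Nat.le_self_pow hn.ne' 2) fun _ => Finset.mem_range.1)
      have h_below {i α : ℕ} (hi : i < d) (hα : α < n) :
          bitZ ((2 ^ n) ^ d + y) (n * i + α) = bitZ y (n * i + α) := by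
        rw [← pow_mul, bitZ_two_pow_add hy_lt, if_pos]
        exact (mul_add_lt_mul hi hα).trans_eq (mul_comm d n)
      obtain ⟨j, h_lt, h_above, h_pivot⟩ := ih hy_sum
      refine ⟨j, by lia, fun i hji hi α hα => ?_, fun α hα => ?_⟩
      · rcases Nat.lt_succ_iff_lt_or_eq.1 hi with hi | rfl
        · rw [h_below hi hα, h_above i hji hi α hα]
        · simp [← pow_mul, bitZ_two_pow_add hy_lt]
      · rw [h_below h_lt hα, h_pivot α hα]

theorem exists_forall_isPivot {d n K : ℕ} (hn : 0 < n)
    (hK : K * (2 ^ n - 1) = 2 ^ (d * n) - 1) :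
    ∃ pv : Fin K → Fin d, ∀ y : Fin K, IsPivot n d y (pv y) := by
  have h_two_pow : 2 ≤ 2 ^ n := Nat.le_self_pow hn.ne' 2
  have hK_sum : K = ∑ i ∈ Finset.range d, (2 ^ n) ^ i := by
    refine Nat.eq_of_mul_eq_mul_right (by lia : 0 < 2 ^ n - 1) ?_
    rw [geom_sum_mul_of_one_le (by lia), hK, mul_comm d n, pow_mul]
  choose j hj using fun y : Fin K => exists_isPivot hn (y.2.trans_eq hK_sum)
  exact ⟨fun y => ⟨j y, (hj y).lt⟩, hj⟩

section Direction

variable {d n K : ℕ}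

/-- The indicator function of the pivot `j`. -/
def pivotBit (pv : Fin K → Fin d) (j : Fin d) (y : Fin K) : ZMod 2 := if j = pv y then 1 else 0

theorem pivotBit_eq {pv : Fin K → Fin d} (hpv : ∀ y : Fin K, IsPivot n d y (pv y)) (hn : 0 < n)
    (j : Fin d) : pivotBit pv j = (∏ i ∈ Finset.Ioi j, fun y : Fin K => bitZ y (n * i)) *
      ((fun y : Fin K => bitZ y (n * j)) + 1) := by
  funext y
  have h_above (i : Fin d) (hi : pv y < i) : bitZ y (n * i) = 1 := by
    simpa using (hpv y).bitZ_above i hi i.2 0 hn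
  have h_pivot : bitZ y (n * pv y) = 0 := by simpa using (hpv y).bitZ_pivot 0 hn
  rw [Pi.mul_apply, Finset.prod_apply, pivotBit, Pi.add_apply, Pi.one_apply]
  rcases lt_trichotomy j (pv y) with h | rfl | h
  · rw [if_neg h.ne, Finset.prod_eq_zero (Finset.mem_Ioi.2 h) h_pivot, zero_mul]
  · rw [if_pos rfl, h_pivot, zero_add, mul_one,
      Finset.prod_eq_one fun i hi => h_above i (Finset.mem_Ioi.1 hi)]
  · rw [if_neg h.ne', h_above j h, CharTwo.add_self_eq_zero, mul_zero]

variable {F : Type*} [Field F] [Algebra (ZMod 2) F] (b : Module.Basis (Fin n) (ZMod 2) F)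

/-- The digit of `y` in base `2 ^ n` at position `i`, as an element of the field with `2 ^ n`
elements. -/
def digit (y i : ℕ) : F := b.equivFun.symm fun α => bitZ y (n * i + α)

theorem equivFun_digit (y i : ℕ) (α : Fin n) :
    b.equivFun (digit b y i) α = bitZ y (n * i + α) := by
  rw [digit, b.equivFun.apply_symm_apply]

/-- The vector that spans the line with number `y` and pivot `j`: the digits of `y` below the
pivot, then `1`, then zeros. -/
def direction (j : Fin d) (y : ℕ) (i : Fin d) : F :=
  if i < j then digit b y i else if i = j then 1 else 0

theorem direction_pivot (j : Fin d) (y : ℕ) : direction b j y j = 1 := by simp [direction]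

theorem direction_above {j i : Fin d} (h : j < i) (y : ℕ) : direction b j y i = 0 := by
  simp [direction, h.not_gt, h.ne']

theorem direction_last {j o : Fin d} (ho : (o : ℕ) + 1 = d) (hj : j ≠ o) (y : ℕ) :
    direction b j y o = 0 :=
  direction_above b (by lia) y

theorem direction_eq (pv : Fin K → Fin d) (y : Fin K) (i : Fin d) : direction b (pv y) y i =
    (∑ j ∈ Finset.Ioi i, pivotBit pv j) y • digit b y i + pivotBit pv i y • 1 := by
  have h_sum : (∑ j ∈ Finset.Ioi i, pivotBit pv j) y = if i < pv y then 1 else 0 := by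
    simp [Finset.sum_apply, pivotBit]
  rw [h_sum, direction, pivotBit]
  rcases lt_trichotomy i (pv y) with h | h | h
  · simp [h, h.ne]
  · simp [h]
  · simp [h.not_gt, h.ne']

theorem IsPivot.eq_of_direction_eq {y y' : ℕ} {j : Fin d} (hy : IsPivot n d y j)
    (hy' : IsPivot n d y' j) (h_lt : y < 2 ^ (d * n)) (h_lt' : y' < 2 ^ (d * n))
    (h : direction b j y = direction b j y') : y = y' := by
  refine eq_of_forall_bitZ_eq h_lt h_lt' fun k hk => ?_
  obtain ⟨⟨i, α⟩, h_eq⟩ := finProdFinEquiv.surjective (⟨k, hk⟩ : Fin (d * n))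
  obtain rfl : n * i + α = k := by simpa [add_comm] using congrArg Fin.val h_eq
  rcases lt_trichotomy i j with hi | rfl | hi
  · have h_digit := congrFun h i
    rw [direction, direction, if_pos hi, if_pos hi] at h_digit
    rw [← equivFun_digit b, h_digit, equivFun_digit]
  · rw [hy.bitZ_pivot α α.2, hy'.bitZ_pivot α α.2]
  · rw [hy.bitZ_above i hi i.2 α α.2, hy'.bitZ_above i hi i.2 α α.2]

theorem pivot_le_of_smul_direction_eq {j j' : Fin d} {y y' : ℕ} {c c' : Fˣ}
    (h : c • direction b j y = c' • direction b j' y') : j' ≤ j := by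
  by_contra! h_lt
  have h_coord := congrFun h j'
  rw [Pi.smul_apply, Pi.smul_apply, direction_above b h_lt, direction_pivot, smul_zero] at h_coord
  exact c'.ne_zero (by simpa [Units.smul_def] using h_coord.symm)

section Lines

variable {pv : Fin K → Fin d} (hpv : ∀ y : Fin K, IsPivot n d y (pv y)) (hK : K ≤ 2 ^ (d * n))
include hpv hK

theorem smul_direction_injective :
    Function.Injective fun q : Fˣ × Fin K => q.1 • direction b (pv q.2) q.2 := by
  rintro ⟨c, y⟩ ⟨c', y'⟩ (h : c • direction b (pv y) y = c' • direction b (pv y') y')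
  have h_pivot : pv y = pv y' := le_antisymm
    (pivot_le_of_smul_direction_eq b h.symm) (pivot_le_of_smul_direction_eq b h)
  have hy' : IsPivot n d y' (pv y) := h_pivot ▸ hpv y'
  rw [← h_pivot] at h
  obtain rfl : c = c' := Units.ext <| by
    simpa [direction_pivot, Units.smul_def] using congrFun h (pv y)
  have h_eq := (hpv y).eq_of_direction_eq b hy' (y.2.trans_le hK) (y'.2.trans_le hK)
    (smul_left_cancel c h)
  rw [Fin.ext h_eq]

variable [Fintype F]

theorem exists_smul_direction_eq (hF : Fintype.card F = 2 ^ n)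
    (hK_mul : K * (2 ^ n - 1) = 2 ^ (d * n) - 1) {x : Fin d → F} (hx : x ≠ 0) :
    ∃ (c : Fˣ) (y : Fin K), c • direction b (pv y) y = x := by
  classical
  have h_card : (Finset.univ.erase (0 : Fin d → F)).card ≤
      (Finset.univ : Finset (Fˣ × Fin K)).card := by
    rw [Finset.card_erase_of_mem (Finset.mem_univ _), Finset.card_univ, Finset.card_univ,
      Fintype.card_fun, Fintype.card_prod, Fintype.card_units, hF, Fintype.card_fin,
      Fintype.card_fin, ← pow_mul, mul_comm n d, ← hK_mul, mul_comm]
  have h_surj := Finset.surjOn_of_injOn_of_card_le _ (fun q _ => ?_)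
    (smul_direction_injective b hpv hK).injOn h_card
  · obtain ⟨⟨c, y⟩, -, h⟩ := h_surj (Finset.mem_coe.2 (Finset.mem_erase.2 ⟨hx, Finset.mem_univ x⟩))
    exact ⟨c, y, h⟩
  · refine Finset.mem_coe.2 (Finset.mem_erase.2 ⟨fun h => q.1.ne_zero ?_, Finset.mem_univ _⟩)
    simpa [direction_pivot, Units.smul_def] using congrFun h (pv q.2)

theorem card_filter_eq_smul_direction [DecidableEq F] (hF : Fintype.card F = 2 ^ n)
    (hK_mul : K * (2 ^ n - 1) = 2 ^ (d * n) - 1) {x : Fin d → F} (hx : x ≠ 0) :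
    (Finset.univ.filter fun y : Fin K => x = x (pv y) • direction b (pv y) y).card = 1 := by
  obtain ⟨c, y, h_eq⟩ := exists_smul_direction_eq b hpv hK hF hK_mul hx
  refine Finset.card_eq_one.2 ⟨y, Finset.ext fun y' => ?_⟩
  rw [Finset.mem_filter_univ, Finset.mem_singleton]
  constructor
  · intro h
    have h_ne : x (pv y') ≠ 0 := fun h_zero => hx (by rw [h, h_zero, zero_smul])
    have h_pair : (Units.mk0 _ h_ne, y') = (c, y) :=
      smul_direction_injective b hpv hK (h.symm.trans h_eq.symm)
    exact congrArg Prod.snd h_pair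
  · rintro rfl
    have h_coeff : x (pv y') = c := by
      simpa [direction_pivot, Units.smul_def] using (congrFun h_eq (pv y')).symm
    rw [h_coeff]
    exact h_eq.symm

end Lines

namespace ComputableWithin

variable {b} {a : ℕ} {pv : Fin K → Fin d} {G : Set (Fin K → ZMod 2)}

theorem range_pivotBit (hpv : ∀ y : Fin K, IsPivot n d y (pv y)) (hn : 0 < n) :
    ComputableWithin (d * n) (d * (2 * d + 5)) G (Set.range (pivotBit pv)) := by
  have h_bit (i : Fin d) : ComputableWithin (d * n) 1 G {fun y : Fin K => bitZ y (n * i)} :=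
    bit (mul_add_lt_mul i.2 hn)
  refine (range (c := 2 * d + 5) fun j => ?_).mono_cost (by simp)
  rw [pivotBit_eq hpv hn]
  refine ((prod (Finset.Ioi j) h_bit).mul ((h_bit j).add one)).mono_cost ?_
  linarith [(Finset.card_le_univ (Finset.Ioi j)).trans_eq (Fintype.card_fin d)]

theorem coords_direction (hG : Set.range (pivotBit pv) ⊆ G) (i : Fin d) :
    ComputableWithin (d * n) (d + 7 * n + 3) G (coords b fun y => direction b (pv y) y i) := by
  have h_pivot (j : Fin d) : ComputableWithin (d * n) 0 G {pivotBit pv j} :=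
    of_mem (hG ⟨j, rfl⟩)
  have h_digit : ComputableWithin (d * n) (n * 1) G (coords b fun y : Fin K => digit b y i) :=
    of_coords fun α => by
      simp only [equivFun_digit]
      exact bit (mul_add_lt_mul i.2 α.2)
  simp only [direction_eq]
  refine (((sum (Finset.Ioi i) h_pivot).coords_smul h_digit).coords_add
    ((h_pivot i).coords_smul (coords_const 1))).mono_cost ?_
  linarith [(Finset.card_le_univ (Finset.Ioi i)).trans_eq (Fintype.card_fin d)]

theorem coords_lineMatrix {v : Fin K → Fin d → F} (hG : Set.range (pivotBit pv) ⊆ G)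
    (hv : ⋃ i, coords b (fun y => v y i) ⊆ G) (o i k : Fin d) :
    ComputableWithin a (9 * n + 1) G (coords b fun y => lineMatrix o (pv y) (v y) i k) := by
  have h_select : ComputableWithin a 1 G
      {fun y => if k = o ∨ k = pv y then (1 : ZMod 2) else 0} := by
    by_cases hk : k = o
    · simp only [hk, true_or, if_true]
      exact one
    · simp only [hk, false_or]
      exact (of_mem (hG ⟨k, rfl⟩)).mono_cost zero_le_one
  have h_entry := (coords_const (b := b) ((1 : Matrix (Fin d) (Fin d) F) i k)).coords_add
    (h_select.coords_smul ((of_subset (Set.iUnion_subset_iff.1 hv i)).coords_add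
      (coords_const (Pi.single (M := fun _ => F) o 1 i))))
  convert h_entry.mono_cost (c' := 9 * n + 1) (by lia) using 3 with y
  simp [lineMatrix, vecMulVec_apply, -smul_add]

theorem entries_expandMatrix_lineMatrix (hpv : ∀ y : Fin K, IsPivot n d y (pv y)) (hd : 0 < d)
    (hn : 0 < n) (o : Fin d) : ComputableWithin (d * n) (40 * (d * n) ^ 4) G
      (entries fun y => expandMatrix b (lineMatrix o (pv y) (direction b (pv y) y))) := by
  refine ((range_pivotBit hpv hn).trans
    ((iUnion fun i => coords_direction (b := b) Set.subset_union_right i).trans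
      (entries_expandMatrix fun i k => coords_lineMatrix (v := fun y => direction b (pv y) y)
        (Set.subset_union_right.trans Set.subset_union_left)
        Set.subset_union_right o i k))).mono_cost ?_
  have h_pow {i j : ℕ} (hi : i ≤ 4) (hj : j ≤ 4) : d ^ i * n ^ j ≤ (d * n) ^ 4 := by
    rw [mul_pow]
    exact Nat.mul_le_mul (Nat.pow_le_pow_right hd hi) (Nat.pow_le_pow_right hn hj)
  calc _ = 4 * (d ^ 2 * n ^ 0) + 8 * (d ^ 1 * n ^ 0) + 7 * (d ^ 1 * n ^ 1) +
        9 * (d ^ 2 * n ^ 1) + 12 * (d ^ 2 * n ^ 4) := by rw [Fintype.card_fin]; ring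
    _ ≤ 4 * (d * n) ^ 4 + 8 * (d * n) ^ 4 + 7 * (d * n) ^ 4 + 9 * (d * n) ^ 4 +
        12 * (d * n) ^ 4 := by gcongr <;> exact h_pow (by norm_num) (by norm_num)
    _ = 40 * (d * n) ^ 4 := by ring

end ComputableWithin

theorem card_filter_expandMatrix_lineMatrix [Fintype F] {s : ℕ} {pv : Fin K → Fin d}
    (hpv : ∀ y : Fin K, IsPivot n d y (pv y)) (hK : K ≤ 2 ^ (d * n))
    (hF : Fintype.card F = 2 ^ n) (hK_mul : K * (2 ^ n - 1) = 2 ^ (d * n) - 1) {o : Fin d}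
    (ho : (o : ℕ) + 1 = d) (hs : s + n = d * n) {x : Fin (d * n) → ZMod 2} (hx : x ≠ 0) :
    (Finset.univ.filter fun y : Fin K => ∀ k : Fin (d * n), (k : ℕ) < s →
      (expandMatrix b (lineMatrix o (pv y) (direction b (pv y) y)) *ᵥ x) k = 0).card = 1 := by
  classical
  have := charP_of_injective_algebraMap (algebraMap (ZMod 2) F).injective 2
  rw [← card_filter_eq_smul_direction b hpv hK hF hK_mul (collectVec_ne_zero b hx)]
  congr 1
  ext y
  rw [Finset.mem_filter_univ, Finset.mem_filter_univ,
    forall_expandMatrix_mulVec_eq_zero_iff b hs ho]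
  exact forall_lineMatrix_mulVec_eq_zero_iff (direction_pivot b _ _)
    (fun h => direction_last b ho h _) _

end Direction

theorem exists_gepp_lines {d n s K : ℕ} (hd : 0 < d) (hn : 0 < n) (hs : s + n = d * n)
    (hK : K * (2 ^ n - 1) = 2 ^ (d * n) - 1) :
    ∃ P : GEPP (2 ^ (d * n)) K (2 ^ s * K), P.size ≤ 421 * (d * n) ^ 4 ∧
      ∀ ε : ℝ, ε < 1 / 2 → P.DetSuccessful ε (2 * ε / 2 ^ n) ε ∧
        (ε ≤ 2 ^ n / 2 ^ (d * n) → P.DetSuccessful ε (ε / 2 ^ n) ε) := by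
  obtain ⟨F, _, _, _, hF, ⟨b⟩⟩ := exists_field_basis_card_two_pow hn.ne'
  have := charP_of_injective_algebraMap (algebraMap (ZMod 2) F).injective 2
  have hdn : 0 < d * n := Nat.mul_pos hd hn
  have h_two_pow : 2 ≤ 2 ^ n := Nat.le_self_pow hn.ne' 2
  have h_two_pow' : 2 ≤ 2 ^ (d * n) := Nat.le_self_pow hdn.ne' 2
  have hK_pos : 0 < K := Nat.pos_of_mul_pos_right (by lia : 0 < K * (2 ^ n - 1))
  have hK_le : K ≤ 2 ^ (d * n) :=
    (Nat.le_mul_of_pos_right K (by lia)).trans (hK.trans_le (Nat.sub_le _ _))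
  obtain ⟨pv, hpv⟩ := exists_forall_isPivot hn hK
  let o : Fin d := ⟨d - 1, by lia⟩
  have ho : (o : ℕ) + 1 = d := Nat.sub_add_cancel hd
  let A (y : Fin K) := expandMatrix b (lineMatrix o (pv y) (direction b (pv y) y))
  have hA (y : Fin K) : A y * A y = 1 := by
    rw [← map_mul, lineMatrix_mul_self (direction_pivot b _ _)
      (fun h => direction_last b ho h _), map_one]
  obtain ⟨l, hl, h_mem, h_length⟩ := (ComputableWithin.entries_expandMatrix_lineMatrix
    (b := b) hpv hd hn o).exists_isProgram
  have h_entries (i k) : (fun y => A y i k) ∈ l := h_mem _ (mem_entries _ i k)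
  obtain ⟨P, h_size, hP⟩ := hl.exists_gepp hs hdn hK_pos hK_le hA h_entries h_entries
    (by rw [one_mul, hK]) fun x hx => card_filter_expandMatrix_lineMatrix b hpv hK_le hF hK ho hs hx
  exact ⟨P, gepp_size_le hdn h_length h_size, hP⟩

theorem size_le_logb {s C a N K : ℕ} (h : s ≤ C * a ^ 4) (hN : N = 2 ^ a) :
    (s : ℝ) ≤ C * (Real.logb 2 N + Real.logb 2 K) ^ 4 := by
  have h_logb_N : Real.logb 2 N = a := by
    rw [hN, Nat.cast_pow, Nat.cast_ofNat, Real.logb_pow, Real.logb_self_eq_one one_lt_two, mul_one]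
  have h_logb_K : 0 ≤ Real.logb 2 K := by
    rcases K.eq_zero_or_pos with rfl | hK
    · simp
    · exact Real.logb_nonneg one_lt_two (Nat.one_le_cast.2 hK)
  calc (s : ℝ) ≤ C * (a : ℝ) ^ 4 := by exact_mod_cast h
    _ ≤ C * (Real.logb 2 N + Real.logb 2 K) ^ 4 := by
      rw [h_logb_N]
      gcongr
      exact le_add_of_nonneg_right h_logb_K

end Purification

end

theorem theorem2 :
    (∃ (C : ℝ) (c : ℕ), ∀ n t : ℕ, t < n →
      ∃ P : Purification.GEPP (2 ^ n) (2 ^ n - 1) (2 ^ (n - t) * (2 ^ n - 1)),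
        (P.size : ℝ) ≤ C * (Real.logb 2 ((2 ^ n : ℕ) : ℝ) +
          Real.logb 2 ((2 ^ n - 1 : ℕ) : ℝ)) ^ c ∧
        ∀ ε : ℝ, ε < 1 / 2 →
          P.DetSuccessful ε (2 * ε / 2 ^ t) ε ∧
          (ε ≤ 2 ^ t / 2 ^ n → P.DetSuccessful ε (ε / 2 ^ t) ε)) ∧
    (∃ (C : ℝ) (c : ℕ), ∀ n : ℕ, 0 < n →
      ∃ P : Purification.GEPP (2 ^ (2 * n)) (2 ^ n + 1) (2 ^ n * (2 ^ n + 1)),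
        (P.size : ℝ) ≤ C * (Real.logb 2 ((2 ^ (2 * n) : ℕ) : ℝ) +
          Real.logb 2 ((2 ^ n + 1 : ℕ) : ℝ)) ^ c ∧
        ∀ ε : ℝ, ε < 1 / 2 →
          P.DetSuccessful ε (2 * ε / 2 ^ n) ε ∧
          (ε ≤ 2 ^ n / 2 ^ (2 * n) → P.DetSuccessful ε (ε / 2 ^ n) ε)) ∧
    (∃ (C : ℝ) (c : ℕ), ∀ d n : ℕ, 0 < d → 0 < n →
      ∃ P : Purification.GEPP (2 ^ (d * n)) ((2 ^ (d * n) - 1) / (2 ^ n - 1))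
          (2 ^ ((d - 1) * n) * ((2 ^ (d * n) - 1) / (2 ^ n - 1))),
        (P.size : ℝ) ≤ C * (Real.logb 2 ((2 ^ (d * n) : ℕ) : ℝ) +
          Real.logb 2 (((2 ^ (d * n) - 1) / (2 ^ n - 1) : ℕ) : ℝ)) ^ c ∧
        ∀ ε : ℝ, ε < 1 / 2 →
          P.DetSuccessful ε (2 * ε / 2 ^ n) ε ∧
          (ε ≤ 2 ^ n / 2 ^ (d * n) → P.DetSuccessful ε (ε / 2 ^ n) ε)) := by
  refine ⟨⟨501, 4, fun n t ht => ?_⟩, ⟨421, 4, fun n hn => ?_⟩, ⟨421, 4, fun d n hd hn => ?_⟩⟩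
  · obtain ⟨P, h_size, hP⟩ := Purification.exists_gepp_field ht
    exact ⟨P, by exact_mod_cast Purification.size_le_logb h_size rfl, hP⟩
  · have hK : (2 ^ n + 1) * (2 ^ n - 1) = 2 ^ (2 * n) - 1 := by
      rw [← Nat.sq_sub_sq, mul_comm 2 n, pow_mul, one_pow]
    obtain ⟨P, h_size, hP⟩ := Purification.exists_gepp_lines two_pos hn (two_mul n).symm hK
    exact ⟨P, by exact_mod_cast Purification.size_le_logb h_size rfl, hP⟩
  · have h_dvd : 2 ^ n - 1 ∣ 2 ^ (d * n) - 1 := by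
      rw [mul_comm, pow_mul]
      simpa using Nat.sub_dvd_pow_sub_pow (2 ^ n) 1 d
    have ha : (d - 1) * n + n = d * n := by
      rw [← Nat.succ_mul, Nat.succ_eq_add_one, Nat.sub_add_cancel hd]
    obtain ⟨P, h_size, hP⟩ := Purification.exists_gepp_lines hd hn ha (Nat.div_mul_cancel h_dvd)
    exact ⟨P, by exact_mod_cast Purification.size_le_logb h_size rfl, hP⟩
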